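/- Let $\Sigma$ and $\Pi$ be disjoint finite alphabets of static symbols and of parameter symbols, with $|\Pi|\ge 1$ and $|\Sigma|+|\Pi|\ge 2$. The prev-encoding $\mathrm{prev}(S)$ of $S\in(\Sigma\cup\Pi)^*$ is the string over $\Sigma\cup\mathbb N$ of length $|S|$ that is obtained from $S$ by replacing each occurrence of a parameter by its distance to the previous occurrence of the same parameter in $S$, or by $0$ if there is none. The parameterized suffix tree of $S$ is the path-compacted (Patricia) tree for the set $\{\mathrm{prev}(T) : T \text{ a suffix of } S\}$ (the empty suffix included): its nodes are the members of this set and the branching nodes of the trie for it. It is stored as a linked data structure: each node has its parent, its string length and an occurrence in $S$ (so that edge labels are references to the stored string $\mathrm{prev}(S)$), and the edges leaving a node are kept, under the first symbols of their labels, in a binary search tree of height $O(\log(|\Sigma|+|\Pi|))$. **Corollary.** There is an online algorithm, the same for all $\Sigma$ and $\Pi$, that reads a string $S\in(\Sigma\cup\Pi)^*$ from right to left and, after each symbol read, holds in memory the parameterized suffix tree of the suffix of $S$ read so far; for a string of length $n\ge 1$ it takes $O(n\,|\Pi|\log(|\Sigma|+|\Pi|))$ time and $O(n)$ space in total. The model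 is a random access machine whose unit-cost operations are constant loading, copying, addition, subtraction, comparison and indirect array access, and in which symbols are given as distinct natural numbers within each alphabet; if these are at most $B$, all numbers that occur are $O(n+B)$. The implied constants are absolute. -/

import Mathlib

namespace PSuffixTree

/-! ## Parameterized strings, prev-encoding and the parameterized suffix tree

`A` is the alphabet of static symbols and `P` the alphabet of parameter symbols.  A p-string is a
`List (A ⊕ P)`, and its prev-encoding is a string over `A ⊕ ℕ`. -/

section Strings

variable {A P : Type*} [DecidableEq A] [DecidableEq P]

/-- The distance from the position just after `w` back to the last occurrence of the parameter `p`
in `w`; it is `0` if `p` does not occur in `w`. -/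
def prevDist (w : List (A ⊕ P)) (p : P) : ℕ :=
  let i := w.reverse.findIdx fun c => decide (c = Sum.inr p)
  if i < w.length then i + 1 else 0

/-- The prev-encoding of a p-string: static symbols stay, a parameter is replaced by the distance
to its previous occurrence, or by `0` if there is none. -/
def prevEnc (S : List (A ⊕ P)) : List (A ⊕ ℕ) :=
  S.mapIdx fun i c =>
    match c with
    | Sum.inl a => Sum.inl a
    | Sum.inr p => Sum.inr (prevDist (S.take i) p)

/-- The set of the prev-encoded suffixes of `S` (the empty suffix included). -/
def PSuffix (S : List (A ⊕ P)) : Set (List (A ⊕ ℕ)) :=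
  {x | ∃ T, T <:+ S ∧ x = prevEnc T}

end Strings

/-- The nodes of the trie for a set `L` of strings, identified with the strings they spell. -/
def IsTrieNode {α : Type*} (L : Set (List α)) (x : List α) : Prop :=
  ∃ y ∈ L, x <+: y

/-- The nodes of the path-compacted (Patricia) tree for a set `L` of strings: the members of `L`
and the branching nodes of the trie. -/
def IsPatriciaNode {α : Type*} (L : Set (List α)) (x : List α) : Prop :=
  x ∈ L ∨ ∃ a b : α, a ≠ b ∧ IsTrieNode L (x ++ [a]) ∧ IsTrieNode L (x ++ [b])

/-- The edges `(x, y, x ++ y)` of the path-compacted tree for `L`, from the node `x` to its child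
`x ++ y`, with the nonempty label `y`. -/
def IsPatriciaEdge {α : Type*} (L : Set (List α)) (x y : List α) : Prop :=
  IsPatriciaNode L x ∧ IsPatriciaNode L (x ++ y) ∧ y ≠ [] ∧
    ∀ z, IsPatriciaNode L z → x <+: z → z <+: x ++ y → z = x ∨ z = x ++ y

section Tree

variable {A P : Type*} [DecidableEq A] [DecidableEq P]

/-- The nodes of the parameterized suffix tree of `S`. -/
def IsNode (S : List (A ⊕ P)) (x : List (A ⊕ ℕ)) : Prop :=
  IsPatriciaNode (PSuffix S) x

/-- The edges of the parameterized suffix tree of `S`. -/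
def IsEdge (S : List (A ⊕ P)) (x y : List (A ⊕ ℕ)) : Prop :=
  IsPatriciaEdge (PSuffix S) x y

end Tree

/-! ## A random access machine with a step count

A machine has registers holding natural numbers and arrays of natural numbers.  A program mentions
only finitely many registers and finitely many arrays, all by constant names; array cells are
addressed indirectly through registers. -/

/-- `reg r` is the content of register `r` and `mem k i` that of cell `i` of array `k`.  The last
three components are counters which programs cannot inspect: the number of steps made so far, one
plus the largest array index accessed so far (in any array), and the largest number that has been
written to a register or to an array cell so far. -/
structure State where
  reg : ℕ → ℕ
  mem : ℕ → ℕ → ℕ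
  time : ℕ
  space : ℕ
  word : ℕ

/-- Everything is zero at the beginning. -/
def State.start : State := ⟨fun _ => 0, fun _ _ => 0, 0, 0, 0⟩

/-- One step that writes `v` to register `d`. -/
def State.setReg (s : State) (d v : ℕ) : State :=
  { s with reg := Function.update s.reg d v, time := s.time + 1, word := max s.word v }

/-- One step that writes `v` to cell `i` of array `k`. -/
def State.setMem (s : State) (k i v : ℕ) : State :=
  { s with
    mem := Function.update s.mem k (Function.update (s.mem k) i v)
    time := s.time + 1
    space := max s.space (i + 1)
    word := max s.word v }

/-- Records an access to index `i` of some array (the step is counted by the instruction). -/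
def State.touch (s : State) (i : ℕ) : State :=
  { s with space := max s.space (i + 1) }

/-- One step without any effect. -/
def State.tick (s : State) : State := { s with time := s.time + 1 }

/-- Elementary instructions; `d`, `a`, `b`, `i` are names of registers, `k` is the name of an
array, and `c` is a constant. -/
inductive Instr where
  | const (d c : ℕ)
  | copy (d a : ℕ)
  | add (d a b : ℕ)
  | sub (d a b : ℕ)
  | load (d k i : ℕ)
  | store (k i a : ℕ)

/-- The effect of an elementary instruction; each of them costs one step. -/
def Instr.run (s : State) : Instr → State
  | .const d c => s.setReg d c
  | .copy d a => s.setReg d (s.reg a)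
  | .add d a b => s.setReg d (s.reg a + s.reg b)
  | .sub d a b => s.setReg d (s.reg a - s.reg b)
  | .load d k i => (s.touch (s.reg i)).setReg d (s.mem k (s.reg i))
  | .store k i a => s.setMem k (s.reg i) (s.reg a)

/-- Tests comparing two registers. -/
inductive Test where
  | eq (a b : ℕ)
  | lt (a b : ℕ)

/-- The outcome of a test. -/
def Test.holds (s : State) : Test → Prop
  | .eq a b => s.reg a = s.reg b
  | .lt a b => s.reg a < s.reg b

/-- Structured programs. -/
inductive Prog where
  | skip
  | instr (c : Instr)
  | seq (p q : Prog)
  | ite (t : Test) (p q : Prog)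
  | loop (t : Test) (p : Prog)

/-- `Exec p s s'`: the program `p`, started in state `s`, halts in state `s'`.  Every elementary
instruction, every evaluation of a test and every `skip` costs one step. -/
inductive Exec : Prog → State → State → Prop where
  | skip (s : State) : Exec .skip s s.tick
  | instr (c : Instr) (s : State) : Exec (.instr c) s (c.run s)
  | seq {p q : Prog} {s s₁ s₂ : State} :
      Exec p s s₁ → Exec q s₁ s₂ → Exec (.seq p q) s s₂
  | ite_true {t : Test} {p q : Prog} {s s₁ : State} :
      t.holds s → Exec p s.tick s₁ → Exec (.ite t p q) s s₁
  | ite_false {t : Test} {p q : Prog} {s s₁ : State} :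
      ¬ t.holds s → Exec q s.tick s₁ → Exec (.ite t p q) s s₁
  | loop_done {t : Test} {p : Prog} {s : State} :
      ¬ t.holds s → Exec (.loop t p) s s.tick
  | loop_step {t : Test} {p : Prog} {s s₁ s₂ : State} :
      t.holds s → Exec p s.tick s₁ → Exec (.loop t p) s₁ s₂ → Exec (.loop t p) s s₂

/-! ## Online algorithms that read a string from right to left -/

/-- An online algorithm: a program `init` that is run once, before anything is read, and a program
`step` that is run after each symbol that is read. -/
structure OnlineAlgorithm where
  init : Prog
  step : Prog

/-- The code of a symbol of `A ⊕ B` as a pair of numbers: a tag, which tells the two alphabets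
apart, and a value. -/
def symCode {A B : Type*} (cA : A → ℕ) (cB : B → ℕ) : A ⊕ B → ℕ × ℕ
  | Sum.inl a => (0, cA a)
  | Sum.inr b => (1, cB b)

/-- Reading one symbol puts its code into the registers `0` and `1`, in two steps. -/
def State.read (s : State) (c : ℕ × ℕ) : State := (s.setReg 0 c.1).setReg 1 c.2

/-- `alg.Runs cA cP S s`: after the algorithm has read the string `S` from right to left and has
processed its last symbol read (the first symbol of `S`), it is in state `s`. -/
inductive OnlineAlgorithm.Runs {A P : Type*} (alg : OnlineAlgorithm) (cA : A → ℕ) (cP : P → ℕ) :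
    List (A ⊕ P) → State → Prop where
  | nil {s : State} : Exec alg.init State.start s → alg.Runs cA cP [] s
  | cons {a : A ⊕ P} {S : List (A ⊕ P)} {s s' : State} :
      alg.Runs cA cP S s → Exec alg.step (s.read (symCode cA cP a)) s' →
      alg.Runs cA cP (a :: S) s'

/-! ## The parameterized suffix tree as a data structure in memory -/

/-- Arrays `0` and `1` hold the prev-encoding of the text (tags and values). -/
def tagArr : ℕ := 0
/-- See `tagArr`. -/
def valArr : ℕ := 1
/-- Cell `0` of this array holds the number of the root of the tree. -/
def rootArr : ℕ := 2
/-- Indexed by tree nodes: the parent. -/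
def parentArr : ℕ := 3
/-- Indexed by tree nodes: the length of the string spelled by the node. -/
def lenArr : ℕ := 4
/-- Indexed by tree nodes: the position of an occurrence in the text of the string spelled by the
node. -/
def posArr : ℕ := 5
/-- Indexed by tree nodes: a pointer to the dictionary of the outgoing edges. -/
def dictArr : ℕ := 6
/-- Indexed by dictionary cells: pointer to the left subtree. -/
def leftArr : ℕ := 7
/-- Indexed by dictionary cells: pointer to the right subtree. -/
def rightArr : ℕ := 8
/-- Indexed by dictionary cells: the tag of the key. -/
def keyTagArr : ℕ := 9
/-- Indexed by dictionary cells: the value of the key. -/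
def keyValArr : ℕ := 10
/-- Indexed by dictionary cells: the tree node stored under the key. -/
def targetArr : ℕ := 11

/-- `BinTree m p d h`: the pointer `p` is the root of a binary tree in the memory `m` of height
`h` whose entries (key, target) in symmetric order form the list `d`; `0` is the null pointer. -/
inductive BinTree (m : ℕ → ℕ → ℕ) : ℕ → List ((ℕ × ℕ) × ℕ) → ℕ → Prop where
  | nil : BinTree m 0 [] 0
  | node {p : ℕ} {l r : List ((ℕ × ℕ) × ℕ)} {h₁ h₂ : ℕ} :
      p ≠ 0 → BinTree m (m leftArr p) l h₁ → BinTree m (m rightArr p) r h₂ →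
      BinTree m p (l ++ ((m keyTagArr p, m keyValArr p), m targetArr p) :: r) (max h₁ h₂ + 1)

/-- `BinSearchTree m p d h`: moreover, the keys increase strictly in the lexicographic order. -/
def BinSearchTree (m : ℕ → ℕ → ℕ) (p : ℕ) (d : List ((ℕ × ℕ) × ℕ)) (h : ℕ) : Prop :=
  BinTree m p d h ∧ d.Pairwise fun e f => toLex e.1 < toLex f.1

/-- The memory `m` holds the parameterized suffix tree of `S`, the node spelling `x` having the
number `num x`.  Positions of `S` are counted from the right end, in the order in which they are
read.  The label of an edge is given by reference to the text: if `v` is the lower end of the edge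
and `u` the upper one, it consists of the last `|v| - |u|` symbols of `v`, and `v` is a prefix of
the prev-encoding of the suffix of `S` whose length is stored with `v`; the `j`-th symbol of that
encoding (counted from zero) is the corresponding symbol of the prev-encoding of `S`, or `0` if
that is a number larger than `j`.  The edges that leave a node are in a binary search tree of
height at most `H`, under the first symbols of their labels. -/
structure HoldsTree {A P : Type*} [DecidableEq A] [DecidableEq P] (cA : A → ℕ)
    (m : ℕ → ℕ → ℕ) (S : List (A ⊕ P)) (H : ℝ) (num : List (A ⊕ ℕ) → ℕ) : Prop where
  text : ∀ (i : ℕ) (c : A ⊕ ℕ), (prevEnc S)[i]? = some c →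
    (m tagArr (S.length - 1 - i), m valArr (S.length - 1 - i)) = symCode cA id c
  inj : ∀ x y, IsNode S x → IsNode S y → num x = num y → x = y
  root : m rootArr 0 = num []
  len : ∀ x, IsNode S x → m lenArr (num x) = x.length
  pos : ∀ x, IsNode S x → ∃ T, T <:+ S ∧ T.length = m posArr (num x) ∧ x <+: prevEnc T
  parent : ∀ x y, IsEdge S x y → m parentArr (num (x ++ y)) = num x
  children : ∀ x, IsNode S x → ∃ (d : List ((ℕ × ℕ) × ℕ)) (h : ℕ),
    BinSearchTree m (m dictArr (num x)) d h ∧ (h : ℝ) ≤ H ∧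
    ∀ (k : ℕ × ℕ) (t : ℕ), (k, t) ∈ d ↔
      ∃ (c : A ⊕ ℕ) (y : List (A ⊕ ℕ)),
        IsEdge S x (c :: y) ∧ k = symCode cA id c ∧ t = num (x ++ c :: y)

end PSuffixTree

namespace PSuffixTree

/-! ## A program logic for the machine -/

-- The construction is Weiner's right-to-left algorithm, adapted to prev-encodings. Write F for
-- `prevEnc (a :: T)`. When the symbol a is prepended to T, only two strings can become nodes
-- (`isNode_cons`): the leaf F, and the longest prefix h of F in the old trie. So for each symbol
-- read the task is to find h, to split an edge if h is not yet a node, and to hang the leaf below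
-- h; `cov_insert_mid` and `cov_insert_leaf` say what happens to the edges.
--
-- Everything about the search rests on one fact, `getElem?_prevEnc_cons_succ`: behind its first
-- symbol, F is `prevEnc T`, except that one 0, at the next occurrence of a, is replaced by a
-- distance. It has three consequences. Firstly, a prefix x of `prevEnc T` of length ℓ, together
-- with a key (the static symbol, or the distance if it is at most ℓ), determines the prefix of F of
-- length ℓ + 1 (`IsLink.target_unique`), and conversely (`IsLink.source_unique`). Each node is
-- therefore the target of at most one link, and links between nodes can be stored in linear space.
-- Secondly, F and another encoding `prevEnc (b :: U)`, where `b :: U` is a suffix of T, can differ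
-- for the first time beyond the first symbol only directly after a prefix whose tail is a node on
-- the path to `prevEnc T`, or at the next occurrence of a or of b (`mismatch`). Thirdly, the tail
-- of a node that is a nonempty prefix of F is again a node unless it is followed by 0 in `prevEnc
-- T` (`isNode_tail`); an encoding has at most |Π| zeros (`card_zeros_le`). In ordinary suffix trees
-- there are no such exceptions; they are the source of the factor |Π|.
--
-- The search for h: from the leaf `prevEnc T` one walks towards the root up to the first node with
-- a stored link for a, pushing the nodes passed on a stack. The link leads to a node v that is a
-- prefix of F; if there is no link, v is the root. From v one descends along F. To see how far F
-- follows the edge to a node w it suffices to compare symbols at the places allowed by `mismatch`,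
-- which are read off the stack and a table of next occurrences (`take_eq_of_candidates`). If F
-- reaches w and the tail of w is on the stack, then a link was missing and is inserted; otherwise
-- the tail of w is no node, and a new zero of `prevEnc T` has been passed.
--
-- The time is amortised over the number of ancestors of the latest leaf, counted by `cnt`. Each
-- node on the stack is an ancestor of the old leaf that is left behind, and `cnt_tail` compares the
-- ancestors of F above v with those of `prevEnc T`. Each edge of the descent adds one ancestor and
-- is paid for by a new link or by a zero. As there are at most 2n + 1 nodes and no more links than
-- nodes, the walks and descents make O(n |Π|) dictionary operations. Finding a parameter in the
-- list of those seen so far costs O(|Π|) per symbol.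
--
-- A dictionary operation takes logarithmic time since the dictionaries are AVL trees with at most
-- |Σ| + |Π| + 1 keys: the nonzero numbers that can follow a string are distances to last
-- occurrences of different parameters (`card_succ_le`), and the nonzero keys of links point at
-- zeros. The invariant `Inv` contains the potential inequality, `stepProg_spec` preserves it, and
-- each specification of a program carries an explicit bound on the number of steps.

infixr:67 " ;; " => Prog.seq

/-- `d := c`. -/
abbrev setC (d c : ℕ) : Prog := .instr (.const d c)
/-- `d := a`. -/
abbrev setR (d a : ℕ) : Prog := .instr (.copy d a)
/-- `d := a + b`. -/
abbrev addR (d a b : ℕ) : Prog := .instr (.add d a b)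
/-- `d := a - b`. -/
abbrev subR (d a b : ℕ) : Prog := .instr (.sub d a b)
/-- `d := k[i]`. -/
abbrev ldR (d k i : ℕ) : Prog := .instr (.load d k i)
/-- `k[i] := a`. -/
abbrev stR (k i a : ℕ) : Prog := .instr (.store k i a)

section Projections

variable (s : State) (d v k i r : ℕ)

@[simp] theorem State.setReg_reg :
    (s.setReg d v).reg r = if r = d then v else s.reg r := by
  simp [State.setReg, Function.update_apply]
@[simp] theorem State.setReg_mem : (s.setReg d v).mem = s.mem := rfl
@[simp] theorem State.setReg_time : (s.setReg d v).time = s.time + 1 := rfl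
@[simp] theorem State.setMem_reg : (s.setMem k i v).reg = s.reg := rfl
@[simp] theorem State.setMem_mem :
    (s.setMem k i v).mem = Function.update s.mem k (Function.update (s.mem k) i v) := rfl
@[simp] theorem State.setMem_time : (s.setMem k i v).time = s.time + 1 := rfl
@[simp] theorem State.touch_reg : (s.touch i).reg = s.reg := rfl
@[simp] theorem State.touch_mem : (s.touch i).mem = s.mem := rfl
@[simp] theorem State.touch_time : (s.touch i).time = s.time := rfl
@[simp] theorem State.tick_reg : s.tick.reg = s.reg := rfl
@[simp] theorem State.tick_mem : s.tick.mem = s.mem := rfl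
@[simp] theorem State.tick_time : s.tick.time = s.time + 1 := rfl

end Projections

attribute [simp] Test.holds

/-- All indices accessed so far are less than `X`, all numbers written so far and all numbers
stored are at most `W`. -/
def State.Ok (X W : ℕ) (s : State) : Prop :=
  s.space ≤ X ∧ s.word ≤ W ∧ (∀ r, s.reg r ≤ W) ∧ ∀ k i, s.mem k i ≤ W

/-- From a state that respects the bounds `X` and `W`, the program halts in a state that respects
them and satisfies `Q`. -/
def wp (X W : ℕ) (p : Prog) (Q : State → Prop) (s : State) : Prop :=
  s.Ok X W → ∃ s', Exec p s s' ∧ s'.Ok X W ∧ Q s'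

/-- A verification condition for `wp` that can be computed by unfolding, except for loops. -/
def vc (X W : ℕ) : Prog → (State → Prop) → State → Prop
  | .skip, Q, s => Q s.tick
  | .instr (.const d c), Q, s => c ≤ W ∧ Q (s.setReg d c)
  | .instr (.copy d a), Q, s => Q (s.setReg d (s.reg a))
  | .instr (.add d a b), Q, s => s.reg a + s.reg b ≤ W ∧ Q (s.setReg d (s.reg a + s.reg b))
  | .instr (.sub d a b), Q, s => Q (s.setReg d (s.reg a - s.reg b))
  | .instr (.load d k i), Q, s =>
      s.reg i < X ∧ Q ((s.touch (s.reg i)).setReg d (s.mem k (s.reg i)))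
  | .instr (.store k i a), Q, s => s.reg i < X ∧ Q (s.setMem k (s.reg i) (s.reg a))
  | .seq p q, Q, s => vc X W p (vc X W q Q) s
  | .ite t p q, Q, s => (t.holds s → vc X W p Q s.tick) ∧ (¬ t.holds s → vc X W q Q s.tick)
  | .loop t p, Q, s => wp X W (.loop t p) Q s

variable {X W : ℕ} {p q : Prog} {Q Q' : State → Prop} {s : State}

theorem State.Ok.setReg (h : s.Ok X W) {d v : ℕ} (hv : v ≤ W) : (s.setReg d v).Ok X W := by
  obtain ⟨h1, h2, h3, h4⟩ := h
  refine ⟨h1, max_le h2 hv, fun r => ?_, h4⟩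
  rw [State.setReg_reg]
  split_ifs
  exacts [hv, h3 r]

theorem State.Ok.setMem (h : s.Ok X W) {k i v : ℕ} (hi : i < X) (hv : v ≤ W) :
    (s.setMem k i v).Ok X W := by
  obtain ⟨h1, h2, h3, h4⟩ := h
  refine ⟨max_le h1 hi, max_le h2 hv, h3, fun k' i' => ?_⟩
  rw [State.setMem_mem, Function.update_apply]
  split_ifs
  · rw [Function.update_apply]
    split_ifs
    exacts [hv, h4 _ _]
  · exact h4 _ _

theorem State.Ok.touch (h : s.Ok X W) {i : ℕ} (hi : i < X) : (s.touch i).Ok X W :=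
  ⟨max_le h.1 hi, h.2⟩

theorem State.Ok.tick (h : s.Ok X W) : s.tick.Ok X W := h

theorem wp.mono (h : wp X W p Q s) (hQ : ∀ s', Q s' → Q' s') : wp X W p Q' s := fun hs =>
  let ⟨s', h1, h2, h3⟩ := h hs
  ⟨s', h1, h2, hQ s' h3⟩

theorem wp.seq (h : wp X W p Q' s) (h' : ∀ s', Q' s' → wp X W q Q s') :
    wp X W (p ;; q) Q s := fun hs =>
  let ⟨_, h1, h2, h3⟩ := h hs
  let ⟨s'', h4, h5, h6⟩ := h' _ h3 h2
  ⟨s'', .seq h1 h4, h5, h6⟩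

theorem wp_ite {t : Test} (h : t.holds s → wp X W p Q s.tick)
    (h' : ¬ t.holds s → wp X W q Q s.tick) : wp X W (.ite t p q) Q s := fun hs => by
  by_cases ht : t.holds s
  · obtain ⟨s', h1, h2⟩ := h ht hs.tick
    exact ⟨s', .ite_true ht h1, h2⟩
  · obtain ⟨s', h1, h2⟩ := h' ht hs.tick
    exact ⟨s', .ite_false ht h1, h2⟩

/-- The side conditions in `vc` are those that `State.Ok` needs: only constants and sums can exceed
`W`, and only array accesses can exceed `X`. Copies, truncated differences and loaded values are
bounded by numbers that are already stored. -/
theorem wp_of_vc : ∀ {p : Prog} {Q : State → Prop} {s : State}, vc X W p Q s → wp X W p Q s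
  | .skip, _, s, h => fun hs => ⟨_, .skip s, hs.tick, h⟩
  | .instr (.const _ _), _, _, h => fun hs => ⟨_, .instr _ _, hs.setReg h.1, h.2⟩
  | .instr (.copy _ a), _, _, h => fun hs => ⟨_, .instr _ _, hs.setReg (hs.2.2.1 a), h⟩
  | .instr (.add _ _ _), _, _, h => fun hs => ⟨_, .instr _ _, hs.setReg h.1, h.2⟩
  | .instr (.sub _ a _), _, _, h => fun hs =>
      ⟨_, .instr _ _, hs.setReg ((Nat.sub_le _ _).trans (hs.2.2.1 a)), h⟩
  | .instr (.load _ k i), _, s, h => fun hs =>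
      ⟨_, .instr _ _, (hs.touch h.1).setReg (hs.2.2.2 k (s.reg i)), h.2⟩
  | .instr (.store _ _ a), _, _, h => fun hs => ⟨_, .instr _ _, hs.setMem h.1 (hs.2.2.1 a), h.2⟩
  | .seq _ _, _, _, h => wp.seq (wp_of_vc h) fun _ h' => wp_of_vc h'
  | .ite _ _ _, _, _, h => wp_ite (fun ht => wp_of_vc (h.1 ht)) fun ht => wp_of_vc (h.2 ht)
  | .loop _ _, _, _, h => h

/-- Loops are treated with an invariant that is indexed by a variant. -/
theorem wp_loop {t : Test} (I : ℕ → State → Prop)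
    (hstep : ∀ n s, I n s → t.holds s → wp X W p (fun s' => ∃ n' < n, I n' s') s.tick)
    (hdone : ∀ n s, I n s → ¬ t.holds s → Q s.tick) :
    ∀ (n : ℕ) (s : State), I n s → wp X W (.loop t p) Q s := by
  intro n
  induction n using Nat.strong_induction_on with
  | _ n ih =>
    intro s hI hs
    by_cases ht : t.holds s
    · obtain ⟨s₁, h1, h2, n', hn, hI'⟩ := hstep n s hI ht hs.tick
      obtain ⟨s₂, h3, h4⟩ := ih n' hn s₁ hI' h2
      exact ⟨s₂, .loop_step ht h1 h3, h4⟩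
    · exact ⟨_, .loop_done ht, hs.tick, hdone n s hI ht⟩

/-! ### The frame rule. -/

/-- Whether the register `r` occurs as a target in the program. -/
def Prog.writesReg (r : ℕ) : Prog → Bool
  | .skip => false
  | .instr (.const d _) => r == d
  | .instr (.copy d _) => r == d
  | .instr (.add d _ _) => r == d
  | .instr (.sub d _ _) => r == d
  | .instr (.load d _ _) => r == d
  | .instr (.store _ _ _) => false
  | .seq p q => p.writesReg r || q.writesReg r
  | .ite _ p q => p.writesReg r || q.writesReg r
  | .loop _ p => p.writesReg r

/-- Whether the array `k` occurs as a target in the program. -/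
def Prog.writesArr (k : ℕ) : Prog → Bool
  | .instr (.store k' _ _) => k == k'
  | .seq p q => p.writesArr k || q.writesArr k
  | .ite _ p q => p.writesArr k || q.writesArr k
  | .loop _ p => p.writesArr k
  | _ => false

theorem Exec.reg_eq {r : ℕ} {s' : State} (h : Exec p s s') (hr : p.writesReg r = false) :
    s'.reg r = s.reg r := by
  induction h with
  | skip => rfl
  | instr c s =>
    cases c <;> simp_all [Prog.writesReg, Instr.run]
  | seq _ _ ih1 ih2 => simp_all [Prog.writesReg]
  | ite_true _ _ ih => simp_all [Prog.writesReg]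
  | ite_false _ _ ih => simp_all [Prog.writesReg]
  | loop_done => rfl
  | loop_step _ _ _ ih1 ih2 => simp_all [Prog.writesReg]

theorem Exec.mem_eq {k : ℕ} {s' : State} (h : Exec p s s') (hk : p.writesArr k = false) :
    s'.mem k = s.mem k := by
  induction h with
  | skip => rfl
  | instr c s =>
    cases c <;> simp_all [Prog.writesArr, Instr.run]
  | seq _ _ ih1 ih2 => simp_all [Prog.writesArr]
  | ite_true _ _ ih => simp_all [Prog.writesArr]
  | ite_false _ _ ih => simp_all [Prog.writesArr]
  | loop_done => rfl
  | loop_step _ _ _ ih1 ih2 => simp_all [Prog.writesArr]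

/-- A program does not change the registers and arrays that are not among its targets. -/
structure Frame (p : Prog) (s s' : State) : Prop where
  reg : ∀ r, p.writesReg r = false → s'.reg r = s.reg r
  mem : ∀ k, p.writesArr k = false → s'.mem k = s.mem k

/-- Which registers and arrays a program writes to is decided by evaluation. Hence the
specifications below mention only what changes; the rest is recovered from `Frame`, mostly by `rfl`.
-/
theorem wp.frame (h : wp X W p Q s) : wp X W p (fun s' => Q s' ∧ Frame p s s') s := fun hs =>
  let ⟨s', h1, h2, h3⟩ := h hs
  ⟨s', h1, h2, h3, fun _ hr => h1.reg_eq hr, fun _ hk => h1.mem_eq hk⟩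

theorem wp.seq_frame (h : wp X W p Q' s) (h' : ∀ s', Q' s' → Frame p s s' → wp X W q Q s') :
    wp X W (p ;; q) Q s :=
  h.frame.seq fun s' hs => h' s' hs.1 hs.2

/-! ## Balanced search trees in memory -/

attribute [simp] tagArr valArr rootArr parentArr lenArr posArr dictArr leftArr rightArr keyTagArr
  keyValArr targetArr

/-- Indexed by dictionary cells: the height of the subtree. -/
@[simp] def htArr : ℕ := 12
/-- Indexed by tree nodes: a pointer to the dictionary of the links. -/
@[simp] def linkArr : ℕ := 13
/-- The stack of the nodes visited on the way towards the root. -/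
@[simp] def stkArr : ℕ := 14
/-- The stack of the cells visited by an insertion into a dictionary. -/
@[simp] def pathArr : ℕ := 15
/-- The directions taken at the cells in `pathArr`. -/
@[simp] def dirArr : ℕ := 16

/-- Binary trees of dictionary cells. -/
inductive Tr where
  | nil
  | node (p : ℕ) (l r : Tr)

namespace Tr

/-- The pointer to the tree. -/
@[simp] def root : Tr → ℕ
  | nil => 0
  | node p _ _ => p

/-- The height. -/
@[simp] def ht : Tr → ℕ
  | nil => 0
  | node _ l r => max l.ht r.ht + 1

/-- The cells in symmetric order. -/
@[simp] def cells : Tr → List ℕ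
  | nil => []
  | node p l r => l.cells ++ p :: r.cells

/-- The AVL condition. -/
@[simp] def Avl : Tr → Prop
  | nil => True
  | node _ l r => l.Avl ∧ r.Avl ∧ l.ht ≤ r.ht + 1 ∧ r.ht ≤ l.ht + 1

/-- The memory `m` represents the tree. -/
@[simp] def Rep (m : ℕ → ℕ → ℕ) : Tr → Prop
  | nil => True
  | node p l r => p ≠ 0 ∧ m leftArr p = l.root ∧ m rightArr p = r.root ∧
      m htArr p = max l.ht r.ht + 1 ∧ l.Rep m ∧ r.Rep m

/-- A node with the first subtree on the side given by `b` (`true` for left). -/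
@[simp] def mk (b : Bool) (p : ℕ) (t u : Tr) : Tr :=
  if b then node p t u else node p u t

theorem Rep.congr {m m' : ℕ → ℕ → ℕ} : ∀ {t : Tr}, t.Rep m →
    (∀ c ∈ t.cells, ∀ k, k = leftArr ∨ k = rightArr ∨ k = htArr → m' k c = m k c) → t.Rep m'
  | nil, _, _ => trivial
  | node p l r, ⟨h1, h2, h3, h4, h5, h6⟩, h => by
    refine ⟨h1, ?_, ?_, ?_, h5.congr fun c hc => h c (by simp [hc]),
      h6.congr fun c hc => h c (by simp [hc])⟩
    · rw [h p (by simp) _ (by simp), h2]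
    · rw [h p (by simp) _ (by simp), h3]
    · rw [h p (by simp) _ (by simp), h4]

theorem root_mem : ∀ {t : Tr}, t.root ≠ 0 → t.root ∈ t.cells
  | nil, h => absurd rfl h
  | node p l r, _ => by simp

theorem Rep.ne_zero {m : ℕ → ℕ → ℕ} : ∀ {t : Tr}, t.Rep m → ∀ c ∈ t.cells, c ≠ 0
  | nil, _, c, hc => by simp at hc
  | node p l r, ⟨h1, _, _, _, h5, h6⟩, c, hc => by
    simp only [cells, List.mem_append, List.mem_cons] at hc
    rcases hc with hc | rfl | hc
    exacts [h5.ne_zero c hc, h1, h6.ne_zero c hc]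

theorem Rep.root_eq_zero {m : ℕ → ℕ → ℕ} {t : Tr} (h : t.Rep m) (h0 : t.root = 0) : t = nil := by
  cases t with
  | nil => rfl
  | node p l r => exact absurd h0 h.1

theorem Rep.ht_root {m : ℕ → ℕ → ℕ} (h0 : m htArr 0 = 0) {t : Tr} (h : t.Rep m) :
    m htArr t.root = t.ht := by
  cases t with
  | nil => exact h0
  | node p l r => exact h.2.2.2.1

theorem ht_le_length : ∀ t : Tr, t.ht ≤ t.cells.length
  | nil => le_rfl
  | node p l r => by
    have := l.ht_le_length
    have := r.ht_le_length
    simp only [ht, cells, List.length_append, List.length_cons]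
    omega

/-- If the subtrees have `a` and `b` cells and heights h + 1 and h, then (a + b + 2)² = (a + 1)² +
2(a + 1)(b + 1) + (b + 1)² ≥ 2·2^h + 2·2^h + 2^h, since (a + 1)(b + 1) is at least the geometric
mean of the bounds for the two squares. This is more than 2^(h + 2). The exponent 2 is cruder than
the golden ratio but avoids Fibonacci numbers. -/
theorem Avl.two_pow_ht_le : ∀ {t : Tr}, t.Avl → 2 ^ t.ht ≤ (t.cells.length + 1) ^ 2
  | nil, _ => by simp
  | node p l r, ⟨hl, hr, h1, h2⟩ => by
    have ihl := hl.two_pow_ht_le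
    have ihr := hr.two_pow_ht_le
    simp only [ht, cells, List.length_append, List.length_cons]
    generalize l.cells.length = a at *
    generalize r.cells.length = b at *
    have key : ∀ h a b : ℕ, 2 ^ (h + 1) ≤ (a + 1) ^ 2 → 2 ^ h ≤ (b + 1) ^ 2 →
        2 ^ (h + 1 + 1) ≤ (a + (b + 1) + 1) ^ 2 := by
      intro h a b ha hb
      rw [pow_succ] at ha
      rw [pow_succ, pow_succ]
      have hab : 2 ^ h ≤ (a + 1) * (b + 1) := by
        by_contra! hlt
        have h1 : ((a + 1) * (b + 1)) * ((a + 1) * (b + 1)) < 2 ^ h * 2 ^ h :=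
          Nat.mul_self_lt_mul_self hlt
        have h2 : (2 ^ h * 2) * 2 ^ h ≤ (a + 1) ^ 2 * (b + 1) ^ 2 := Nat.mul_le_mul ha hb
        nlinarith
      nlinarith
    rcases Nat.lt_trichotomy l.ht r.ht with h | h | h
    · rw [max_eq_right h.le]
      have := key l.ht b a (by rwa [show r.ht = l.ht + 1 by omega] at ihr) ihl
      rw [show r.ht = l.ht + 1 by omega]
      calc _ ≤ _ := this
        _ = _ := by ring
    · rw [h] at ihl ⊢
      rw [max_self, pow_succ]
      nlinarith [Nat.zero_le (a * b)]
    · rw [max_eq_left h.le, show l.ht = r.ht + 1 by omega]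
      exact key r.ht a b (by rwa [show l.ht = r.ht + 1 by omega] at ihl) ihr

theorem Avl.ht_le {t : Tr} (h : t.Avl) {M : ℕ} (hM : t.cells.length ≤ M) :
    t.ht ≤ 2 * Nat.log 2 (M + 1) + 1 := by
  have h1 := h.two_pow_ht_le
  have h2 : t.cells.length + 1 < 2 ^ (Nat.log 2 (M + 1) + 1) :=
    lt_of_le_of_lt (by omega) (Nat.lt_pow_succ_log_self one_lt_two (M + 1))
  have h3 : 2 ^ t.ht < 2 ^ (2 * (Nat.log 2 (M + 1) + 1)) := by
    refine h1.trans_lt ?_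
    rw [mul_comm 2, pow_mul]
    exact Nat.pow_lt_pow_left h2 two_ne_zero
  have := (Nat.pow_lt_pow_iff_right one_lt_two).1 h3
  omega

end Tr

/-- The array of the pointers to the subtrees on a side (`true` for left). -/
def sideArr (b : Bool) : ℕ := if b then leftArr else rightArr

@[simp] theorem sideArr_true : sideArr true = 7 := rfl
@[simp] theorem sideArr_false : sideArr false = 8 := rfl

theorem sideArr_ne (b : Bool) : sideArr b ≠ sideArr (!b) ∧ sideArr b ≠ 12 ∧ sideArr (!b) ≠ 12 := by
  cases b <;> simp

namespace Tr

variable {b : Bool} {p X : ℕ} {t u : Tr}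

theorem rep_mk {m : ℕ → ℕ → ℕ} : (mk b p t u).Rep m ↔ p ≠ 0 ∧ m (sideArr b) p = t.root ∧
    m (sideArr !b) p = u.root ∧ m htArr p = max t.ht u.ht + 1 ∧ t.Rep m ∧ u.Rep m := by
  cases b <;> simp [max_comm]; tauto

theorem root_mk : (mk b p t u).root = p := by cases b <;> simp

theorem ht_mk : (mk b p t u).ht = max t.ht u.ht + 1 := by cases b <;> simp [max_comm]

theorem mem_cells_mk {c : ℕ} : c ∈ (mk b p t u).cells ↔ c = p ∨ c ∈ t.cells ∨ c ∈ u.cells := by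
  cases b <;> simp <;> tauto

theorem mk_not : mk (!b) p t u = mk b p u t := by cases b <;> simp

theorem length_cells_mk : (mk b p t u).cells.length = t.cells.length + u.cells.length + 1 := by
  cases b <;> simp <;> omega

theorem nodup_mk : (mk b p t u).cells.Nodup ↔ p ∉ t.cells ∧ p ∉ u.cells ∧ t.cells.Nodup ∧
    u.cells.Nodup ∧ ∀ c ∈ t.cells, c ∉ u.cells := by
  cases b <;> simp [List.nodup_append, List.nodup_cons] <;> grind

theorem exists_mk (b : Bool) : ∀ {t : Tr}, t.ht ≠ 0 → ∃ p t₁ t₂, t = mk b p t₁ t₂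
  | nil, h => absurd rfl h
  | node p l r, _ => by
    cases b
    exacts [⟨p, r, l, by simp⟩, ⟨p, l, r, by simp⟩]

theorem root_lt (hX : ∀ c ∈ t.cells, c < X) (h0 : 0 < X) : t.root < X := by
  by_cases h : t.root = 0
  exacts [h ▸ h0, hX _ (root_mem h)]

theorem avl_mk : (mk b p t u).Avl ↔ t.Avl ∧ u.Avl ∧ t.ht ≤ u.ht + 1 ∧ u.ht ≤ t.ht + 1 := by
  cases b <;> simp; tauto

end Tr

/-! ### Rotations and rebalancing of AVL trees. -/

/-- Recomputes the height of the cell in register `r`. -/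
def fixHt (r : ℕ) : Prog :=
  ldR 38 leftArr r ;; ldR 38 htArr 38 ;; ldR 39 rightArr r ;; ldR 39 htArr 39 ;;
  .ite (.lt 38 39) (setR 38 39) .skip ;; addR 38 38 3 ;; stR htArr r 38

/-- Rotates at the cell in register `p`; the child on the side `b` is moved up, and its number is
put into register `o`. -/
def rotate (b : Bool) (p o : ℕ) : Prog :=
  ldR 36 (sideArr b) p ;; ldR 37 (sideArr !b) 36 ;; stR (sideArr b) p 37 ;; stR (sideArr !b) 36 p ;;
  fixHt p ;; fixHt 36 ;; setR o 36

/-- Rebalances at the cell in register `27`, whose child in register `l` on the side `b` is too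
high. -/
def fixHeavy (b : Bool) (l : ℕ) : Prog :=
  (ldR 33 (sideArr b) l ;; ldR 33 htArr 33 ;; ldR 34 (sideArr !b) l ;; ldR 34 htArr 34) ;;
  .ite (.lt 33 34) (rotate (!b) l 35 ;; stR (sideArr b) 27 35) .skip ;; rotate b 27 26

/-- Restores the AVL condition at the cell in register `27`; the new root is put into register
`26`. -/
def balance : Prog :=
  (ldR 28 leftArr 27 ;; ldR 29 rightArr 27 ;; ldR 30 htArr 28 ;; ldR 31 htArr 29 ;;
    addR 32 31 3) ;;
  .ite (.lt 32 30) (fixHeavy true 28)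
    (addR 32 30 3 ;; .ite (.lt 32 31) (fixHeavy false 29) (fixHt 27 ;; setR 26 27))

section Spec

variable {X W : ℕ} {s : State}

theorem fixHt_spec {r : ℕ} (hr : r < 38) (hp : s.reg r < X) (h3 : s.reg 3 = 1)
    (hl : s.mem leftArr (s.reg r) < X) (hl' : s.mem rightArr (s.reg r) < X)
    (hW : max (s.mem htArr (s.mem leftArr (s.reg r))) (s.mem htArr (s.mem rightArr (s.reg r))) + 1
      ≤ W) :
    wp X W (fixHt r) (fun s' => s'.time ≤ s.time + 9 ∧
      s'.mem = Function.update s.mem htArr (Function.update (s.mem htArr) (s.reg r)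
        (max (s.mem htArr (s.mem leftArr (s.reg r))) (s.mem htArr (s.mem rightArr (s.reg r)))
          + 1))) s := by
  apply wp_of_vc
  have e1 : r ≠ 38 := by omega
  have e2 : r ≠ 39 := by omega
  simp only [fixHt, vc]
  simp [e1, e2, h3] at *
  refine ⟨hp, hl, hp, hl', fun h => ⟨by omega, hp, ?_⟩, fun h => ⟨by omega, hp, ?_⟩⟩
  · rw [max_eq_right h.le]
  · rw [max_eq_left h]

theorem wp_seq_vc {p q : Prog} {Q : State → Prop} (h : vc X W p (wp X W q Q) s) :
    wp X W (p ;; q) Q s :=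
  (wp_of_vc h).seq fun _ h => h

theorem fixHt_side (b : Bool) {r : ℕ} (hr : r < 38) {P x y : ℕ} (hP : s.reg r = P) (hPX : P < X)
    (h3 : s.reg 3 = 1) (hx : s.mem (sideArr b) P = x) (hy : s.mem (sideArr !b) P = y)
    (hxX : x < X) (hyX : y < X) (hW : max (s.mem htArr x) (s.mem htArr y) + 1 ≤ W) :
    wp X W (fixHt r) (fun s' => s'.time ≤ s.time + 9 ∧ s'.mem = Function.update s.mem htArr
      (Function.update (s.mem htArr) P (max (s.mem htArr x) (s.mem htArr y) + 1))) s := by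
  subst hP hx hy
  cases b
  · rw [max_comm] at hW ⊢
    exact fixHt_spec hr hPX h3 hyX hxX hW
  · exact fixHt_spec hr hPX h3 hxX hyX hW

/-- The cells `P` and `l` are different and lie in none of the three subtrees, so the pointer and
height writes leave those subtrees intact. The height of `P` is recomputed before that of `l`,
because `P` has become a child of `l`. -/
theorem rotate_spec {b : Bool} {r o : ℕ} (hr : r < 36) {P l : ℕ} {ta tx tc : Tr}
    (h0 : s.mem htArr 0 = 0) (h3 : s.reg 3 = 1) (hP : s.reg r = P)
    (hPl : s.mem (sideArr b) P = l) (hPc : s.mem (sideArr !b) P = tc.root)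
    (hla : s.mem (sideArr b) l = ta.root) (hlx : s.mem (sideArr !b) l = tx.root)
    (ra : ta.Rep s.mem) (rx : tx.Rep s.mem) (rc : tc.Rep s.mem)
    (hP0 : P ≠ 0) (hl0 : l ≠ 0) (hne : P ≠ l)
    (hPn : P ∉ ta.cells ∧ P ∉ tx.cells ∧ P ∉ tc.cells)
    (hln : l ∉ ta.cells ∧ l ∉ tx.cells ∧ l ∉ tc.cells)
    (hX : P < X ∧ l < X ∧ ta.root < X ∧ tx.root < X ∧ tc.root < X)
    (hW : ta.ht + tx.ht + tc.ht + 2 ≤ W) :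
    wp X W (rotate b r o) (fun s' => s'.time ≤ s.time + 24 ∧
      (Tr.mk b l ta (Tr.mk b P tx tc)).Rep s'.mem ∧ s'.reg o = l ∧
      ∀ k c, (k = leftArr ∨ k = rightArr ∨ k = htArr → c ≠ P ∧ c ≠ l) →
        s'.mem k c = s.mem k c) s := by
  have e1 : r ≠ 36 := by omega
  have e2 : r ≠ 37 := by omega
  have e3 : r ≠ 38 := by omega
  have e4 : r ≠ 39 := by omega
  obtain ⟨d1, d2, d3⟩ := sideArr_ne b
  obtain ⟨hX1, hX2, hX3, hX4, hX5⟩ := hX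
  -- Needed so that the second height computation reads the old height of `ta`; the root of `ta` may
  -- be the null pointer, which is why `hP0` enters.
  have hta : ta.root ≠ P := fun h => hPn.1 (h ▸ Tr.root_mem (h ▸ hP0))
  have hra := ra.ht_root h0
  have hrx := rx.ht_root h0
  have hrc := rc.ht_root h0
  refine wp_seq_vc ⟨by rw [hP]; exact hX1, wp_seq_vc ⟨by simpa [hP, hPl] using hX2, wp_seq_vc
    ⟨by simpa [e1, e2, hP] using hX1, wp_seq_vc ⟨by simpa [hP, hPl] using hX2, ?_⟩⟩⟩⟩
  suffices ∀ s₄ : State, s₄.reg r = P → s₄.reg 36 = l → s₄.reg 3 = 1 →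
      s₄.mem (sideArr b) = Function.update (s.mem (sideArr b)) P tx.root →
      s₄.mem (sideArr !b) = Function.update (s.mem (sideArr !b)) l P →
      (∀ k, k ≠ sideArr b → k ≠ sideArr !b → s₄.mem k = s.mem k) →
      s₄.time = s.time + 4 → wp X W _ _ s₄ by
    apply this
    · simp [e1, e2, hP]
    · simp [e1, e2, hP, hPl]
    · simp [h3]
    · simp [d1, e1, e2, hP, hPl, hlx]
    · simp [d1.symm, e1, e2, hP, hPl, hlx]
    · intro k h1 h2; simp [h1, h2]
    · simp
  intro s₄ f1 f2 f3 f4 f5 f6 f7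
  have g0 : s₄.mem htArr = s.mem htArr := f6 12 d2.symm d3.symm
  have rPx : s₄.mem (sideArr b) P = tx.root := by rw [f4, Function.update_self]
  have rPc : s₄.mem (sideArr !b) P = tc.root := by rw [f5, Function.update_of_ne hne, hPc]
  have rla : s₄.mem (sideArr b) l = ta.root := by rw [f4, Function.update_of_ne hne.symm, hla]
  have rlP : s₄.mem (sideArr !b) l = P := by rw [f5, Function.update_self]
  refine (fixHt_side b (by omega) f1 hX1 f3 rPx rPc hX4 hX5
    (by rw [g0, hrx, hrc]; omega)).seq_frame ?_
  rintro s₅ ⟨t5, m5⟩ fr5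
  rw [g0, hrx, hrc] at m5
  have g12 : s₅.mem htArr = Function.update (s.mem htArr) P (max tx.ht tc.ht + 1) := by
    rw [m5, Function.update_self]
  have gk : ∀ k ≠ 12, s₅.mem k = s₄.mem k := fun k hk => by
    rw [m5, Function.update_of_ne (by exact hk)]
  have g36 : s₅.reg 36 = l := by rw [← f2]; exact fr5.reg 36 (by simp [fixHt, Prog.writesReg])
  have g3 : s₅.reg 3 = 1 := by rw [← f3]; exact fr5.reg 3 (by simp [fixHt, Prog.writesReg])
  refine (fixHt_side b (by omega) g36 hX2 g3 (by rw [gk _ d2, rla]) (by rw [gk _ d3, rlP]) hX3 hX1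
    (by rw [g12, Function.update_of_ne hta, hra, Function.update_self]; omega)).seq_frame ?_
  rintro s₆ ⟨t6, m6⟩ fr6
  rw [g12, Function.update_of_ne hta, hra, Function.update_self] at m6
  have ik : ∀ k ≠ 12, s₆.mem k = s₄.mem k := fun k hk => by
    rw [m6, Function.update_of_ne (by exact hk), gk k hk]
  have i12 : s₆.mem htArr = Function.update (Function.update (s.mem htArr) P
      (max tx.ht tc.ht + 1)) l (max ta.ht (max tx.ht tc.ht + 1) + 1) := by
    rw [m6, Function.update_self]
  have i36 : s₆.reg 36 = l := by rw [← g36]; exact fr6.reg 36 (by simp [fixHt, Prog.writesReg])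
  have hmem : ∀ k c, (k = leftArr ∨ k = rightArr ∨ k = htArr → c ≠ P ∧ c ≠ l) →
      s₆.mem k c = s.mem k c := by
    intro k c h
    by_cases h12 : k = 12
    · subst h12
      obtain ⟨hc1, hc2⟩ := h (by simp)
      erw [i12]
      rw [Function.update_of_ne hc2, Function.update_of_ne hc1]
      rfl
    rw [ik k h12]
    by_cases hb : k = sideArr b
    · obtain ⟨hc1, hc2⟩ := h (by subst hb; cases b <;> simp)
      rw [hb, f4, Function.update_of_ne hc1]
    by_cases hb' : k = sideArr !b
    · obtain ⟨hc1, hc2⟩ := h (by subst hb'; cases b <;> simp)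
      rw [hb', f5, Function.update_of_ne hc2]
    rw [f6 k hb hb']
  have cg : ∀ t : Tr, t.Rep s.mem → P ∉ t.cells → l ∉ t.cells → t.Rep s₆.mem :=
    fun t ht h1 h2 => ht.congr fun c hc k _ => hmem k c fun _ =>
      ⟨fun e => h1 (e ▸ hc), fun e => h2 (e ▸ hc)⟩
  apply wp_of_vc
  simp only [vc, State.setReg_time, State.setReg_mem, State.setReg_reg, if_true]
  refine ⟨by omega, ?_, i36, hmem⟩
  rw [Tr.rep_mk, Tr.rep_mk, Tr.root_mk, Tr.ht_mk, ik _ d2, ik _ d3, i12, Function.update_self,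
    Function.update_of_ne hne, Function.update_self]
  exact ⟨hl0, rla, rlP, rfl, cg _ ra hPn.1 hln.1, hP0, rPx, rPc, rfl, cg _ rx hPn.2.1 hln.2.1,
    cg _ rc hPn.2.2 hln.2.2⟩

/-- The memories agree except for the shape of the tree on the given cells. -/
def SameOff (m m' : ℕ → ℕ → ℕ) (cs : List ℕ) : Prop :=
  ∀ k c, (k = leftArr ∨ k = rightArr ∨ k = htArr → c ∉ cs) → m' k c = m k c

-- If the inner grandchild is higher than the outer one, it is first rotated above the heavy child.
-- After that the outer grandchild is the one that makes the side too high, and a single rotation at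
-- `P` balances the tree.
set_option maxHeartbeats 800000 in
theorem fixHeavy_spec {b : Bool} {r : ℕ} (hr : r < 33) {P : ℕ} {t u : Tr}
    (h0 : s.mem htArr 0 = 0) (h3 : s.reg 3 = 1) (hP : s.reg 27 = P) (hP0 : P ≠ 0)
    (ht : s.reg r = t.root) (hPt : s.mem (sideArr b) P = t.root)
    (hPu : s.mem (sideArr !b) P = u.root) (rt : t.Rep s.mem) (ru : u.Rep s.mem) (at' : t.Avl)
    (au : u.Avl) (hh : t.ht = u.ht + 2) (hnd : (Tr.mk b P t u).cells.Nodup)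
    (hX : ∀ c ∈ (Tr.mk b P t u).cells, c < X) (hW : (Tr.mk b P t u).cells.length + 1 ≤ W) :
    wp X W (fixHeavy b r) (fun s' => s'.time ≤ s.time + 55 ∧ ∃ t' : Tr, t'.Rep s'.mem ∧ t'.Avl ∧
      t'.cells = (Tr.mk b P t u).cells ∧ (t'.ht = u.ht + 2 ∨ t'.ht = u.ht + 3) ∧
      s'.reg 26 = t'.root ∧ SameOff s.mem s'.mem t'.cells) s := by
  obtain ⟨d1, d2, d3⟩ := sideArr_ne b
  obtain ⟨l, ta, tx, rfl⟩ := Tr.exists_mk b (t := t) (by omega)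
  rw [Tr.root_mk] at ht hPt
  rw [Tr.length_cells_mk, Tr.length_cells_mk] at hW
  have ta_le := ta.ht_le_length
  have tx_le := tx.ht_le_length
  have u_le := u.ht_le_length
  rw [Tr.ht_mk] at hh
  obtain ⟨ata, atx, ah1, ah2⟩ := Tr.avl_mk.1 at'
  obtain ⟨hl0, hla, hlx, hlh, ra, rx⟩ := Tr.rep_mk.1 rt
  obtain ⟨n1, n2, n3, n4, n5⟩ := Tr.nodup_mk.1 hnd
  obtain ⟨n6, n7, n8, n9, n10⟩ := Tr.nodup_mk.1 n3
  simp only [Tr.mem_cells_mk, not_or] at n1 n5 hX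
  have hPX : P < X := hX P (.inl rfl)
  have hlX : l < X := hX l (.inr (.inl (.inl rfl)))
  have h0X : 0 < X := by omega
  have haX : ta.root < X := Tr.root_lt (fun c hc => hX c (.inr (.inl (.inr (.inl hc))))) h0X
  have hxX : tx.root < X := Tr.root_lt (fun c hc => hX c (.inr (.inl (.inr (.inr hc))))) h0X
  have huX : u.root < X := Tr.root_lt (fun c hc => hX c (.inr (.inr hc))) h0X
  have hlu : l ∉ u.cells := n5 l (.inl rfl)
  apply wp.seq (Q' := fun s₄ => s₄.reg r = l ∧ s₄.reg 27 = P ∧ s₄.reg 3 = 1 ∧ s₄.mem = s.mem ∧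
    s₄.reg 33 = ta.ht ∧ s₄.reg 34 = tx.ht ∧ s₄.time = s.time + 4)
  · have e1 : r ≠ 33 := by omega
    have e2 : r ≠ 34 := by omega
    have h1 := ra.ht_root h0
    have h2 := rx.ht_root h0
    simp only [htArr] at h1 h2
    apply wp_of_vc
    simp [vc, e1, e2, ht, hla, hlx, h1, h2, hP, h3, -Tr.root, hlX, haX, hxX]
  rintro s₄ ⟨f1, f2, f3, f4, f5, f6, f7⟩
  -- The common situation before the final rotation, with or without the preliminary one: the outer
  -- grandchild has height exactly `u.ht + 1`, and the inner one differs from `u` by at most one.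
  -- The cells in symmetric order are unchanged.
  apply wp.seq (Q' := fun s₅ => s₅.time ≤ s.time + 31 ∧ s₅.mem htArr 0 = 0 ∧ s₅.reg 27 = P ∧
    s₅.reg 3 = 1 ∧ SameOff s.mem s₅.mem (Tr.mk b P (Tr.mk b l ta tx) u).cells ∧
    u.Rep s₅.mem ∧ s₅.mem (sideArr !b) P = u.root ∧
    ∃ l' ta' tx', s₅.mem (sideArr b) P = l' ∧ (Tr.mk b l' ta' tx').Rep s₅.mem ∧
      (Tr.mk b P (Tr.mk b l' ta' tx') u).cells = (Tr.mk b P (Tr.mk b l ta tx) u).cells ∧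
      ta'.Avl ∧ tx'.Avl ∧ ta'.ht = u.ht + 1 ∧ tx'.ht ≤ u.ht + 1 ∧ u.ht ≤ tx'.ht + 1)
  · apply wp_ite
    · intro hlt
      simp only [Test.holds, f5, f6] at hlt
      obtain ⟨x, xb, xa, rfl⟩ := Tr.exists_mk (!b) (t := tx) (by omega)
      rw [Tr.root_mk] at hlx hxX
      rw [Tr.ht_mk] at hlt hh ah1 ah2 tx_le
      obtain ⟨axb, axa, ah3, ah4⟩ := Tr.avl_mk.1 atx
      obtain ⟨hx0, hxb, hxa, hxh, rxb, rxa⟩ := Tr.rep_mk.1 rx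
      obtain ⟨n11, n12, n13, n14, n15⟩ := Tr.nodup_mk.1 n9
      simp only [Tr.mem_cells_mk, not_or] at n1 n5 hX n7 n10
      have hbX : xb.root < X :=
        Tr.root_lt (fun c hc => hX c (.inr (.inl (.inr (.inr (.inr (.inl hc))))))) h0X
      have haX' : xa.root < X :=
        Tr.root_lt (fun c hc => hX c (.inr (.inl (.inr (.inr (.inr (.inr hc))))))) h0X
      have hxta : x ∉ ta.cells := fun h => (n10 x h).1 rfl
      rw [Tr.length_cells_mk] at tx_le hW
      have xa_le := xa.ht_le_length
      have xb_le := xb.ht_le_length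
      refine (rotate_spec (b := !b) (by omega) (P := l) (l := x) (ta := xb) (tx := xa) (tc := ta)
        (by simpa [f4] using h0) (by simpa using f3) (by simpa using f1)
        (by simpa [f4] using hlx) (by simpa [f4] using hla) (by simpa [f4] using hxb)
        (by simpa [f4] using hxa) (by simpa [f4] using rxb) (by simpa [f4] using rxa)
        (by simpa [f4] using ra) hl0 hx0 n7.1 ⟨n7.2.1, n7.2.2, n6⟩ ⟨n11, n12, hxta⟩
        ⟨hlX, hxX, hbX, haX', haX⟩ (by omega)).seq_frame ?_
      rintro s₅ ⟨t5, r5, x5, m5⟩ fr5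
      rw [State.tick_mem, f4] at m5
      rw [Tr.mk_not, Tr.mk_not] at r5
      have g27 : s₅.reg 27 = P := by
        rw [fr5.reg 27 (by cases b <;> rfl)]; simpa using f2
      have g3 : s₅.reg 3 = 1 := by
        rw [fr5.reg 3 (by cases b <;> rfl)]; simpa using f3
      have hPx : P ≠ x := n1.2.2.1
      have hPmem : ∀ k, s₅.mem k P = s.mem k P := fun k => m5 k P fun _ => ⟨n1.1, hPx⟩
      apply wp_of_vc
      simp only [vc, g27, x5]
      refine ⟨hPX, by rw [State.tick_time] at t5; rw [State.setMem_time]; omega, ?_, by simpa using g27, by simpa using g3,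
        ?_, ?_, ?_, x, Tr.mk b l ta xa, xb, by simp, ?_, ?_, ?_⟩
      · rw [State.setMem_mem, Function.update_of_ne (by simpa using d2.symm),
          m5 _ _ fun _ => ⟨hl0.symm, hx0.symm⟩, h0]
      · intro k c h
        by_cases hk : k = sideArr b
        · have := h (by subst hk; cases b <;> simp)
          simp only [Tr.mem_cells_mk, not_or] at this
          subst hk
          rw [State.setMem_mem, Function.update_self, Function.update_of_ne this.1]
          exact m5 _ _ fun _ => ⟨this.2.1.1, this.2.1.2.2.1⟩
        · rw [State.setMem_mem, Function.update_of_ne hk]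
          exact m5 _ _ fun hk => by
            have := h hk
            simp only [Tr.mem_cells_mk, not_or] at this
            exact ⟨this.2.1.1, this.2.1.2.2.1⟩
      · refine ru.congr fun c hc k _ => ?_
        have hcP : c ≠ P := fun e => n2 (e ▸ hc)
        have hcl : c ≠ l := fun e => hlu (e ▸ hc)
        have hcx : c ≠ x := fun e => n5 x (.inr (.inr (.inl rfl))) (e ▸ hc)
        rw [State.setMem_mem, ← m5 k c fun _ => ⟨hcl, hcx⟩]
        by_cases hk : k = sideArr b
        · rw [hk, Function.update_self, Function.update_of_ne hcP]
        · rw [Function.update_of_ne hk]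
      · rw [State.setMem_mem, Function.update_of_ne d1.symm, hPmem, hPu]
      · refine r5.congr fun c hc k _ => ?_
        rw [State.setMem_mem]
        by_cases hk : k = sideArr b
        · subst hk
          rw [Function.update_self, Function.update_of_ne]
          rintro rfl
          simp only [Tr.mem_cells_mk] at hc
          tauto
        · rw [Function.update_of_ne hk]
      · cases b <;> simp
      · rw [Tr.avl_mk, Tr.ht_mk]
        refine ⟨⟨ata, axa, ?_⟩, axb, ?_⟩ <;> omega
    · intro hlt
      simp only [Test.holds, f5, f6] at hlt
      apply wp_of_vc
      simp only [vc, State.tick_time, State.tick_mem, State.tick_reg, f2, f3, f4, f7]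
      exact ⟨by omega, h0, trivial, trivial, fun _ _ _ => rfl, ru, hPu, l, ta, tx, hPt, rt, rfl, ata, atx,
        by omega, by omega, by omega⟩
  · rintro s₅ ⟨t5, z5, g27, g3, so, hu5, hPu5, l', ta', tx', hPl', r5, ce, aa, ax, e1, e2, e3⟩
    obtain ⟨hl0', hla', hlx', -, ra', rx'⟩ := Tr.rep_mk.1 r5
    rw [← ce] at hnd
    have hX' : ∀ c ∈ (Tr.mk b P (Tr.mk b l' ta' tx') u).cells, c < X := fun c hc => by
      rw [ce] at hc
      simp only [Tr.mem_cells_mk] at hc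
      exact hX c hc
    simp only [Tr.mem_cells_mk] at hX'
    obtain ⟨n1, n2, n3, n4, n5⟩ := Tr.nodup_mk.1 hnd
    obtain ⟨n6, n7, n8, n9, n10⟩ := Tr.nodup_mk.1 n3
    simp only [Tr.mem_cells_mk, not_or] at n1 n5
    have ta_le := ta'.ht_le_length
    have tx_le := tx'.ht_le_length
    have hlen := congrArg List.length ce
    simp only [Tr.length_cells_mk] at hlen
    refine (rotate_spec (b := b) (r := 27) (by omega) z5 g3 g27 hPl' hPu5 hla' hlx' ra' rx' hu5
      hP0 hl0' n1.1 ⟨n1.2.1, n1.2.2, n2⟩ ⟨n6, n7, n5 l' (.inl rfl)⟩ ⟨hPX, ?_, ?_, ?_, huX⟩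
      (by omega)).mono ?_
    · exact hX' _ (.inr (.inl (.inl rfl)))
    · exact Tr.root_lt (fun c hc => hX' c (.inr (.inl (.inr (.inl hc))))) h0X
    · exact Tr.root_lt (fun c hc => hX' c (.inr (.inl (.inr (.inr hc))))) h0X
    · rintro s₆ ⟨t6, r6, x6, m6⟩
      refine ⟨by omega, _, r6, ?_, ?_, ?_, ?_, ?_⟩
      · rw [Tr.avl_mk, Tr.avl_mk, Tr.ht_mk]
        refine ⟨aa, ⟨ax, au, ?_⟩, ?_⟩ <;> omega
      · rw [← ce]; cases b <;> simp
      · rw [Tr.ht_mk, Tr.ht_mk]; omega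
      · rw [x6, Tr.root_mk]
      · intro k c h
        have : (Tr.mk b l' ta' (Tr.mk b P tx' u)).cells =
            (Tr.mk b P (Tr.mk b l ta tx) u).cells := by rw [← ce]; cases b <;> simp
        rw [this] at h
        rw [m6 k c fun hk => ?_, so k c h]
        have := h hk
        rw [← ce] at this
        simp only [Tr.mem_cells_mk, not_or] at this
        exact ⟨this.1, this.2.1.1⟩

end Spec
section Spec
variable {X W : ℕ} {s : State}

/-- The last three clauses follow the height through the cases; they are what decides whether the
growth of a subtree propagates upwards. -/
theorem balance_spec {P : ℕ} {l r : Tr} (h0 : s.mem htArr 0 = 0) (h3 : s.reg 3 = 1)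
    (hP : s.reg 27 = P) (hP0 : P ≠ 0) (hl : s.mem leftArr P = l.root)
    (hr : s.mem rightArr P = r.root) (rl : l.Rep s.mem) (rr : r.Rep s.mem) (al : l.Avl)
    (ar : r.Avl) (h1 : l.ht ≤ r.ht + 2) (h2 : r.ht ≤ l.ht + 2)
    (hnd : (Tr.node P l r).cells.Nodup) (hX : ∀ c ∈ (Tr.node P l r).cells, c < X)
    (hW : (Tr.node P l r).cells.length + 1 ≤ W) :
    wp X W balance (fun s' => s'.time ≤ s.time + 65 ∧ ∃ t' : Tr, t'.Rep s'.mem ∧ t'.Avl ∧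
      t'.cells = (Tr.node P l r).cells ∧ s'.reg 26 = t'.root ∧
      SameOff s.mem s'.mem t'.cells ∧
      (l.ht ≤ r.ht + 1 → r.ht ≤ l.ht + 1 → t'.ht = max l.ht r.ht + 1) ∧
      (l.ht = r.ht + 2 → t'.ht = r.ht + 2 ∨ t'.ht = r.ht + 3) ∧
      (r.ht = l.ht + 2 → t'.ht = l.ht + 2 ∨ t'.ht = l.ht + 3)) s := by
  have hPX : P < X := hX P (by simp)
  have h0X : 0 < X := by omega
  have hlX : l.root < X := Tr.root_lt (fun c hc => hX c (by simp [hc])) h0X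
  have hrX : r.root < X := Tr.root_lt (fun c hc => hX c (by simp [hc])) h0X
  have l_le := l.ht_le_length
  have r_le := r.ht_le_length
  have hW' : l.cells.length + r.cells.length + 2 ≤ W := by simp at hW; omega
  have hl' := rl.ht_root h0
  have hr' := rr.ht_root h0
  simp only [htArr, leftArr, rightArr] at hl' hr' hl hr
  apply wp.seq (Q' := fun s₁ => s₁.mem = s.mem ∧ s₁.reg 27 = P ∧ s₁.reg 28 = l.root ∧
    s₁.reg 29 = r.root ∧ s₁.reg 30 = l.ht ∧ s₁.reg 31 = r.ht ∧ s₁.reg 32 = r.ht + 1 ∧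
    s₁.reg 3 = 1 ∧ s₁.time = s.time + 5)
  · apply wp_of_vc
    simp [vc, hP, hl, hr, hl', hr', h3, -Tr.root, hPX, hlX, hrX]
    omega
  rintro s₁ ⟨f1, f2, f3, f4, f5, f6, f7, f8, f9⟩
  apply wp_ite
  · intro hlt
    simp only [Test.holds, f7, f5] at hlt
    refine (fixHeavy_spec (b := true) (r := 28) (P := P) (t := l) (u := r) (by omega)
      (by simpa [f1] using h0) (by simpa using f8) (by simpa using f2) hP0 (by simpa using f3)
      (by simpa [f1] using hl) (by simpa [f1] using hr) (by simpa [f1] using rl)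
      (by simpa [f1] using rr) al ar (by omega) hnd hX hW).mono ?_
    rintro s' ⟨t1, t', r1, a1, c1, e1, x1, o1⟩
    simp only [State.tick_time, State.tick_mem, f1, f9] at t1 o1
    exact ⟨by omega, t', r1, a1, c1, x1, o1, by omega, by omega, by omega⟩
  · intro hlt
    simp only [Test.holds, f7, f5] at hlt
    refine wp_seq_vc ⟨by simp [f5, f8]; omega, ?_⟩
    apply wp_ite
    · intro hlt'
      simp [f5, f6, f8] at hlt'
      refine (fixHeavy_spec (b := false) (r := 29) (P := P) (t := r) (u := l) (by omega)
        (by simpa [f1] using h0) (by simpa using f8) (by simpa using f2) hP0 (by simpa using f4)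
        (by simpa [f1] using hr) (by simpa [f1] using hl) (by simpa [f1] using rr)
        (by simpa [f1] using rl) ar al (by omega) hnd hX hW).mono ?_
      rintro s' ⟨t1, t', r1, a1, c1, e1, x1, o1⟩
      simp [f1, f9] at t1 o1
      exact ⟨by omega, t', r1, a1, c1, x1, o1, by omega, by omega, by omega⟩
    · intro hlt'
      simp [f5, f6, f8] at hlt'
      refine (fixHt_side true (r := 27) (P := P) (x := l.root) (y := r.root) (by omega)
        (by simpa using f2) hPX (by simpa using f8) (by simpa [f1] using hl)
        (by simpa [f1] using hr) hlX hrX (by simp [f1, hl', hr', -Tr.root]; omega)).seq_frame ?_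
      rintro s₂ ⟨t2, m2⟩ fr
      simp only [State.tick_mem, State.setReg_mem, f1, htArr, hl', hr'] at m2
      have g27 : s₂.reg 27 = P := by rw [fr.reg 27 rfl]; simpa using f2
      simp at t2
      apply wp_of_vc
      simp only [vc, State.setReg_time, State.setReg_mem, State.setReg_reg, if_true, g27]
      have hPl : P ∉ l.cells ∧ P ∉ r.cells := by
        simp [List.nodup_append] at hnd; grind
      have hsame : SameOff s.mem s₂.mem (Tr.node P l r).cells := by
        intro k c h
        rw [m2]
        by_cases hk : k = 12
        · have := h (.inr (.inr hk))
          subst hk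
          rw [Function.update_self, Function.update_of_ne]
          rintro rfl
          simp at this
        · rw [Function.update_of_ne hk]
      have cg : ∀ t : Tr, t.Rep s.mem → P ∉ t.cells → t.Rep s₂.mem := fun t ht hP =>
        ht.congr fun c hc k _ => by
          rw [m2]
          by_cases hk : k = 12
          · rw [hk, Function.update_self, Function.update_of_ne (show c ≠ P from fun e => hP (e ▸ hc))]
          · rw [Function.update_of_ne hk]
      refine ⟨by omega, .node P l r, ⟨hP0, ?_, ?_, ?_, cg l rl hPl.1, cg r rr hPl.2⟩,
        ⟨al, ar, by omega, by omega⟩, rfl, rfl, hsame, fun _ _ => rfl, by omega, by omega⟩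
      · rw [m2]; simp [hl, -Tr.root]
      · rw [m2]; simp [hr, -Tr.root]
      · rw [m2]; simp

end Spec

/-! ### Looking up a key -/

/-- The key stored in a dictionary cell. -/
def cellKey (m : ℕ → ℕ → ℕ) (c : ℕ) : ℕ × ℕ := (m keyTagArr c, m keyValArr c)

/-- Looks for the key in the registers `11` and `12` in the tree to which cell `[10]` of the array
`K` points. Register `14` receives the cell that holds the key, or `0` if there is none. -/
def lookup (K : ℕ) : Prog :=
  (ldR 20 K 10 ;; setC 14 0) ;;
  .loop (.lt 2 20)
    (ldR 21 keyTagArr 20 ;; ldR 22 keyValArr 20 ;;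
      .ite (.eq 21 11)
        (.ite (.eq 22 12) (setR 14 20 ;; setC 20 0)
          (.ite (.lt 12 22) (ldR 20 leftArr 20) (ldR 20 rightArr 20)))
        (.ite (.lt 11 21) (ldR 20 leftArr 20) (ldR 20 rightArr 20)))

/-- The keys of the cells increase strictly. -/
def SortedBy (m : ℕ → ℕ → ℕ) (cs : List ℕ) : Prop :=
  cs.Pairwise fun c d => toLex (cellKey m c) < toLex (cellKey m d)

theorem toLex_lt_iff (a b c d : ℕ) : toLex (a, b) < toLex (c, d) ↔ a < c ∨ a = c ∧ b < d := by
  simp [Prod.Lex.toLex_lt_toLex]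

theorem lookup_spec {X W : ℕ} {s : State} {K : ℕ} {t : Tr} (h2 : s.reg 2 = 0)
    (h10 : s.reg 10 < X)
    (hroot : s.mem K (s.reg 10) = t.root) (hrep : t.Rep s.mem) (hX : ∀ c ∈ t.cells, c < X)
    (hs : SortedBy s.mem t.cells) :
    wp X W (lookup K) (fun s' => s'.mem = s.mem ∧ s'.time ≤ s.time + 8 * t.ht + 3 ∧
      ((s'.reg 14 = 0 ∧ ∀ c ∈ t.cells, cellKey s.mem c ≠ (s.reg 11, s.reg 12)) ∨
        (s'.reg 14 ∈ t.cells ∧ cellKey s.mem (s'.reg 14) = (s.reg 11, s.reg 12)))) s := by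
  obtain ⟨k, hk⟩ : ∃ k : ℕ × ℕ, k = (s.reg 11, s.reg 12) := ⟨_, rfl⟩
  rw [← hk]
  have hk1 : s.reg 11 = k.1 := by rw [hk]
  have hk2 : s.reg 12 = k.2 := by rw [hk]
  clear hk
  apply wp.seq (Q' := fun s₁ => s₁.mem = s.mem ∧ s₁.reg 20 = t.root ∧ s₁.reg 2 = 0 ∧
    s₁.reg 11 = k.1 ∧ s₁.reg 12 = k.2 ∧ s₁.reg 14 = 0 ∧ s₁.time = s.time + 2)
  · apply wp_of_vc
    simp [vc, h10, hroot, h2, hk1, hk2, -Tr.root]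
  rintro s₁ ⟨f1, f2, f3, f4, f5, f6, f7⟩
  -- As long as nothing has been found, every cell of `t` with the key `k` lies in the remaining
  -- subtree `u`. A hit replaces `u` by `nil`, matching the register 20, which is cleared to end the
  -- loop. The variant is the height of `u`.
  refine wp_loop (fun n s' => ∃ u : Tr, n = u.ht ∧ u.Rep s.mem ∧ s'.mem = s.mem ∧
    s'.reg 20 = u.root ∧ s'.reg 2 = 0 ∧ s'.reg 11 = k.1 ∧ s'.reg 12 = k.2 ∧
    (∀ c ∈ u.cells, c < X ∧ c ∈ t.cells) ∧ SortedBy s.mem u.cells ∧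
    s'.time + 8 * u.ht ≤ s.time + 8 * t.ht + 2 ∧
    ((s'.reg 14 = 0 ∧ ∀ c ∈ t.cells, cellKey s.mem c = k → c ∈ u.cells) ∨
      (u = .nil ∧ s'.reg 14 ∈ t.cells ∧ cellKey s.mem (s'.reg 14) = k))) ?_ ?_ t.ht s₁
      ⟨t, rfl, hrep, f1, f2, f3, f4, f5, fun c hc => ⟨hX c hc, hc⟩, hs, by omega,
        .inl ⟨f6, fun c hc _ => hc⟩⟩
  · rintro n s' ⟨u, rfl, ru, e1, e2, e3, e4, e5, e6, e7, e8, e9⟩ hlt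
    simp only [Test.holds, e2, e3] at hlt
    cases u with
    | nil => simp at hlt
    | node p l r =>
      obtain ⟨hp0, hl, hr, -, rl, rr⟩ := ru
      simp only [Tr.root] at e2
      simp only [leftArr, rightArr] at hl hr
      replace e9 : s'.reg 14 = 0 ∧ ∀ c ∈ t.cells, cellKey s.mem c = k →
          c ∈ (Tr.node p l r).cells := by
        rcases e9 with e9 | e9
        exacts [e9, by simp at e9]
      obtain ⟨e9, e10⟩ := e9
      have hpX := (e6 p (by simp)).1
      have hpt := (e6 p (by simp)).2
      have hsl : SortedBy s.mem l.cells := (List.pairwise_append.1 e7).1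
      have hsr : SortedBy s.mem r.cells := (List.pairwise_cons.1 (List.pairwise_append.1 e7).2.1).2
      have hlp : ∀ c ∈ l.cells, toLex (cellKey s.mem c) < toLex (cellKey s.mem p) := fun c hc =>
        (List.pairwise_append.1 e7).2.2 c hc p (by simp)
      have hpr : ∀ c ∈ r.cells, toLex (cellKey s.mem p) < toLex (cellKey s.mem c) := fun c hc =>
        (List.pairwise_cons.1 (List.pairwise_append.1 e7).2.1).1 c hc
      have goL : toLex k < toLex (cellKey s.mem p) → ∀ c ∈ t.cells, cellKey s.mem c = k →
          c ∈ l.cells := by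
        intro h c hc hck
        have := e10 c hc hck
        simp only [Tr.cells, List.mem_append, List.mem_cons] at this
        rcases this with h' | rfl | h'
        · exact h'
        · exact absurd h (by rw [hck]; exact lt_irrefl _)
        · have := hpr c h'
          rw [hck] at this
          exact absurd this h.asymm
      have goR : toLex (cellKey s.mem p) < toLex k → ∀ c ∈ t.cells, cellKey s.mem c = k →
          c ∈ r.cells := by
        intro h c hc hck
        have := e10 c hc hck
        simp only [Tr.cells, List.mem_append, List.mem_cons] at this
        rcases this with h' | rfl | h'
        · have := hlp c h'
          rw [hck] at this
          exact absurd this h.asymm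
        · exact absurd h (by rw [hck]; exact lt_irrefl _)
        · exact h'
      have h6l : ∀ c ∈ l.cells, c < X ∧ c ∈ t.cells := fun c hc => e6 c (by simp [hc])
      have h6r : ∀ c ∈ r.cells, c < X ∧ c ∈ t.cells := fun c hc => e6 c (by simp [hc])
      simp only [Tr.ht] at e8
      have hle1 := le_max_left l.ht r.ht
      have hle2 := le_max_right l.ht r.ht
      apply wp.mono (Q := fun s₂ => s₂.mem = s.mem ∧ s₂.reg 2 = 0 ∧ s₂.reg 11 = k.1 ∧
        s₂.reg 12 = k.2 ∧ s₂.time ≤ s'.time + 8 ∧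
        ((cellKey s.mem p = k ∧ s₂.reg 14 = p ∧ s₂.reg 20 = 0) ∨
        (toLex k < toLex (cellKey s.mem p) ∧ s₂.reg 14 = 0 ∧ s₂.reg 20 = l.root) ∨
        (toLex (cellKey s.mem p) < toLex k ∧ s₂.reg 14 = 0 ∧ s₂.reg 20 = r.root)))
      · apply wp_of_vc
        obtain ⟨k1, k2⟩ := k
        simp only [cellKey, toLex_lt_iff, Prod.mk.injEq]
        simp only at e4 e5
        simp [vc, e1, e2, e3, e4, e5, e9, hl, hr, hpX, -Tr.root]
        grind
      · rintro s₂ ⟨g1, g2, g3, g4, g5, ⟨h, g6, g7⟩ | ⟨h, g6, g7⟩ | ⟨h, g6, g7⟩⟩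
        · exact ⟨0, by simp, .nil, rfl, trivial, g1, g7, g2, g3, g4, by simp, by simp [SortedBy],
            by simp; omega, .inr ⟨rfl, by rwa [g6], by rwa [g6]⟩⟩
        · exact ⟨l.ht, Nat.lt_succ_of_le hle1, l, rfl, rl, g1, g7, g2, g3, g4, h6l, hsl,
            by omega, .inl ⟨g6, goL h⟩⟩
        · exact ⟨r.ht, Nat.lt_succ_of_le hle2, r, rfl, rr, g1, g7, g2, g3, g4, h6r, hsr,
            by omega, .inl ⟨g6, goR h⟩⟩
  · rintro n s' ⟨u, rfl, ru, e1, e2, e3, e4, e5, e6, e7, e8, e9⟩ hlt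
    simp only [Test.holds, e2, e3] at hlt
    have hu : u = .nil := ru.root_eq_zero (by omega)
    subst hu
    refine ⟨e1, by simp at e8 ⊢; omega, ?_⟩
    rcases e9 with ⟨h, h'⟩ | ⟨_, h⟩
    · exact .inl ⟨h, fun c hc hck => by simpa using h' c hc hck⟩
    · exact .inr h

/-! ### Inserting a key -/

/-- A step of the path from the root of a binary tree to a subtree: the cell, the side on which
the subtree is (`true` for left), and the subtree on the other side. -/
structure PathStep where
  p : ℕ
  b : Bool
  sib : Tr

/-- The tree with the subtree `t` at the end of the path; the path starts with its lowest step. -/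
def plug : List PathStep → Tr → Tr
  | [], t => t
  | f :: fs, t => plug fs (Tr.mk f.b f.p t f.sib)

/-- The cells to the left of the path. -/
def pathL : List PathStep → List ℕ
  | [] => []
  | f :: fs => pathL fs ++ if f.b then [] else f.sib.cells ++ [f.p]

/-- The cells to the right of the path. -/
def pathR : List PathStep → List ℕ
  | [] => []
  | f :: fs => (if f.b then f.p :: f.sib.cells else []) ++ pathR fs

theorem cells_plug : ∀ (fs : List PathStep) (t : Tr),
    (plug fs t).cells = pathL fs ++ t.cells ++ pathR fs
  | [], t => by simp [plug, pathL, pathR]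
  | ⟨p, b, u⟩ :: fs, t => by
    rw [plug, cells_plug fs, pathL, pathR]
    cases b <;> simp

theorem avl_of_plug : ∀ {fs : List PathStep} {t : Tr}, (plug fs t).Avl → t.Avl
  | [], _, h => h
  | _ :: _, _, h => (Tr.avl_mk.1 (avl_of_plug (by exact h))).1

/-- The memory represents the path, except for the pointers along it, and stores it in the arrays
`pathArr` and `dirArr`. -/
def PathRep (m : ℕ → ℕ → ℕ) : List PathStep → Prop
  | [] => True
  | f :: fs => f.p ≠ 0 ∧ m (sideArr !f.b) f.p = f.sib.root ∧ f.sib.Rep m ∧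
      m pathArr fs.length = f.p ∧ m dirArr fs.length = (if f.b then 0 else 1) ∧ PathRep m fs

theorem sideArr_mem (b : Bool) : sideArr b = leftArr ∨ sideArr b = rightArr ∨ sideArr b = htArr := by
  cases b <;> simp

theorem mem_path_cons {f : PathStep} {fs : List PathStep} {c : ℕ} :
    c ∈ pathL (f :: fs) ∨ c ∈ pathR (f :: fs) ↔
      (c = f.p ∨ c ∈ f.sib.cells) ∨ (c ∈ pathL fs ∨ c ∈ pathR fs) := by
  obtain ⟨p, b, u⟩ := f
  cases b <;> simp [pathL, pathR] <;> tauto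

theorem PathRep.congr {m m' : ℕ → ℕ → ℕ} : ∀ {fs : List PathStep}, PathRep m fs →
    (∀ c, c ∈ pathL fs ∨ c ∈ pathR fs → ∀ k, k = leftArr ∨ k = rightArr ∨ k = htArr →
      m' k c = m k c) →
    (∀ i < fs.length, m' pathArr i = m pathArr i ∧ m' dirArr i = m dirArr i) → PathRep m' fs
  | [], _, _, _ => trivial
  | f :: fs, ⟨h1, h2, h3, h4, h5, h6⟩, hc, hi => by
    refine ⟨h1, ?_, h3.congr fun c h => hc c (mem_path_cons.2 (.inl (.inr h))), ?_, ?_,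
      h6.congr (fun c h => hc c (mem_path_cons.2 (.inr h))) fun i h => hi i (by simp; omega)⟩
    · rw [hc f.p (mem_path_cons.2 (.inl (.inl rfl))) _ (sideArr_mem _), h2]
    · rw [(hi _ (by simp)).1, h4]
    · rw [(hi _ (by simp)).2, h5]

/-- Sets up the cell in register `23` with the key in the registers `11` and `12` and the target in
register `13`. -/
def newCell : Prog :=
  setR 23 7 ;; addR 7 7 3 ;; stR leftArr 23 2 ;; stR rightArr 23 2 ;; stR htArr 23 3 ;;
  stR keyTagArr 23 11 ;; stR keyValArr 23 12 ;; stR targetArr 23 13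

/-- Follows the path on which the key in the registers `11` and `12` has to be inserted. -/
def findPath : Prog :=
  .loop (.lt 2 20)
    (ldR 21 keyTagArr 20 ;; ldR 22 keyValArr 20 ;; stR pathArr 24 20 ;; setC 25 1 ;;
      .ite (.eq 21 11) (.ite (.lt 12 22) (setC 25 0) .skip) (.ite (.lt 11 21) (setC 25 0) .skip) ;;
      stR dirArr 24 25 ;; addR 24 24 3 ;; .ite (.eq 25 2) (ldR 20 leftArr 20) (ldR 20 rightArr 20))

/-- Hangs the tree in register `26` under the path and rebalances. -/
def closePath : Prog :=
  .loop (.lt 2 24)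
    ((subR 24 24 3 ;; ldR 27 pathArr 24 ;; ldR 25 dirArr 24 ;;
      .ite (.eq 25 2) (stR leftArr 27 26) (stR rightArr 27 26)) ;; balance)

/-- Inserts the key in the registers `11` and `12` with the target in register `13` into the tree
to which cell `[10]` of the array `K` points. -/
def dictInsert (K : ℕ) : Prog :=
  newCell ;; (ldR 20 K 10 ;; setC 24 0) ;; findPath ;; setR 26 23 ;; closePath ;; stR K 10 26

section Spec
variable {X W : ℕ} {s : State}

/-- The path is a zipper: `plug fs u = t` holds throughout, and the key lies strictly between the
cells on the two sides of the path. As the key is absent from `t`, every comparison selects a side,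
and the path ends at the empty subtree where the new cell belongs. -/
theorem findPath_spec {t : Tr} {k : ℕ × ℕ} (h2 : s.reg 2 = 0) (h3 : s.reg 3 = 1)
    (h11 : s.reg 11 = k.1) (h12 : s.reg 12 = k.2) (h20 : s.reg 20 = t.root) (h24 : s.reg 24 = 0)
    (hrep : t.Rep s.mem) (hX : ∀ c ∈ t.cells, c < X) (hlen : t.cells.length ≤ X) (hXW : X ≤ W)
    (hs : SortedBy s.mem t.cells) (hk : ∀ c ∈ t.cells, cellKey s.mem c ≠ k) :
    wp X W findPath (fun s' => s'.time ≤ s.time + 14 * t.ht + 1 ∧ ∃ fs : List PathStep,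
      plug fs .nil = t ∧ fs.length ≤ t.ht ∧ PathRep s'.mem fs ∧ s'.reg 24 = fs.length ∧
      (∀ c ∈ pathL fs, toLex (cellKey s.mem c) < toLex k) ∧
      (∀ c ∈ pathR fs, toLex k < toLex (cellKey s.mem c))) s := by
  have hht := t.ht_le_length
  refine wp_loop (fun n s' => (∀ j, j ≠ pathArr → j ≠ dirArr → s'.mem j = s.mem j) ∧
    ∃ (fs : List PathStep) (u : Tr), n = u.ht ∧ plug fs u = t ∧
    PathRep s'.mem fs ∧ u.Rep s'.mem ∧ s'.reg 24 = fs.length ∧ s'.reg 20 = u.root ∧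
    s'.reg 2 = 0 ∧ s'.reg 3 = 1 ∧ s'.reg 11 = k.1 ∧ s'.reg 12 = k.2 ∧
    fs.length + u.ht ≤ t.ht ∧ s'.time + 14 * u.ht ≤ s.time + 14 * t.ht ∧
    (∀ c ∈ pathL fs, toLex (cellKey s.mem c) < toLex k) ∧
    (∀ c ∈ pathR fs, toLex k < toLex (cellKey s.mem c))) ?_ ?_ t.ht s
    ⟨fun _ _ _ => rfl, [], t, rfl, rfl, trivial, hrep, h24, h20, h2, h3, h11, h12, by simp,
      by simp, by simp [pathL], by simp [pathR]⟩
  · rintro n s' ⟨hm, fs, u, rfl, hplug, pr, ru, e1, e2, e3, e4, e5, e6, e7, e8, eL, eR⟩ hlt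
    simp only [Test.holds, e2, e3] at hlt
    cases u with
    | nil => simp at hlt
    | node p l r =>
      have hmem : ∀ c ∈ (Tr.node p l r).cells, c ∈ t.cells := fun c hc => by
        rw [← hplug, cells_plug]; simp only [List.mem_append]; tauto
      have hsu : SortedBy s.mem (Tr.node p l r).cells := by
        rw [← hplug, cells_plug] at hs
        exact (List.pairwise_append.1 (List.pairwise_append.1 hs).1).2.1
      have hpt := hmem p (by simp)
      have hpX := hX p hpt
      have hpk := hk p hpt
      obtain ⟨hp0, hl, hr, -, rl, rr⟩ := ru
      have hlp : ∀ c ∈ l.cells, toLex (cellKey s.mem c) < toLex (cellKey s.mem p) := fun c hc =>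
        (List.pairwise_append.1 hsu).2.2 c hc p (by simp)
      have hpr : ∀ c ∈ r.cells, toLex (cellKey s.mem p) < toLex (cellKey s.mem c) := fun c hc =>
        (List.pairwise_cons.1 (List.pairwise_append.1 hsu).2.1).1 c hc
      simp only [Tr.ht] at e7 e8
      simp only [leftArr, rightArr] at hl hr
      simp only [Tr.root] at e2
      have hle1 := le_max_left l.ht r.ht
      have hle2 := le_max_right l.ht r.ht
      have hfX : fs.length < X := by omega
      have hck : cellKey s.mem p = (s'.mem 9 p, s'.mem 10 p) := by
        rw [hm 9 (by simp) (by simp), hm 10 (by simp) (by simp)]; rfl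
      apply wp.mono (Q := fun s₂ => (∀ j, j ≠ pathArr → j ≠ dirArr → s₂.mem j = s'.mem j) ∧
        s₂.reg 2 = 0 ∧ s₂.reg 3 = 1 ∧ s₂.reg 11 = k.1 ∧ s₂.reg 12 = k.2 ∧
        s₂.time ≤ s'.time + 14 ∧ s₂.reg 24 = fs.length + 1 ∧
        s₂.mem pathArr = Function.update (s'.mem pathArr) fs.length p ∧
        ∃ b : Bool, s₂.mem dirArr = Function.update (s'.mem dirArr) fs.length
          (if b then 0 else 1) ∧ ((b = true ∧ toLex k < toLex (cellKey s.mem p) ∧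
            s₂.reg 20 = l.root) ∨ (b = false ∧ toLex (cellKey s.mem p) < toLex k ∧
            s₂.reg 20 = r.root)))
      · apply wp_of_vc
        rw [hck] at hpk
        obtain ⟨k1, k2⟩ := k
        simp only [hck, toLex_lt_iff, Prod.mk.injEq, ne_eq] at hpk ⊢
        simp only at e5 e6
        have hWf : fs.length + 1 ≤ W := by omega
        simp [vc, e1, e2, e3, e4, e5, e6, hl, hr, hpX, hfX, -Tr.root]
        refine ⟨by omega, fun h => ⟨fun h' => ⟨hWf, ?_, ?_⟩, fun h' => ⟨hWf, ?_, ?_⟩⟩,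
          fun h => ⟨fun h' => ⟨hWf, ?_, ?_⟩, fun h' => ⟨hWf, ?_, ?_⟩⟩⟩
        · intro j hj hj'; simp [hj, hj']
        · exact .inr (.inr ⟨h.symm, h'⟩)
        · intro j hj hj'; simp [hj, hj']
        · exact .inl (.inr ⟨h, by omega⟩)
        · intro j hj hj'; simp [hj, hj']
        · exact .inr (.inl h')
        · intro j hj hj'; simp [hj, hj']
        · exact .inl (.inl (by omega))
      · rintro s₂ ⟨g1, g2, g3, g4, g5, g6, g7, g8, b, g9, g10⟩
        have hm2 : ∀ j, j ≠ pathArr → j ≠ dirArr → s₂.mem j = s.mem j := fun j h h' =>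
          (g1 j h h').trans (hm j h h')
        have cgm : ∀ j, j = leftArr ∨ j = rightArr ∨ j = htArr → s₂.mem j = s'.mem j := by
          intro j hj
          apply g1 <;> rcases hj with rfl | rfl | rfl <;> simp
        have pr2 : PathRep s₂.mem fs := pr.congr (fun c _ j hj => by rw [cgm j hj])
          fun i hi => ⟨by rw [g8, Function.update_of_ne hi.ne],
            by rw [g9, Function.update_of_ne hi.ne]⟩
        have rl2 : l.Rep s₂.mem := rl.congr fun c _ j hj => by rw [cgm j hj]
        have rr2 : r.Rep s₂.mem := rr.congr fun c _ j hj => by rw [cgm j hj]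
        have hl2 : s₂.mem 7 p = l.root := by rw [cgm 7 (by simp), hl]
        have hr2 : s₂.mem 8 p = r.root := by rw [cgm 8 (by simp), hr]
        rcases g10 with ⟨rfl, hk', h20'⟩ | ⟨rfl, hk', h20'⟩
        · refine ⟨l.ht, Nat.lt_succ_of_le hle1, hm2, ⟨p, true, r⟩ :: fs, l, rfl, ?_,
            ⟨hp0, hr2, rr2, by rw [g8, Function.update_self],
              by rw [g9, Function.update_self], pr2⟩, rl2, g7, h20', g2, g3, g4, g5,
            by simp; omega, by omega, ?_, ?_⟩
          · simpa [plug] using hplug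
          · simpa [pathL] using eL
          · simp only [pathR, if_true, List.mem_append, List.mem_cons]
            rintro c ((rfl | hc) | hc)
            exacts [hk', hk'.trans (hpr c hc), eR c hc]
        · refine ⟨r.ht, Nat.lt_succ_of_le hle2, hm2, ⟨p, false, l⟩ :: fs, r, rfl, ?_,
            ⟨hp0, hl2, rl2, by rw [g8, Function.update_self],
              by rw [g9, Function.update_self], pr2⟩, rr2, g7, h20', g2, g3, g4, g5,
            by simp; omega, by omega, ?_, ?_⟩
          · simpa [plug] using hplug
          · simp only [pathL, Bool.false_eq_true, if_false, List.mem_append, List.mem_singleton]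
            rintro c (hc | hc | rfl)
            exacts [eL c hc, (hlp c hc).trans hk', hk']
          · simpa [pathR] using eR
  · rintro n s' ⟨hm, fs, u, rfl, hplug, pr, ru, e1, e2, e3, e4, e5, e6, e7, e8, eL, eR⟩ hlt
    simp only [Test.holds, e2, e3] at hlt
    obtain rfl : u = .nil := ru.root_eq_zero (by omega)
    simp only [Tr.ht] at e7 e8
    exact ⟨by simp; omega, fs, hplug, by omega, pr, e1, eL, eR⟩

/-- Here `h` is the height of the subtree that `u` has replaced, so the old tree had height `max h
v.ht + 1`. The conclusion is that the rebalanced tree is again at most one level higher than the old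
one, which is the hypothesis `hh` for the next step upwards. -/
theorem balance_mk {b : Bool} {P : ℕ} {u v : Tr} {h : ℕ} (h0 : s.mem htArr 0 = 0)
    (h3 : s.reg 3 = 1) (hP : s.reg 27 = P) (hP0 : P ≠ 0) (hu : s.mem (sideArr b) P = u.root)
    (hv : s.mem (sideArr !b) P = v.root) (ru : u.Rep s.mem) (rv : v.Rep s.mem) (au : u.Avl)
    (av : v.Avl) (h1 : h ≤ v.ht + 1) (h2 : v.ht ≤ h + 1) (hh : u.ht = h ∨ u.ht = h + 1)
    (hnd : (Tr.mk b P u v).cells.Nodup) (hX : ∀ c ∈ (Tr.mk b P u v).cells, c < X)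
    (hW : (Tr.mk b P u v).cells.length + 1 ≤ W) :
    wp X W balance (fun s' => s'.time ≤ s.time + 65 ∧ ∃ t' : Tr, t'.Rep s'.mem ∧ t'.Avl ∧
      t'.cells = (Tr.mk b P u v).cells ∧ s'.reg 26 = t'.root ∧
      SameOff s.mem s'.mem t'.cells ∧
      (t'.ht = max h v.ht + 1 ∨ t'.ht = max h v.ht + 2)) s := by
  cases b
  · refine (balance_spec (l := v) (r := u) h0 h3 hP hP0 hv hu rv ru av au (by omega) (by omega)
      hnd hX hW).mono ?_
    rintro s' ⟨t1, t', r1, a1, c1, x1, o1, c2, c3, c4⟩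
    exact ⟨t1, t', r1, a1, c1, x1, o1, by omega⟩
  · refine (balance_spec (l := u) (r := v) h0 h3 hP hP0 hu hv ru rv au av (by omega) (by omega)
      hnd hX hW).mono ?_
    rintro s' ⟨t1, t', r1, a1, c1, x1, o1, c2, c3, c4⟩
    exact ⟨t1, t', r1, a1, c1, x1, o1, by omega⟩

/-- The subtree `u₀` is the one that `u` replaces; the balance of the old tree `plug fs u₀` bounds
the heights of the siblings along the path. The loop goes up to the root even after the heights have
become stable, which costs only a constant per level. -/
theorem closePath_spec {fs : List PathStep} {u u₀ : Tr} (h2 : s.reg 2 = 0) (h3 : s.reg 3 = 1)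
    (h26 : s.reg 26 = u.root) (h24 : s.reg 24 = fs.length) (h0 : s.mem htArr 0 = 0)
    (pr : PathRep s.mem fs) (ru : u.Rep s.mem) (au : u.Avl)
    (ap : (plug fs u₀).Avl) (hu : u.ht = u₀.ht ∨ u.ht = u₀.ht + 1)
    (hnd : (plug fs u).cells.Nodup) (hX : ∀ c ∈ (plug fs u).cells, c < X)
    (hlen : fs.length ≤ X) (hW : (plug fs u).cells.length + 1 ≤ W) :
    wp X W closePath (fun s' => s'.time ≤ s.time + 72 * fs.length + 1 ∧ ∃ t' : Tr,
      t'.Rep s'.mem ∧ t'.Avl ∧ t'.cells = (plug fs u).cells ∧ s'.reg 26 = t'.root ∧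
      SameOff s.mem s'.mem t'.cells) s := by
  obtain ⟨C, hC⟩ : ∃ C, C = (plug fs u).cells := ⟨_, rfl⟩
  rw [← hC] at hnd hX hW ⊢
  refine wp_loop (fun n s' => ∃ (gs : List PathStep) (u u₀ : Tr), n = gs.length ∧
    s'.reg 2 = 0 ∧ s'.reg 3 = 1 ∧ s'.reg 26 = u.root ∧ s'.reg 24 = gs.length ∧
    s'.mem htArr 0 = 0 ∧ PathRep s'.mem gs ∧ u.Rep s'.mem ∧ u.Avl ∧ (plug gs u₀).Avl ∧
    (u.ht = u₀.ht ∨ u.ht = u₀.ht + 1) ∧ C = (plug gs u).cells ∧ SameOff s.mem s'.mem C ∧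
    gs.length ≤ fs.length ∧
    s'.time + 72 * gs.length ≤ s.time + 72 * fs.length) ?_ ?_ fs.length s
    ⟨fs, u, u₀, rfl, h2, h3, h26, h24, h0, pr, ru, au, ap, hu, hC, fun _ _ _ => rfl, le_rfl,
      le_rfl⟩
  · clear! u u₀
    rintro n s' ⟨gs, u, u₀, rfl, e2, e3, e26, e24, e0, pr, ru, au, ap, hu, hC, so, hgl, ht⟩ hlt
    simp only [Test.holds, e2, e24] at hlt
    cases gs with
    | nil => simp at hlt
    | cons f gs =>
      obtain ⟨p, b, v⟩ := f
      obtain ⟨hp0, hv, rv, hpath, hdir, pr⟩ := pr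
      simp only [List.length_cons] at *
      simp only [pathArr, dirArr] at hpath hdir
      have hC' : C = pathL gs ++ (Tr.mk b p u v).cells ++ pathR gs := by
        rw [hC, plug, cells_plug]
      have hnd' := hnd
      rw [hC'] at hnd'
      have hmkC : ∀ c ∈ (Tr.mk b p u v).cells, c ∈ C := fun c hc => by
        rw [hC']; simp only [List.mem_append]; tauto
      have hndm : (Tr.mk b p u v).cells.Nodup := by
        simp only [List.nodup_append] at hnd'; exact hnd'.1.2.1
      have hgs : ∀ c, c ∈ pathL gs ∨ c ∈ pathR gs → c ∉ (Tr.mk b p u v).cells := by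
        intro c hc hc'
        simp only [List.nodup_append, List.mem_append] at hnd'
        rcases hc with hc | hc
        · exact hnd'.1.2.2 c hc c hc' rfl
        · exact hnd'.2.2 c (.inr hc') c hc rfl
      obtain ⟨np1, np2, -, -, -⟩ := Tr.nodup_mk.1 hndm
      have hpX := hX p (hmkC p (Tr.mem_cells_mk.2 (.inl rfl)))
      have hlenC : (Tr.mk b p u v).cells.length ≤ C.length := by
        rw [hC']; simp only [List.length_append]; omega
      have hgX : gs.length < X := by omega
      obtain ⟨-, av, ha1, ha2⟩ : _ ∧ v.Avl ∧ u₀.ht ≤ v.ht + 1 ∧ v.ht ≤ u₀.ht + 1 :=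
        Tr.avl_mk.1 (avl_of_plug (fs := gs) (by exact ap))
      obtain ⟨d1, d2, d3⟩ := sideArr_ne b
      apply wp.seq (Q' := fun s₁ => s₁.reg 2 = 0 ∧ s₁.reg 3 = 1 ∧ s₁.reg 24 = gs.length ∧
        s₁.reg 27 = p ∧ s₁.time = s'.time + 6 ∧ s₁.mem = Function.update s'.mem (sideArr b)
          (Function.update (s'.mem (sideArr b)) p u.root))
      · apply wp_of_vc
        cases b <;> simp_all [vc, -Tr.root]
      · rintro s₁ ⟨f2, f3, f24, f27, ft, fm⟩
        have m1 : ∀ k c, c ≠ p → s₁.mem k c = s'.mem k c := by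
          intro k c hc
          rw [fm]
          by_cases hk : k = sideArr b
          · rw [hk, Function.update_self, Function.update_of_ne hc]
          · rw [Function.update_of_ne hk]
        have m2 : ∀ k, k ≠ sideArr b → s₁.mem k = s'.mem k := fun k hk => by
          rw [fm, Function.update_of_ne hk]
        have ru1 : u.Rep s₁.mem := ru.congr fun c hc k _ =>
          m1 k c fun e => np1 (e ▸ hc)
        have rv1 : v.Rep s₁.mem := rv.congr fun c hc k _ =>
          m1 k c fun e => np2 (e ▸ hc)
        have e01 : s₁.mem htArr 0 = 0 := by rw [m1 _ _ hp0.symm, e0]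
        refine ((balance_mk (b := b) (h := u₀.ht) e01 f3 f27 hp0
          (by rw [fm, Function.update_self, Function.update_self])
          (by rw [m2 _ d1.symm, hv]) ru1 rv1 au av ha1 ha2 hu hndm (fun c hc => hX c (hmkC c hc))
          (by omega)).frame).mono ?_
        rintro s₂ ⟨⟨t2, t', r', a', c', x', o', hh'⟩, fr⟩
        have o1 : ∀ c, c ∉ (Tr.mk b p u v).cells → ∀ k, s₂.mem k c = s'.mem k c := by
          intro c hc k
          rw [o' k c fun _ => by rwa [c'], m1]
          rintro rfl
          exact hc (Tr.mem_cells_mk.2 (.inl rfl))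
        have o2 : ∀ k, k ≠ leftArr → k ≠ rightArr → k ≠ htArr → s₂.mem k = s'.mem k := by
          intro k h1 h2 h3
          funext c
          rw [o' k c fun h => by tauto, m2]
          cases b
          exacts [h2, h1]
        refine ⟨gs.length, by omega, gs, t', Tr.mk b p u₀ v, rfl, ?_, ?_, x', ?_, ?_, ?_, r', a',
          ap, ?_, ?_, ?_, by omega, by omega⟩
        · rw [fr.reg 2 rfl, f2]
        · rw [fr.reg 3 rfl, f3]
        · rw [fr.reg 24 rfl, f24]
        · rw [o1 0 (fun h => ?_), e0]
          rcases Tr.mem_cells_mk.1 h with h | h | h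
          exacts [hp0 h.symm, ru.ne_zero 0 h rfl, rv.ne_zero 0 h rfl]
        · exact pr.congr (fun c hc k _ => o1 c (hgs c hc) k) fun i _ =>
            ⟨by rw [o2 _ (by simp) (by simp) (by simp)],
              by rw [o2 _ (by simp) (by simp) (by simp)]⟩
        · rw [Tr.ht_mk]; omega
        · rw [cells_plug, c', hC']
        · intro k c hk
          by_cases hk' : k = leftArr ∨ k = rightArr ∨ k = htArr
          · rw [o1 c (fun h => hk hk' (hmkC c h)), so k c hk]
          · push Not at hk'
            rw [o2 k hk'.1 hk'.2.1 hk'.2.2, so k c hk]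
  · clear! u u₀
    rintro n s' ⟨gs, u, u₀, rfl, e2, e3, e26, e24, e0, pr, ru, au, ap, hu, hC, so, hgl, ht⟩ hlt
    simp only [Test.holds, e2, e24] at hlt
    cases gs with
    | cons f gs => simp at hlt
    | nil =>
      have hC' : u.cells = C := hC.symm
      exact ⟨by simp at ht ⊢; omega, u, ru, au, hC', e26, hC' ▸ so⟩

end Spec

theorem length_le_of_nodup {l : List ℕ} {f : ℕ} (hnd : l.Nodup) (h0 : ∀ c ∈ l, c ≠ 0)
    (hlt : ∀ c ∈ l, c < f) : l.length ≤ f - 1 := by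
  have h : l.toFinset ⊆ Finset.Ico 1 f := fun c hc => by
    have hc := List.mem_toFinset.1 hc
    exact Finset.mem_Ico.2 ⟨Nat.pos_of_ne_zero (h0 c hc), hlt c hc⟩
  have := Finset.card_le_card h
  rwa [List.toFinset_card_of_nodup hnd, Nat.card_Ico] at this

theorem insert_spec {X W : ℕ} {s : State} {K f i tgt : ℕ} {t : Tr} {k : ℕ × ℕ}
    (hK : K = dictArr ∨ K = linkArr) (h2 : s.reg 2 = 0) (h3 : s.reg 3 = 1) (h10 : s.reg 10 = i)
    (hi : i < X) (h7 : s.reg 7 = f) (hf0 : f ≠ 0) (hf : f < X) (hXW : X ≤ W)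
    (h11 : s.reg 11 = k.1) (h12 : s.reg 12 = k.2) (h13 : s.reg 13 = tgt)
    (hroot : s.mem K i = t.root) (h0 : s.mem htArr 0 = 0) (rt : t.Rep s.mem) (at' : t.Avl)
    (hnd : t.cells.Nodup) (hlt : ∀ c ∈ t.cells, c < f) (hs : SortedBy s.mem t.cells)
    (hk : ∀ c ∈ t.cells, cellKey s.mem c ≠ k) :
    wp X W (dictInsert K) (fun s' => s'.time ≤ s.time + 86 * t.ht + 14 ∧ s'.reg 7 = f + 1 ∧
      ∃ (t' : Tr) (l r : List ℕ), t.cells = l ++ r ∧ t'.cells = l ++ f :: r ∧ t'.Rep s'.mem ∧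
      t'.Avl ∧ s'.mem K i = t'.root ∧ SortedBy s'.mem t'.cells ∧ cellKey s'.mem f = k ∧
      s'.mem targetArr f = tgt ∧
      ∀ j c, (j = leftArr ∨ j = rightArr ∨ j = htArr → c ∉ t'.cells) →
        (j = keyTagArr ∨ j = keyValArr ∨ j = targetArr → c ≠ f) → (j = K → c ≠ i) →
        j ≠ pathArr → j ≠ dirArr → s'.mem j c = s.mem j c) s := by
  have hlen := length_le_of_nodup hnd rt.ne_zero hlt
  have hft : f ∉ t.cells := fun h => lt_irrefl f (hlt f h)
  refine wp.seq (Q' := fun s₁ => s₁.time = s.time + 8 ∧ s₁.reg 2 = 0 ∧ s₁.reg 3 = 1 ∧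
    s₁.reg 7 = f + 1 ∧ s₁.reg 10 = i ∧ s₁.reg 11 = k.1 ∧ s₁.reg 12 = k.2 ∧ s₁.reg 23 = f ∧
    (∀ j c, (7 ≤ j ∧ j ≤ 12 → c ≠ f) → s₁.mem j c = s.mem j c) ∧ s₁.mem 7 f = 0 ∧
    s₁.mem 8 f = 0 ∧ s₁.mem 9 f = k.1 ∧ s₁.mem 10 f = k.2 ∧ s₁.mem 11 f = tgt ∧
    s₁.mem 12 f = 1) ?_ ?_
  · apply wp_of_vc
    simp only [newCell, vc]
    simp [h2, h3, h7, h10, h11, h12, h13, hf]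
    refine ⟨by omega, ?_⟩
    intro j c hj
    simp only [Function.update_apply]
    grind
  rintro s₁ ⟨t1, e2, e3, e7, e10, e11, e12, e23, em, m7, m8, m9, m10, m11, m12⟩
  refine wp.seq_frame (Q' := fun s₂ => s₂.mem = s₁.mem ∧ s₂.reg 20 = t.root ∧ s₂.reg 24 = 0 ∧
    s₂.time = s₁.time + 2) ?_ ?_
  · apply wp_of_vc
    rcases hK with rfl | rfl <;> simp only [dictArr, linkArr] at * <;>
      simp [vc, e10, hi, em, hroot, -Tr.root]
  rintro s₂ ⟨fm, f20, f24, t2⟩ fr2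
  have hne : ∀ c ∈ t.cells, c ≠ f := fun c hc e => hft (e ▸ hc)
  have hm : ∀ c ∈ t.cells, ∀ j, s₂.mem j c = s.mem j c := fun c hc j => by
    rw [fm, em j c fun _ => hne c hc]
  have hck : ∀ c ∈ t.cells, cellKey s₂.mem c = cellKey s.mem c := fun c hc => by
    simp only [cellKey, hm c hc]
  have hs2 : SortedBy s₂.mem t.cells := hs.imp_of_mem fun ha hb h => by
    rwa [hck _ ha, hck _ hb]
  refine (findPath_spec (k := k) (by rw [fr2.reg 2 rfl, e2]) (by rw [fr2.reg 3 rfl, e3])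
    (by rw [fr2.reg 11 rfl, e11]) (by rw [fr2.reg 12 rfl, e12]) f20 f24
    (rt.congr fun c hc j _ => hm c hc j) (fun c hc => (hlt c hc).trans hf) (by omega) hXW hs2
    fun c hc => by rw [hck c hc]; exact hk c hc).seq_frame ?_
  rintro s₃ ⟨t3, fs, hplug, hfs, pr, g24, gL, gR⟩ fr3
  have g7 : s₃.reg 7 = f + 1 := by rw [fr3.reg 7 rfl, fr2.reg 7 rfl, e7]
  have g2 : s₃.reg 2 = 0 := by rw [fr3.reg 2 rfl, fr2.reg 2 rfl, e2]
  have g3 : s₃.reg 3 = 1 := by rw [fr3.reg 3 rfl, fr2.reg 3 rfl, e3]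
  have g10 : s₃.reg 10 = i := by rw [fr3.reg 10 rfl, fr2.reg 10 rfl, e10]
  have g23 : s₃.reg 23 = f := by rw [fr3.reg 23 rfl, fr2.reg 23 rfl, e23]
  have gm : ∀ j, j ≠ pathArr → j ≠ dirArr → s₃.mem j = s₁.mem j := fun j h h' => by
    rw [fr3.mem j (by simp [findPath, Prog.writesArr]; tauto), fm]
  have htc : t.cells = pathL fs ++ pathR fs := by rw [← hplug, cells_plug]; simp
  have hpc : (plug fs (.node f .nil .nil)).cells = pathL fs ++ f :: pathR fs := by
    rw [cells_plug]; simp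
  have hndp : (plug fs (.node f .nil .nil)).cells.Nodup := by
    rw [hpc]
    rw [htc] at hnd hft
    exact List.nodup_middle.2 (List.nodup_cons.2 ⟨hft, hnd⟩)
  have hmemp : ∀ c ∈ (plug fs (.node f .nil .nil)).cells, c = f ∨ c ∈ t.cells := by
    rw [hpc, htc]
    intro c hc
    simp only [List.mem_append, List.mem_cons] at hc ⊢
    tauto
  have hlenp : (plug fs (.node f .nil .nil)).cells.length = t.cells.length + 1 := by
    rw [hpc, htc]; simp; omega
  have hht := t.ht_le_length
  refine wp_seq_vc ?_
  show wp X W _ _ _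
  -- The new cell is a tree of height one that replaces an empty one.
  refine (closePath_spec (fs := fs) (u := .node f .nil .nil) (u₀ := .nil) (by simpa using g2)
    (by simpa using g3) (by simpa using g23) (by simpa using g24) ?_ (by simpa using pr) ?_
    (by simp) (by rw [hplug]; exact at') (by simp) hndp (fun c hc => ?_)
    (by omega) (by omega)).seq_frame ?_
  · rw [State.setReg_mem, gm _ (by simp) (by simp), em _ _ fun _ => hf0.symm, h0]
  · simp only [State.setReg_mem, Tr.Rep]
    refine ⟨hf0, ?_, ?_, ?_, trivial, trivial⟩
    · rw [gm _ (by simp) (by simp)]; exact m7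
    · rw [gm _ (by simp) (by simp)]; exact m8
    · rw [gm _ (by simp) (by simp)]; exact m12
  · rcases hmemp c hc with rfl | h
    exacts [hf, (hlt c h).trans hf]
  rintro s₄ ⟨t4, t', r', a', c', x', o'⟩ fr4
  have i10 : s₄.reg 10 = i := by rw [fr4.reg 10 rfl]; simpa using g10
  have i7 : s₄.reg 7 = f + 1 := by rw [fr4.reg 7 rfl]; simpa using g7
  have hKne : K ≠ 7 ∧ K ≠ 8 ∧ K ≠ 9 ∧ K ≠ 10 ∧ K ≠ 11 ∧ K ≠ 12 ∧ K ≠ 15 ∧ K ≠ 16 := by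
    rcases hK with rfl | rfl <;> simp
  obtain ⟨k7, k8, k9, k10, k11, k12, k15, k16⟩ := hKne
  have om : ∀ j c, (j = leftArr ∨ j = rightArr ∨ j = htArr → c ∉ t'.cells) → j ≠ pathArr →
      j ≠ dirArr → s₄.mem j c = s₁.mem j c := fun j c h h1 h2 => by
    rw [o' j c h, State.setReg_mem, gm j h1 h2]
  apply wp_of_vc
  simp only [vc, i10, x', State.setMem_time, State.setMem_reg, State.setMem_mem]
  simp only [State.setReg_time] at t4
  have hupd : ∀ j, j ≠ K → ∀ v, Function.update s₄.mem K v j = s₄.mem j := fun j hj v =>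
    Function.update_of_ne hj _ _
  have hkf : cellKey (Function.update s₄.mem K (Function.update (s₄.mem K) i t'.root)) f = k := by
    simp only [cellKey]
    rw [hupd keyTagArr k9.symm, hupd keyValArr k10.symm, om _ _ (by simp) (by simp) (by simp),
      om _ _ (by simp) (by simp) (by simp)]
    simp [m9, m10]
  have hkc : ∀ c ∈ t.cells,
      cellKey (Function.update s₄.mem K (Function.update (s₄.mem K) i t'.root)) c =
        cellKey s₂.mem c := fun c hc => by
    simp only [cellKey]
    rw [hupd keyTagArr k9.symm, hupd keyValArr k10.symm, om _ _ (by simp) (by simp) (by simp),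
      om _ _ (by simp) (by simp) (by simp), fm]
  refine ⟨hi, by omega, i7, t', pathL fs, pathR fs, htc, by rw [c', hpc], ?_, a', by simp, ?_, hkf,
    ?_, ?_⟩
  · refine r'.congr fun c _ j hj => ?_
    rw [hupd]
    rcases hj with rfl | rfl | rfl
    exacts [k7.symm, k8.symm, k12.symm]
  · rw [c', hpc]
    rw [htc] at hs2 hkc
    obtain ⟨p1, p2, p3⟩ := List.pairwise_append.1 hs2
    have hl : ∀ c ∈ pathL fs, c ∈ pathL fs ++ pathR fs := fun c hc => List.mem_append_left _ hc
    have hr : ∀ c ∈ pathR fs, c ∈ pathL fs ++ pathR fs := fun c hc => List.mem_append_right _ hc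
    refine List.pairwise_append.2 ⟨p1.imp_of_mem fun ha hb h => ?_, List.pairwise_cons.2
      ⟨fun c hc => ?_, p2.imp_of_mem fun ha hb h => ?_⟩, fun c hc d hd => ?_⟩
    · rwa [hkc _ (hl _ ha), hkc _ (hl _ hb)]
    · rw [hkf, hkc _ (hr _ hc)]; exact gR c hc
    · rwa [hkc _ (hr _ ha), hkc _ (hr _ hb)]
    · rw [hkc _ (hl _ hc)]
      rcases List.mem_cons.1 hd with rfl | hd
      · rw [hkf]; exact gL c hc
      · rw [hkc _ (hr _ hd)]; exact p3 c hc d hd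
  · rw [hupd targetArr k11.symm, om _ _ (by simp) (by simp) (by simp)]
    exact m11
  · intro j c h1 h2 h3 h4 h5
    have : s₁.mem j c = s.mem j c := em j c fun hj e => by
      subst e
      by_cases hj' : j = leftArr ∨ j = rightArr ∨ j = htArr
      · exact h1 hj' (by rw [c', hpc]; simp)
      · simp at hj'
        exact h2 (by simp; omega) rfl
    by_cases hj : j = K
    · subst hj
      rw [Function.update_self, Function.update_of_ne (h3 rfl), om _ _ h1 h4 h5, this]
    · rw [hupd _ hj, om _ _ h1 h4 h5, this]

/-! ### Families of dictionaries -/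

/-- The array of the pointers to the dictionaries of the edges (`true`) or of the links. -/
def dArr (b : Bool) : ℕ := if b then dictArr else linkArr

@[simp] theorem dArr_true : dArr true = 6 := rfl
@[simp] theorem dArr_false : dArr false = 13 := rfl

/-- `E b i k t`: the dictionary number `i` of the kind `b` has the target `t` under the key `k`. -/
abbrev Entries := Bool → ℕ → ℕ × ℕ → ℕ → Prop

/-- The entries after an insertion. -/
def Entries.insert (E : Entries) (b : Bool) (i : ℕ) (k : ℕ × ℕ) (t : ℕ) : Entries :=
  fun b' i' k' t' => E b' i' k' t' ∨ (b' = b ∧ i' = i ∧ k' = k ∧ t' = t)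

/-- The entries after the target under the key `k` has been replaced by `t`. -/
def Entries.retarget (E : Entries) (b : Bool) (i : ℕ) (k : ℕ × ℕ) (t : ℕ) : Entries :=
  fun b' i' k' t' => if b' = b ∧ i' = i ∧ k' = k then t' = t else E b' i' k' t'

/-- The memory represents the binary search trees `tr`, with cells less than `f`. -/
structure DictRep (m : ℕ → ℕ → ℕ) (f : ℕ) (tr : Bool → ℕ → Tr) : Prop where
  root : ∀ b i, m (dArr b) i = (tr b i).root
  rep : ∀ b i, (tr b i).Rep m
  avl : ∀ b i, (tr b i).Avl
  nodup : ∀ b i, (tr b i).cells.Nodup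
  lt : ∀ b i, ∀ c ∈ (tr b i).cells, c < f
  sorted : ∀ b i, SortedBy m (tr b i).cells
  disj : ∀ b i b' i' c, c ∈ (tr b i).cells → c ∈ (tr b' i').cells → b = b' ∧ i = i'
  zero : m htArr 0 = 0
  pos : f ≠ 0

/-- The memory holds dictionaries with the entries `E`, with cells less than `f`. -/
def Dict (m : ℕ → ℕ → ℕ) (f : ℕ) (E : Entries) : Prop :=
  ∃ tr, DictRep m f tr ∧ ∀ b i k t, E b i k t ↔
    ∃ c ∈ (tr b i).cells, cellKey m c = k ∧ m targetArr c = t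

/-- The dictionary number `i` of the kind `b` has at most `M` keys. -/
def Small (E : Entries) (M : ℕ) (b : Bool) (i : ℕ) : Prop :=
  ∃ F : Finset (ℕ × ℕ), F.card ≤ M ∧ ∀ k t, E b i k t → k ∈ F

/-- A bound for the height of a balanced search tree with at most `M` keys. -/
def htBound (M : ℕ) : ℕ := 2 * Nat.log 2 (M + 1) + 1

theorem SortedBy.inj {m : ℕ → ℕ → ℕ} {cs : List ℕ} (h : SortedBy m cs) {c d : ℕ} (hc : c ∈ cs)
    (hd : d ∈ cs) (hcd : cellKey m c = cellKey m d) : c = d := by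
  by_contra hne
  rcases List.pairwise_iff_getElem.1 h with h
  obtain ⟨i, hi, rfl⟩ := List.getElem_of_mem hc
  obtain ⟨j, hj, rfl⟩ := List.getElem_of_mem hd
  rcases lt_trichotomy i j with hij | rfl | hij
  · exact absurd (h i j hi hj hij) (by rw [hcd]; exact lt_irrefl _)
  · exact hne rfl
  · exact absurd (h j i hj hi hij) (by rw [hcd]; exact lt_irrefl _)

/-- Strictly sorted keys are distinct, so there are at most as many cells as possible keys, and the
AVL condition bounds the height. -/
theorem DictRep.ht_le {m : ℕ → ℕ → ℕ} {f M : ℕ} {tr : Bool → ℕ → Tr} (h : DictRep m f tr)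
    {b : Bool} {i : ℕ} {F : Finset (ℕ × ℕ)} (hF : F.card ≤ M)
    (hk : ∀ c ∈ (tr b i).cells, cellKey m c ∈ F) : (tr b i).ht ≤ htBound M := by
  refine (h.avl b i).ht_le ?_
  rw [← List.toFinset_card_of_nodup (h.nodup b i)]
  refine (Finset.card_le_card_of_injOn (cellKey m) (fun c hc => hk c ?_) ?_).trans hF
  · simpa using hc
  · intro c hc d hd hcd
    exact (h.sorted b i).inj (by simpa using hc) (by simpa using hd) hcd

theorem Dict.unique {m : ℕ → ℕ → ℕ} {f : ℕ} {E : Entries} (h : Dict m f E) {b : Bool} {i : ℕ}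
    {k : ℕ × ℕ} {t t' : ℕ} (h1 : E b i k t) (h2 : E b i k t') : t = t' := by
  obtain ⟨tr, hr, hE⟩ := h
  obtain ⟨c, hc, hk, rfl⟩ := (hE _ _ _ _).1 h1
  obtain ⟨d, hd, hk', rfl⟩ := (hE _ _ _ _).1 h2
  rw [(hr.sorted b i).inj hc hd (hk.trans hk'.symm)]

theorem Dict.congr {m m' : ℕ → ℕ → ℕ} {f : ℕ} {E : Entries} (h : Dict m f E)
    (hm : ∀ j, 6 ≤ j → j ≤ 13 → m' j = m j) : Dict m' f E := by
  obtain ⟨tr, hr, hE⟩ := h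
  have hck : cellKey m' = cellKey m := by
    funext c
    simp only [cellKey]
    rw [hm _ (by simp) (by simp), hm _ (by simp) (by simp)]
  refine ⟨tr, ⟨fun b i => ?_, fun b i => ?_, hr.avl, hr.nodup, hr.lt, fun b i => ?_, hr.disj, ?_,
    hr.pos⟩, fun b i k t => ?_⟩
  · rw [hm _ (by cases b <;> simp) (by cases b <;> simp), hr.root]
  · exact (hr.rep b i).congr fun c _ j hj => by
      rw [hm j (by rcases hj with rfl | rfl | rfl <;> simp)
        (by rcases hj with rfl | rfl | rfl <;> simp)]
  · simpa only [SortedBy, hck] using hr.sorted b i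
  · rw [hm _ (by simp) (by simp), hr.zero]
  · rw [hck, hm _ (by simp) (by simp), hE]

/-- A hit also yields the dictionary obtained by overwriting the target in the cell found; this is
how an edge is redirected to a node that splits it. Other dictionaries are not affected because of
`disj`. -/
theorem Dict.lookup_spec {X W : ℕ} {s : State} {f M i : ℕ} {b : Bool} {E : Entries} {k : ℕ × ℕ}
    (hd : Dict s.mem f E) (hM : Small E M b i) (h2 : s.reg 2 = 0) (h10 : s.reg 10 = i)
    (hi : i < X) (h11 : s.reg 11 = k.1) (h12 : s.reg 12 = k.2) (hf : f ≤ X) :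
    wp X W (lookup (dArr b)) (fun s' => s'.mem = s.mem ∧ s'.time ≤ s.time + 8 * htBound M + 3 ∧
      ((s'.reg 14 = 0 ∧ ∀ t, ¬ E b i k t) ∨
        (s'.reg 14 ≠ 0 ∧ s'.reg 14 < X ∧ E b i k (s.mem targetArr (s'.reg 14)) ∧
          ∀ t, Dict (Function.update s.mem targetArr
            (Function.update (s.mem targetArr) (s'.reg 14) t)) f (E.retarget b i k t)))) s := by
  obtain ⟨tr, hr, hE⟩ := hd
  obtain ⟨F, hF, hk⟩ := hM
  have hht := hr.ht_le hF fun c hc => hk _ _ ((hE b i _ _).2 ⟨c, hc, rfl, rfl⟩)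
  refine (PSuffixTree.lookup_spec h2 (by rwa [h10]) (by rw [h10]; exact hr.root b i) (hr.rep b i)
    (fun c hc => (hr.lt b i c hc).trans_le hf) (hr.sorted b i)).mono ?_
  rw [h11, h12]
  rintro s' ⟨hm, ht, ⟨h14, h⟩ | ⟨h14, h⟩⟩
  · refine ⟨hm, by omega, .inl ⟨h14, fun t ht => ?_⟩⟩
    obtain ⟨c, hc, hck, -⟩ := (hE _ _ _ _).1 ht
    exact h c hc hck
  · refine ⟨hm, by omega, .inr ⟨(hr.rep b i).ne_zero _ h14, (hr.lt b i _ h14).trans_le hf,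
      (hE _ _ _ _).2 ⟨_, h14, h, rfl⟩, fun t => ?_⟩⟩
    generalize s'.reg 14 = c at *
    have hj : ∀ j ≠ targetArr, Function.update s.mem targetArr
        (Function.update (s.mem targetArr) c t) j = s.mem j := fun j hj =>
      Function.update_of_ne hj _ _
    have hck : cellKey (Function.update s.mem targetArr
        (Function.update (s.mem targetArr) c t)) = cellKey s.mem := by
      funext d
      simp only [cellKey]
      rw [hj _ (by simp), hj _ (by simp)]
    refine ⟨tr, ⟨fun b i => ?_, fun b i => ?_, hr.avl, hr.nodup, hr.lt, fun b i => ?_, hr.disj, ?_,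
      hr.pos⟩, fun b' i' k' t' => ?_⟩
    · rw [hj _ (by cases b <;> simp), hr.root]
    · exact (hr.rep b i).congr fun c _ j h => by
        rw [hj j (by rcases h with rfl | rfl | rfl <;> simp)]
    · simpa only [SortedBy, hck] using hr.sorted b i
    · rw [hj _ (by simp), hr.zero]
    · rw [hck, Function.update_self, Entries.retarget]
      split_ifs with heq
      · obtain ⟨rfl, rfl, rfl⟩ := heq
        constructor
        · rintro rfl
          exact ⟨c, h14, h, by simp⟩
        · rintro ⟨d, hd, hdk, rfl⟩
          rw [(hr.sorted _ _).inj hd h14 (hdk.trans h.symm)]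
          simp
      · rw [hE]
        refine exists_congr fun d => and_congr_right fun hd => and_congr_right fun hdk => ?_
        rw [Function.update_of_ne]
        rintro rfl
        obtain ⟨rfl, rfl⟩ := hr.disj _ _ _ _ _ hd h14
        exact heq ⟨rfl, rfl, hdk.symm.trans h⟩

/-- The cell `f` is not in use and different dictionaries share no cells, so only one of the trees
changes. The counter `f` serves the edges and the links together; later it measures how many links
have been inserted. -/
theorem Dict.insert_spec {X W : ℕ} {s : State} {f M i t : ℕ} {b : Bool} {E : Entries} {k : ℕ × ℕ}
    (hd : Dict s.mem f E) (hM : Small E M b i) (h2 : s.reg 2 = 0) (h3 : s.reg 3 = 1)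
    (h7 : s.reg 7 = f) (h10 : s.reg 10 = i)
    (hi : i < X) (h11 : s.reg 11 = k.1) (h12 : s.reg 12 = k.2) (h13 : s.reg 13 = t) (hf : f < X)
    (hXW : X ≤ W) (hE : ∀ t, ¬ E b i k t) :
    wp X W (dictInsert (dArr b)) (fun s' => s'.time ≤ s.time + 86 * htBound M + 14 ∧
      s'.reg 7 = f + 1 ∧ Dict s'.mem (f + 1) (E.insert b i k t)) s := by
  obtain ⟨tr, hr, hE'⟩ := hd
  obtain ⟨F, hF, hk⟩ := hM
  have hht := hr.ht_le hF fun c hc => hk _ _ ((hE' b i _ _).2 ⟨c, hc, rfl, rfl⟩)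
  refine (PSuffixTree.insert_spec (by cases b <;> simp) h2 h3 h10 hi h7 hr.pos hf hXW h11 h12 h13
    (hr.root b i) hr.zero (hr.rep b i) (hr.avl b i) (hr.nodup b i) (hr.lt b i) (hr.sorted b i)
    fun c hc hck => hE _ ((hE' _ _ _ _).2 ⟨c, hc, hck, rfl⟩)).mono ?_
  rintro s' ⟨ht, g7, t', l, r, hc, hc', r', a', root', sorted', key', tgt', hm⟩
  have hmem : ∀ c, c ∈ t'.cells ↔ c = f ∨ c ∈ (tr b i).cells := fun c => by
    rw [hc, hc']; simp only [List.mem_append, List.mem_cons]; tauto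
  have hff : ∀ b i, f ∉ (tr b i).cells := fun b i h => lt_irrefl f (hr.lt b i f h)
  have old : ∀ b' i', ¬ (b' = b ∧ i' = i) → ∀ c ∈ (tr b' i').cells, ∀ j, j ≠ dArr b →
      j ≠ pathArr → j ≠ dirArr → s'.mem j c = s.mem j c := by
    intro b' i' hne c hcm j hj h1 h2
    refine hm j c (fun _ hct => ?_) (fun _ e => hff b' i' (e ▸ hcm)) (fun e => absurd e hj) h1 h2
    rcases (hmem c).1 hct with rfl | h
    · exact hff _ _ hcm
    · exact hne (hr.disj _ _ _ _ _ hcm h)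
  have hkey : ∀ b' i', ∀ c ∈ (tr b' i').cells, cellKey s'.mem c = cellKey s.mem c ∧
      s'.mem targetArr c = s.mem targetArr c := by
    intro b' i' c hcm
    have : ∀ j, j = 9 ∨ j = 10 ∨ j = 11 → s'.mem j c = s.mem j c := by
      intro j hj
      refine hm j c (fun h => ?_) (fun _ e => hff b' i' (e ▸ hcm)) (fun e => ?_) ?_ ?_
      · simp at h; omega
      · cases b <;> simp at e <;> omega
      · simp; omega
      · simp; omega
    simp [cellKey, this]
  let tr' : Bool → ℕ → Tr := fun b' i' => if b' = b ∧ i' = i then t' else tr b' i'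
  have htr : tr' b i = t' := if_pos ⟨rfl, rfl⟩
  have htr' : ∀ b' i', ¬ (b' = b ∧ i' = i) → tr' b' i' = tr b' i' := fun b' i' h => if_neg h
  have hfree : ∀ j, j = leftArr ∨ j = rightArr ∨ j = htArr → j ≠ dArr b ∧ j ≠ pathArr ∧
      j ≠ dirArr := by
    rintro j (rfl | rfl | rfl) <;> cases b <;> simp
  have hnd' : t'.cells.Nodup := by
    rw [hc']
    have h1 := hr.nodup b i
    have h2 := hff b i
    rw [hc] at h1 h2
    exact List.nodup_middle.2 (List.nodup_cons.2 ⟨h2, h1⟩)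
  refine ⟨by omega, g7, tr', ⟨?_, ?_, ?_, ?_, ?_, ?_, ?_, ?_, by omega⟩, ?_⟩
  · intro b' i'
    by_cases h : b' = b ∧ i' = i
    · obtain ⟨rfl, rfl⟩ := h
      rw [htr, root']
    · rw [htr' _ _ h, ← hr.root]
      apply hm
      · intro e; cases b' <;> simp at e
      · intro e; cases b' <;> simp at e
      · intro e hii
        refine h ⟨?_, hii⟩
        cases b <;> cases b' <;> simp at e <;> rfl
      · cases b' <;> simp
      · cases b' <;> simp
  · intro b' i'
    by_cases h : b' = b ∧ i' = i
    · obtain ⟨rfl, rfl⟩ := h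
      rwa [htr]
    · rw [htr' _ _ h]
      exact (hr.rep b' i').congr fun c hcm j hj =>
        old b' i' h c hcm j (hfree j hj).1 (hfree j hj).2.1 (hfree j hj).2.2
  · intro b' i'
    by_cases h : b' = b ∧ i' = i
    · obtain ⟨rfl, rfl⟩ := h
      rwa [htr]
    · rw [htr' _ _ h]
      exact hr.avl _ _
  · intro b' i'
    by_cases h : b' = b ∧ i' = i
    · obtain ⟨rfl, rfl⟩ := h
      rwa [htr]
    · rw [htr' _ _ h]
      exact hr.nodup _ _
  · intro b' i' c hcm
    by_cases h : b' = b ∧ i' = i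
    · obtain ⟨rfl, rfl⟩ := h
      rw [htr, hmem] at hcm
      rcases hcm with rfl | hcm
      · omega
      · exact (hr.lt _ _ c hcm).trans (Nat.lt_succ_self f)
    · rw [htr' _ _ h] at hcm
      exact (hr.lt _ _ c hcm).trans (Nat.lt_succ_self f)
  · intro b' i'
    by_cases h : b' = b ∧ i' = i
    · obtain ⟨rfl, rfl⟩ := h
      rwa [htr]
    · rw [htr' _ _ h]
      exact (hr.sorted b' i').imp_of_mem fun ha hb h => by
        rwa [(hkey _ _ _ ha).1, (hkey _ _ _ hb).1]
  · intro b₁ i₁ b₂ i₂ c h1 h2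
    by_cases e1 : b₁ = b ∧ i₁ = i <;> by_cases e2 : b₂ = b ∧ i₂ = i
    · exact ⟨e1.1.trans e2.1.symm, e1.2.trans e2.2.symm⟩
    · obtain ⟨rfl, rfl⟩ := e1
      rw [htr, hmem] at h1
      rw [htr' _ _ e2] at h2
      rcases h1 with rfl | h1
      · exact absurd h2 (hff _ _)
      · exact hr.disj _ _ _ _ _ h1 h2
    · obtain ⟨rfl, rfl⟩ := e2
      rw [htr, hmem] at h2
      rw [htr' _ _ e1] at h1
      rcases h2 with rfl | h2
      · exact absurd h1 (hff _ _)
      · exact hr.disj _ _ _ _ _ h1 h2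
    · rw [htr' _ _ e1] at h1
      rw [htr' _ _ e2] at h2
      exact hr.disj _ _ _ _ _ h1 h2
  · rw [hm _ _ (fun _ h => ?_) (by simp) (by cases b <;> simp) (by simp) (by simp), hr.zero]
    exact r'.ne_zero _ h rfl
  · intro b' i' k' t''
    by_cases h : b' = b ∧ i' = i
    · obtain ⟨rfl, rfl⟩ := h
      rw [htr, Entries.insert, hE']
      constructor
      · rintro (⟨c, hc, hck, hct⟩ | ⟨-, -, rfl, rfl⟩)
        · exact ⟨c, (hmem c).2 (.inr hc), by rw [(hkey _ _ c hc).1, hck],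
            by rw [(hkey _ _ c hc).2, hct]⟩
        · exact ⟨f, (hmem f).2 (.inl rfl), key', tgt'⟩
      · rintro ⟨c, hc, hck, hct⟩
        rcases (hmem c).1 hc with rfl | hc
        · exact .inr ⟨rfl, rfl, hck.symm.trans key', hct.symm.trans tgt'⟩
        · exact .inl ⟨c, hc, by rw [← (hkey _ _ c hc).1, hck], by rw [← (hkey _ _ c hc).2, hct]⟩
    · rw [htr' _ _ h, Entries.insert, hE']
      constructor
      · rintro (⟨c, hc, hck, hct⟩ | ⟨h1, h2, -⟩)
        · exact ⟨c, hc, by rw [(hkey _ _ c hc).1, hck], by rw [(hkey _ _ c hc).2, hct]⟩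
        · exact absurd ⟨h1, h2⟩ h
      · rintro ⟨c, hc, hck, hct⟩
        exact .inl ⟨c, hc, by rw [← (hkey _ _ c hc).1, hck], by rw [← (hkey _ _ c hc).2, hct]⟩

/-! ## Combinatorics of prev-encodings -/

section Strings

variable {A P : Type*} [DecidableEq A] [DecidableEq P]

theorem prevDist_eq_zero {w : List (A ⊕ P)} {p : P} : prevDist w p = 0 ↔ Sum.inr p ∉ w := by
  unfold prevDist
  have h := List.findIdx_lt_length (xs := w.reverse) (p := fun c => decide (c = Sum.inr p))
  rw [List.length_reverse] at h
  simp only [h]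
  simp

theorem prevDist_spec {w : List (A ⊕ P)} {p : P} {k : ℕ} (h : prevDist w p = k + 1) :
    k < w.length ∧ w[w.length - 1 - k]? = some (Sum.inr p) ∧
      ∀ i, w.length - 1 - k < i → w[i]? ≠ some (Sum.inr p) := by
  unfold prevDist at h
  simp only at h
  split_ifs at h with hlt
  obtain rfl : List.findIdx (fun c => decide (c = Sum.inr p)) w.reverse = k := by omega
  refine ⟨hlt, ?_, fun i hi hi' => ?_⟩
  · have := List.findIdx_getElem (xs := w.reverse) (p := fun c => decide (c = Sum.inr p))
      (w := by simpa using hlt)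
    simp only [decide_eq_true_eq, List.getElem_reverse] at this
    rw [List.getElem?_eq_getElem (by omega), this]
  · obtain ⟨hil, hi'⟩ := List.getElem?_eq_some_iff.1 hi'
    have := List.not_of_lt_findIdx (xs := w.reverse) (p := fun c => decide (c = Sum.inr p))
      (i := w.length - 1 - i) (by omega)
    have e : w.length - 1 - (w.length - 1 - i) = i := by omega
    simp [e, hi'] at this

theorem length_prevEnc (S : List (A ⊕ P)) : (prevEnc S).length = S.length := by
  simp [prevEnc]

theorem getElem?_prevEnc (S : List (A ⊕ P)) (j : ℕ) :
    (prevEnc S)[j]? = S[j]?.map fun c => match c with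
      | Sum.inl a => Sum.inl a
      | Sum.inr p => Sum.inr (prevDist (S.take j) p) := by
  exact List.getElem?_mapIdx

theorem prevDist_cons_of_mem {a : A ⊕ P} {w : List (A ⊕ P)} {p : P} (hp : Sum.inr p ∈ w) :
    prevDist (a :: w) p = prevDist w p := by
  unfold prevDist
  have h := List.findIdx_lt_length (xs := w.reverse) (p := fun c => decide (c = Sum.inr p))
  have h' := h.2 ⟨Sum.inr p, by simpa using hp, by simp⟩
  rw [List.length_reverse] at h'
  simp only [List.reverse_cons, List.findIdx_append, List.length_cons, List.length_reverse,
    if_pos h', if_pos (h'.trans (Nat.lt_succ_self _))]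

theorem prevDist_cons_of_not_mem {a : A ⊕ P} {w : List (A ⊕ P)} {p : P} (hp : Sum.inr p ∉ w) :
    prevDist (a :: w) p = if a = Sum.inr p then w.length + 1 else 0 := by
  unfold prevDist
  have h := List.findIdx_lt_length (xs := w.reverse) (p := fun c => decide (c = Sum.inr p))
  have h' := mt h.1 fun ⟨x, hx, hx'⟩ => hp (by
    rw [decide_eq_true_eq] at hx'
    subst hx'
    simpa using hx)
  rw [List.length_reverse] at h'
  simp only [List.reverse_cons, List.findIdx_append, List.length_cons, List.length_reverse,
    if_neg h']
  by_cases ha : a = Sum.inr p <;> simp [ha]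

/-- The distance from a symbol that precedes `T` to its first occurrence in `T` if the symbol is a
parameter that occurs in `T`, and `0` otherwise. -/
def nxt : A ⊕ P → List (A ⊕ P) → ℕ
  | Sum.inl _, _ => 0
  | Sum.inr p, T =>
    let i := T.findIdx fun c => decide (c = Sum.inr p)
    if i < T.length then i + 1 else 0

/-- The first symbol of the prev-encoding of a string that begins with the given symbol. -/
def headSym : A ⊕ P → A ⊕ ℕ
  | Sum.inl a => Sum.inl a
  | Sum.inr _ => Sum.inr 0

theorem nxt_eq_succ {a : A ⊕ P} {T : List (A ⊕ P)} {j : ℕ} :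
    nxt a T = j + 1 ↔ ∃ p, a = Sum.inr p ∧ T[j]? = some (Sum.inr p) ∧
      Sum.inr p ∉ T.take j := by
  cases a with
  | inl a => simp [nxt]
  | inr p =>
    simp only [nxt, Sum.inr.injEq, exists_eq_left']
    constructor
    · intro h
      split_ifs at h with hlt
      obtain rfl : List.findIdx (fun c => decide (c = Sum.inr p)) T = j := by omega
      refine ⟨?_, fun hm => ?_⟩
      · have := List.findIdx_getElem (w := hlt)
        rw [List.getElem?_eq_getElem hlt]
        simpa using this
      · obtain ⟨i, hi, he⟩ := List.mem_take_iff_getElem.1 hm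
        have := List.not_of_lt_findIdx (lt_of_lt_of_le hi (min_le_left _ _))
        simp [he] at this
    · rintro ⟨h1, h2⟩
      obtain ⟨hj, h1⟩ := List.getElem?_eq_some_iff.1 h1
      have : List.findIdx (fun c => decide (c = Sum.inr p)) T = j := by
        rw [List.findIdx_eq hj]
        refine ⟨by simp [h1], fun i hi => ?_⟩
        simp only [decide_eq_false_iff_not]
        exact fun e => h2 (List.mem_take_iff_getElem.2 ⟨i, by omega, e⟩)
      rw [this, if_pos hj]

theorem nxt_le (a : A ⊕ P) (T : List (A ⊕ P)) : nxt a T ≤ T.length := by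
  rcases h : nxt a T with _ | j
  · simp
  · obtain ⟨p, -, h, -⟩ := nxt_eq_succ.1 h
    exact (List.getElem?_eq_some_iff.1 h).1

/-- The next occurrence of `a` is the first one of this parameter within `T`, so before `a` is
prepended it is encoded by 0. -/
theorem getElem?_prevEnc_nxt {a : A ⊕ P} {T : List (A ⊕ P)} {j : ℕ} (h : nxt a T = j + 1) :
    (prevEnc T)[j]? = some (Sum.inr 0) := by
  obtain ⟨p, -, h1, h2⟩ := nxt_eq_succ.1 h
  rw [getElem?_prevEnc, h1, Option.map_some]
  dsimp only
  rw [prevDist_eq_zero.2 h2]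

theorem getElem?_prevEnc_cons_zero (a : A ⊕ P) (T : List (A ⊕ P)) :
    (prevEnc (a :: T))[0]? = some (headSym a) := by
  rw [getElem?_prevEnc]
  cases a <;> simp [headSym, prevDist_eq_zero]

/-- Only a first occurrence in `T` can acquire a predecessor, and only if it is an occurrence of
`a`. So prepending `a` alters the encoding of `T` in at most one place. All of the combinatorics
below depends on this. -/
theorem getElem?_prevEnc_cons_succ (a : A ⊕ P) (T : List (A ⊕ P)) (j : ℕ) :
    (prevEnc (a :: T))[j + 1]? =
      (prevEnc T)[j]?.map fun e => if nxt a T = j + 1 then Sum.inr (j + 1) else e := by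
  rw [getElem?_prevEnc, getElem?_prevEnc, List.getElem?_cons_succ]
  rcases hc : T[j]? with _ | c
  · simp
  · obtain ⟨hj, -⟩ := List.getElem?_eq_some_iff.1 hc
    simp only [Option.map_some, Option.some.injEq, List.take_succ_cons]
    cases c with
    | inl b =>
      rw [if_neg]
      intro h
      obtain ⟨p, -, h, -⟩ := nxt_eq_succ.1 h
      simp [hc] at h
    | inr p =>
      dsimp only
      by_cases hp : Sum.inr p ∈ T.take j
      · rw [prevDist_cons_of_mem hp, if_neg]
        intro h
        obtain ⟨q, -, h1, h2⟩ := nxt_eq_succ.1 h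
        rw [hc] at h1
        cases h1
        exact h2 hp
      · rw [prevDist_cons_of_not_mem hp, prevDist_eq_zero.2 hp, List.length_take,
          min_eq_left hj.le]
        by_cases ha : a = Sum.inr p
        · rw [if_pos ha, if_pos (nxt_eq_succ.2 ⟨p, ha, hc, hp⟩)]
        · rw [if_neg ha, if_neg]
          intro h
          obtain ⟨q, h0, h1, -⟩ := nxt_eq_succ.1 h
          rw [hc] at h1
          cases h1
          exact ha h0

/-- A symbol at position `j` of a prev-encoding, read in a longer string. -/
def trunc (j : ℕ) : A ⊕ ℕ → A ⊕ ℕ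
  | Sum.inl a => Sum.inl a
  | Sum.inr v => if v ≤ j then Sum.inr v else Sum.inr 0

theorem le_of_getElem?_prevEnc {T : List (A ⊕ P)} {j v : ℕ}
    (h : (prevEnc T)[j]? = some (Sum.inr v)) : v ≤ j := by
  induction T generalizing j with
  | nil => simp [prevEnc] at h
  | cons a T ih =>
    cases j with
    | zero =>
      rw [getElem?_prevEnc_cons_zero] at h
      cases a <;> simp [headSym] at h
      omega
    | succ j =>
      rw [getElem?_prevEnc_cons_succ] at h
      obtain ⟨e, he, h⟩ := Option.map_eq_some_iff.1 h
      split_ifs at h with hn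
      · cases h; exact le_rfl
      · subst h
        exact (ih he).trans (Nat.le_succ j)

theorem trunc_getElem?_prevEnc (T : List (A ⊕ P)) (j : ℕ) :
    ((prevEnc T)[j]?).map (trunc j) = (prevEnc T)[j]? := by
  rcases h : (prevEnc T)[j]? with _ | (a | v)
  · rfl
  · rfl
  · simp [trunc, le_of_getElem?_prevEnc h]

/-- By induction on `V`: a symbol changed by prepending was 0 and now points to a place outside of
`U`, so `trunc` restores the 0. -/
theorem getElem?_prevEnc_suffix (V U : List (A ⊕ P)) (j : ℕ) :
    (prevEnc U)[j]? = ((prevEnc (V ++ U))[V.length + j]?).map (trunc j) := by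
  induction V with
  | nil => simp [trunc_getElem?_prevEnc]
  | cons a V ih =>
    rw [ih, List.cons_append, List.length_cons, Nat.add_right_comm, getElem?_prevEnc_cons_succ,
      Option.map_map]
    rcases he : (prevEnc (V ++ U))[V.length + j]? with _ | e
    · rfl
    · simp only [Option.map_some, Function.comp_apply]
      split_ifs with h
      · have h0 := getElem?_prevEnc_nxt h
        rw [he] at h0
        cases h0
        simp only [trunc, Nat.zero_le, if_true]
        rw [if_neg (by omega)]
      · rfl

theorem getElem?_prevEnc_tail (a : A ⊕ P) (T : List (A ⊕ P)) (j : ℕ) :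
    (prevEnc T)[j]? = ((prevEnc (a :: T))[j + 1]?).map (trunc j) := by
  have := getElem?_prevEnc_suffix [a] T j
  rwa [List.length_singleton, add_comm] at this

/-! ### Positions of parameters -/

theorem getElem?_prevEnc_eq_zero {U : List (A ⊕ P)} {j : ℕ}
    (h : (prevEnc U)[j]? = some (Sum.inr 0)) :
    ∃ p, U[j]? = some (Sum.inr p) ∧ Sum.inr p ∉ U.take j := by
  rw [getElem?_prevEnc] at h
  obtain ⟨c, hc, h⟩ := Option.map_eq_some_iff.1 h
  cases c with
  | inl a => simp at h
  | inr p => exact ⟨p, hc, prevDist_eq_zero.1 (by simpa using h)⟩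

theorem getElem?_prevEnc_eq_succ {U : List (A ⊕ P)} {j k : ℕ}
    (h : (prevEnc U)[j]? = some (Sum.inr (k + 1))) :
    k < j ∧ ∃ p, U[j]? = some (Sum.inr p) ∧ U[j - 1 - k]? = some (Sum.inr p) ∧
      ∀ i, j - 1 - k < i → i < j → U[i]? ≠ some (Sum.inr p) := by
  rw [getElem?_prevEnc] at h
  obtain ⟨c, hc, h⟩ := Option.map_eq_some_iff.1 h
  have hj := (List.getElem?_eq_some_iff.1 hc).1
  cases c with
  | inl a => simp at h
  | inr p =>
    obtain ⟨h1, h2, h3⟩ := prevDist_spec (by simpa using h)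
    rw [List.length_take, min_eq_left hj.le] at h1 h2 h3
    rw [List.getElem?_take_of_lt (by omega)] at h2
    exact ⟨h1, p, hc, h2, fun i hi hi' => by
      simpa [List.getElem?_take_of_lt hi'] using h3 i hi⟩

theorem prefix_getElem? {α : Type*} {x y : List α} (h : x <+: y) {j : ℕ} (hj : j < x.length) :
    x[j]? = y[j]? := by
  obtain ⟨z, rfl⟩ := h
  rw [List.getElem?_append_left hj]

/-- Zeros mark the first occurrences of parameters, and these belong to different parameters. -/
theorem card_zeros_le [Fintype P] {U : List (A ⊕ P)} {x : List (A ⊕ ℕ)} (hx : x <+: prevEnc U) :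
    ((Finset.range x.length).filter fun j => x[j]? = some (Sum.inr 0)).card ≤ Fintype.card P := by
  have h : ∀ j, j < x.length ∧ x[j]? = some (Sum.inr 0) →
      ∃ p, U[j]? = some (Sum.inr p) ∧ Sum.inr p ∉ U.take j := fun j hj =>
    getElem?_prevEnc_eq_zero (by rw [← prefix_getElem? hx hj.1, hj.2])
  cases isEmpty_or_nonempty P
  · rw [Fintype.card_eq_zero, Nat.le_zero, Finset.card_eq_zero, Finset.filter_eq_empty_iff]
    exact fun j hj hj' => isEmptyElim (h j ⟨Finset.mem_range.1 hj, hj'⟩).choose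
  choose! f hf1 hf2 using h
  rw [← Finset.card_univ]
  refine Finset.card_le_card_of_injOn f (fun _ _ => Finset.mem_univ _) ?_
  have key : ∀ i j, (i < x.length ∧ x[i]? = some (Sum.inr 0)) →
      (j < x.length ∧ x[j]? = some (Sum.inr 0)) → i < j → f i ≠ f j := by
    intro i j hi hj hij he
    refine hf2 j hj ?_
    obtain ⟨hl, h⟩ := List.getElem?_eq_some_iff.1 (hf1 i hi)
    exact List.mem_take_iff_getElem.2 ⟨i, by omega, by rw [h, he]⟩
  intro i hi j hj hij
  simp only [Finset.coe_filter, Finset.mem_range, Set.mem_ofPred_eq] at hi hj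
  rcases lt_trichotomy i j with h | h | h
  exacts [absurd hij (key i j hi hj h), h, absurd hij.symm (key j i hj hi h)]

/-- The numbers that can follow a string `x` in prev-encodings are, apart from `0`, the distances
to the last occurrences of the parameters. -/
theorem eq_of_getElem?_eq {U U' V : List (A ⊕ P)} {x : List (A ⊕ ℕ)} {k k' : ℕ}
    (hV : x <+: prevEnc V) (hU : x ++ [Sum.inr (k + 1)] <+: prevEnc U)
    (hU' : x ++ [Sum.inr (k' + 1)] <+: prevEnc U') (hk : k < x.length ∧ k' < x.length)
    (he : V[x.length - 1 - k]? = V[x.length - 1 - k']?)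
    (hp : ∃ p, V[x.length - 1 - k]? = some (Sum.inr p)) : k = k' := by
  have key : ∀ {U U' : List (A ⊕ P)} {k k' : ℕ}, x ++ [Sum.inr (k + 1)] <+: prevEnc U →
      x ++ [Sum.inr (k' + 1)] <+: prevEnc U' → k < x.length → k' < x.length →
      V[x.length - 1 - k]? = V[x.length - 1 - k']? →
      (∃ p, V[x.length - 1 - k]? = some (Sum.inr p)) → ¬ k < k' := by
    clear! U U' k k'
    intro U U' k k' hU hU' hk hk' he ⟨p, hp⟩ hlt
    classical
    -- If `k < k'`, the parameter `p` occurs in `V` at the place designated by `k'` and again later,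
    -- at the place designated by `k`. At its first later occurrence `j`, the string `x` points back
    -- to the former place. In `U'` these two places then also carry the same parameter, although
    -- the symbol `k' + 1` after `x` says that this parameter does not recur in between.
    have hm : ∃ j, x.length - 1 - k' < j ∧ V[j]? = some (Sum.inr p) := ⟨_, by omega, hp⟩
    obtain ⟨h1, h2⟩ := Nat.find_spec hm
    have h3 : Nat.find hm ≤ x.length - 1 - k := Nat.find_min' hm ⟨by omega, hp⟩
    have h4 : ∀ i, x.length - 1 - k' < i → i < Nat.find hm → V[i]? ≠ some (Sum.inr p) :=
      fun i hi hi' h => Nat.find_min hm hi' ⟨hi, h⟩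
    obtain ⟨j, hj⟩ : ∃ j, j = Nat.find hm := ⟨_, rfl⟩
    rw [← hj] at h1 h2 h3 h4
    clear hj
    have hVj : (prevEnc V)[j]? = some (Sum.inr (j - (x.length - 1 - k'))) := by
      rw [getElem?_prevEnc, h2, Option.map_some]
      dsimp only
      have hjl := (List.getElem?_eq_some_iff.1 h2).1
      have hmem : Sum.inr p ∈ V.take j := by
        obtain ⟨h5, h6⟩ := List.getElem?_eq_some_iff.1 (he ▸ hp)
        exact List.mem_take_iff_getElem.2 ⟨x.length - 1 - k', by omega, h6⟩
      rcases hd : prevDist (V.take j) p with _ | d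
      · exact absurd hmem (prevDist_eq_zero.1 hd)
      · obtain ⟨h5, h6, h7⟩ := prevDist_spec hd
        rw [List.length_take, min_eq_left hjl.le] at h5 h6 h7
        rw [List.getElem?_take_of_lt (by omega)] at h6
        have h8 : ¬ x.length - 1 - k' < j - 1 - d := fun h => h4 _ h (by omega) h6
        have h9 : ¬ j - 1 - d < x.length - 1 - k' := fun h => h7 _ h (by
          rw [List.getElem?_take_of_lt (by omega), ← he, hp])
        rw [show d + 1 = j - (x.length - 1 - k') by omega]
    have hxj : x[j]? = (prevEnc V)[j]? := prefix_getElem? hV (by omega)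
    have hUj : (prevEnc U')[j]? = x[j]? := by
      rw [← prefix_getElem? hU' (by simp; omega), List.getElem?_append_left (by omega)]
    have hUx : (prevEnc U')[x.length]? = some (Sum.inr (k' + 1)) := by
      rw [← prefix_getElem? hU' (by simp)]; simp
    rw [hxj, hVj, show j - (x.length - 1 - k') = (j - (x.length - 1 - k') - 1) + 1 by omega] at hUj
    obtain ⟨-, q, q1, q2, -⟩ := getElem?_prevEnc_eq_succ hUj
    obtain ⟨-, q', q3, q4, q5⟩ := getElem?_prevEnc_eq_succ hUx
    rw [show j - 1 - (j - (x.length - 1 - k') - 1) = x.length - 1 - k' by omega, q4] at q2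
    cases q2
    exact q5 j h1 (by omega) q1
  rcases lt_trichotomy k k' with h | h | h
  · exact absurd h (key hU hU' hk.1 hk.2 he hp)
  · exact h
  · exact absurd h (key hU' hU hk.2 hk.1 he.symm (he ▸ hp))

/-- Each number `k + 1` designates a place of `V` with some parameter, and by `eq_of_getElem?_eq`
different numbers designate different parameters. This bounds the number of children of a node
although the edge labels start with arbitrary numbers. -/
theorem card_succ_le [Fintype P] {V : List (A ⊕ P)} {x : List (A ⊕ ℕ)} (hV : x <+: prevEnc V)
    (F : Finset ℕ) (hF : ∀ k ∈ F, ∃ U : List (A ⊕ P), x ++ [Sum.inr (k + 1)] <+: prevEnc U) :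
    F.card ≤ Fintype.card P := by
  have h : ∀ k ∈ F, k < x.length ∧ ∃ p, V[x.length - 1 - k]? = some (Sum.inr p) := by
    intro k hk
    obtain ⟨U, hU⟩ := hF k hk
    have hUx : (prevEnc U)[x.length]? = some (Sum.inr (k + 1)) := by
      rw [← prefix_getElem? hU (by simp)]; simp
    obtain ⟨h1, p, -, h2, -⟩ := getElem?_prevEnc_eq_succ hUx
    refine ⟨h1, ?_⟩
    -- `U` has a parameter at this place. The encodings of `U` and `V` agree there, and an encoding
    -- shows whether a symbol is static, so `V` has a parameter there too.
    have h3 : (prevEnc V)[x.length - 1 - k]? = (prevEnc U)[x.length - 1 - k]? := by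
      rw [← prefix_getElem? hV (by omega), ← prefix_getElem? hU (by simp; omega),
        List.getElem?_append_left (by omega)]
    rw [getElem?_prevEnc, getElem?_prevEnc, h2] at h3
    rcases hc : V[x.length - 1 - k]? with _ | (a | p)
    · simp [hc] at h3
    · simp [hc] at h3
    · exact ⟨p, rfl⟩
  cases isEmpty_or_nonempty P
  · rw [Fintype.card_eq_zero, Nat.le_zero, Finset.card_eq_zero, Finset.eq_empty_iff_forall_notMem]
    exact fun k hk => isEmptyElim (h k hk).2.choose
  choose! hlt f hf using h
  rw [← Finset.card_univ]
  refine Finset.card_le_card_of_injOn f (fun _ _ => Finset.mem_univ _) ?_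
  intro k hk k' hk' hkk
  obtain ⟨U, hU⟩ := hF k hk
  obtain ⟨U', hU'⟩ := hF k' hk'
  exact eq_of_getElem?_eq hV hU hU' ⟨hlt k hk, hlt k' hk'⟩ (by rw [hf k hk, hf k' hk', hkk])
    ⟨_, hf k hk⟩

end Strings

/-! ## Patricia trees -/

section Patricia

variable {α : Type*}

theorem prefix_take_iff {x y : List α} : x <+: y ↔ x = y.take x.length :=
  List.prefix_iff_eq_take

theorem eq_of_snoc_prefix {x z : List α} {a b : α} (ha : x ++ [a] <+: z) (hb : x ++ [b] <+: z) :
    a = b := by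
  have h := List.prefix_of_prefix_length_le ha hb (by simp)
  simpa using h.eq_of_length (by simp)

theorem exists_snoc_prefix {x z : List α} (h : x <+: z) (hne : x ≠ z) : ∃ a, x ++ [a] <+: z := by
  obtain ⟨y, rfl⟩ := h
  cases y with
  | nil => simp at hne
  | cons a y => exact ⟨a, y, by simp⟩

theorem snoc_prefix_of_prefix {x u z : List α} {a : α} (ha : x ++ [a] <+: z) (hx : x <+: u)
    (hu : u <+: z) (hne : x ≠ u) : x ++ [a] <+: u := by
  obtain ⟨b, hb⟩ := exists_snoc_prefix hx hne
  rwa [eq_of_snoc_prefix ha (hb.trans hu)]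

theorem exists_branch : ∀ {z w : List α}, ¬ z <+: w → ¬ w <+: z →
    ∃ g a b, a ≠ b ∧ g ++ [a] <+: z ∧ g ++ [b] <+: w
  | [], _, h, _ => absurd List.nil_prefix h
  | _ :: _, [], _, h => absurd List.nil_prefix h
  | a :: z, b :: w, h, h' => by
    by_cases hab : a = b
    · subst hab
      obtain ⟨g, c, d, hcd, h1, h2⟩ := exists_branch (z := z) (w := w)
        (fun hp => h ((List.prefix_cons_inj a).2 hp)) (fun hp => h' ((List.prefix_cons_inj a).2 hp))
      exact ⟨a :: g, c, d, hcd, (List.prefix_cons_inj a).2 h1, (List.prefix_cons_inj a).2 h2⟩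
    · exact ⟨[], a, b, hab, by simp, by simp⟩

/-- `z` is a child of `x` in the compacted tree with the set of nodes `N`. -/
def Cov (N : Set (List α)) (x z : List α) : Prop :=
  x ∈ N ∧ z ∈ N ∧ x <+: z ∧ x ≠ z ∧ ∀ u ∈ N, x <+: u → u <+: z → u = x ∨ u = z

theorem isPatriciaEdge_iff {L : Set (List α)} {x y : List α} :
    IsPatriciaEdge L x y ↔ Cov {u | IsPatriciaNode L u} x (x ++ y) := by
  simp [IsPatriciaEdge, Cov]

theorem IsTrieNode.of_prefix {L : Set (List α)} {x y : List α} (hy : IsTrieNode L y)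
    (h : x <+: y) : IsTrieNode L x :=
  let ⟨z, hz, hyz⟩ := hy
  ⟨z, hz, h.trans hyz⟩

theorem IsPatriciaNode.isTrieNode {L : Set (List α)} {x : List α} (h : IsPatriciaNode L x) :
    IsTrieNode L x := by
  rcases h with h | ⟨a, b, -, h, -⟩
  · exact ⟨x, h, List.prefix_rfl⟩
  · exact h.of_prefix (List.prefix_append _ _)

/-- Otherwise `z` and `w` would branch below `h`, and the branching point would be a node strictly
between `v` and `w`. -/
theorem Cov.comparable {L : Set (List α)} {v w h z : List α}
    (hc : Cov {u | IsPatriciaNode L u} v w) (hvh : v <+: h) (hne : v ≠ h) (hhw : h <+: w)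
    (hz : IsTrieNode L z) (hhz : h <+: z) : z <+: w ∨ w <+: z := by
  by_contra! hcon
  obtain ⟨g, a, b, hab, ha, hb⟩ := exists_branch hcon.1 hcon.2
  have hg : IsPatriciaNode L g :=
    .inr ⟨a, b, hab, hz.of_prefix ha, hc.2.1.isTrieNode.of_prefix hb⟩
  have hgw : g <+: w := (List.prefix_append _ _).trans hb
  have hhg : h <+: g := by
    rcases List.prefix_or_prefix_of_prefix hhw hgw with h' | h'
    · exact h'
    · by_cases he : g = h
      · exact he ▸ List.prefix_rfl
      · obtain ⟨c, hcc⟩ := exists_snoc_prefix h' he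
        exact absurd ((eq_of_snoc_prefix ha (hcc.trans hhz)).trans
          (eq_of_snoc_prefix (hcc.trans hhw) hb)) hab
  rcases hc.2.2.2.2 g hg (hvh.trans hhg) hgw with rfl | rfl
  · exact hne (hvh.eq_of_length_le hhg.length_le)
  · simpa using hb.length_le

/-- The child is a shortest node that extends `v ++ [c]`; a member of `L` that does so exists. -/
theorem exists_cov {L : Set (List α)} {v : List α} {c : α} (hv : IsPatriciaNode L v)
    (hc : IsTrieNode L (v ++ [c])) : ∃ w, Cov {u | IsPatriciaNode L u} v w ∧ v ++ [c] <+: w := by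
  classical
  obtain ⟨y, hy, hcy⟩ := hc
  have hex : ∃ n, ∃ u : List α, u.length = n ∧ IsPatriciaNode L u ∧ v ++ [c] <+: u :=
    ⟨_, y, rfl, .inl hy, hcy⟩
  obtain ⟨w, hwn, hw, hcw⟩ := Nat.find_spec hex
  refine ⟨w, ⟨hv, hw, (List.prefix_append _ _).trans hcw, ?_, fun u hu hvu huw => ?_⟩, hcw⟩
  · rintro rfl
    simpa using hcw.length_le
  · by_cases he : v = u
    · exact .inl he.symm
    · have := Nat.find_min' hex ⟨u, rfl, hu, snoc_prefix_of_prefix hcw hvu huw he⟩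
      exact .inr (huw.eq_of_length_le (by omega))

/-- Adding a leaf. -/
theorem cov_insert_leaf {N : Set (List α)} {h l : List α} (hh : h ∈ N) (hl : ∀ u ∈ N, ¬ l <+: u)
    (hhl : h <+: l) (hmax : ∀ u ∈ N, u <+: l → u <+: h) {x z : List α} :
    Cov (insert l N) x z ↔ Cov N x z ∨ (x = h ∧ z = l) := by
  have hne : h ≠ l := fun e => hl h hh (e ▸ List.prefix_rfl)
  constructor
  · rintro ⟨hx, hz, hxz, hne', hc⟩
    have hxN : x ∈ N := by
      rcases hx with rfl | hx
      · rcases hz with rfl | hz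
        · exact absurd rfl hne'
        · exact absurd hxz (hl z hz)
      · exact hx
    rcases hz with rfl | hz
    · rcases hc h (.inr hh) (hmax x hxN hxz) hhl with e | e
      · exact .inr ⟨e.symm, rfl⟩
      · exact absurd e hne
    · exact .inl ⟨hxN, hz, hxz, hne', fun u hu => hc u (.inr hu)⟩
  · rintro (⟨hx, hz, hxz, hne', hc⟩ | ⟨rfl, rfl⟩)
    · refine ⟨.inr hx, .inr hz, hxz, hne', ?_⟩
      rintro u (rfl | hu) h1 h2
      · exact absurd h2 (hl z hz)
      · exact hc u hu h1 h2
    · refine ⟨.inr hh, .inl rfl, hhl, hne, ?_⟩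
      rintro u (rfl | hu) h1 h2
      · exact .inr rfl
      · exact .inl ((hmax u hu h2).eq_of_length_le h1.length_le)

/-- Splitting an edge. -/
theorem cov_insert_mid {N : Set (List α)} {v h w : List α} (hc : Cov N v w) (hvh : v <+: h)
    (hhw : h <+: w) (hv : v ≠ h) (hw : h ≠ w) (hex : ∀ u ∈ N, h <+: u → w <+: u) {x z : List α} :
    Cov (insert h N) x z ↔
      (Cov N x z ∧ ¬ (x = v ∧ z = w)) ∨ (x = v ∧ z = h) ∨ (x = h ∧ z = w) := by
  obtain ⟨hvN, hwN, hvw, hvw', hcc⟩ := hc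
  have hhN : h ∉ N := fun h' => by
    rcases hcc h h' hvh hhw with e | e
    exacts [hv e.symm, hw e]
  constructor
  · rintro ⟨hx, hz, hxz, hne', hc⟩
    rcases hx with rfl | hx
    · rcases hz with rfl | hz
      · exact absurd rfl hne'
      · rcases hc w (.inr hwN) hhw (hex z hz hxz) with e | e
        · exact absurd e.symm hw
        · exact .inr (.inr ⟨rfl, e.symm⟩)
    · rcases hz with rfl | hz
      · refine .inr (.inl ⟨?_, rfl⟩)
        rcases List.prefix_or_prefix_of_prefix hxz hvh with h' | h'
        · rcases hc v (.inr hvN) h' hvh with e | e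
          · exact e.symm
          · exact absurd e hv
        · rcases hcc x hx h' (hxz.trans hhw) with e | e
          · exact e
          · subst e
            exact absurd (hhw.eq_of_length_le hxz.length_le) hw
      · refine .inl ⟨⟨hx, hz, hxz, hne', fun u hu => hc u (.inr hu)⟩, ?_⟩
        rintro ⟨rfl, rfl⟩
        rcases hc h (.inl rfl) hvh hhw with e | e
        exacts [hv e.symm, hw e]
  · rintro (⟨⟨hx, hz, hxz, hne', hc⟩, hn⟩ | ⟨rfl, rfl⟩ | ⟨rfl, rfl⟩)
    · refine ⟨.inr hx, .inr hz, hxz, hne', ?_⟩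
      rintro u (rfl | hu) h1 h2
      · exfalso
        have hwz := hex z hz h2
        rcases List.prefix_or_prefix_of_prefix h1 hvh with h' | h'
        · rcases hc v hvN h' ((hvh.trans hhw).trans hwz) with e | e
          · subst e
            rcases hc w hwN hvw hwz with e | e
            · exact hvw' e.symm
            · exact hn ⟨rfl, e.symm⟩
          · subst e
            exact hvw' (hvw.eq_of_length_le hwz.length_le)
        · rcases hcc x hx h' (h1.trans hhw) with e | e
          · subst e
            rcases hc w hwN hvw hwz with e | e
            · exact hvw' e.symm
            · exact hn ⟨rfl, e.symm⟩
          · subst e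
            exact hw (hhw.eq_of_length_le h1.length_le)
      · exact hc u hu h1 h2
    · refine ⟨.inr hvN, .inl rfl, hvh, hv, ?_⟩
      rintro u (rfl | hu) h1 h2
      · exact .inr rfl
      · rcases hcc u hu h1 (h2.trans hhw) with e | e
        · exact .inl e
        · subst e
          exact absurd (hhw.eq_of_length_le h2.length_le) hw
    · refine ⟨.inl rfl, .inr hwN, hhw, hw, ?_⟩
      rintro u (rfl | hu) h1 h2
      · exact .inl rfl
      · exact .inr (h2.eq_of_length_le (hex u hu h1).length_le)

end Patricia

/-! ## Parameterized suffix trees when a symbol is prepended -/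

section Tree

variable {A P : Type*} [DecidableEq A] [DecidableEq P]
variable {a b : A ⊕ P} {T U : List (A ⊕ P)} {x h : List (A ⊕ ℕ)}

/-- The nodes of the trie for the prev-encoded suffixes. -/
def IsTrie (T : List (A ⊕ P)) (x : List (A ⊕ ℕ)) : Prop := IsTrieNode (PSuffix T) x

theorem isTrie_iff : IsTrie T x ↔ ∃ U, U <:+ T ∧ x <+: prevEnc U := by
  constructor
  · rintro ⟨_, ⟨U, hU, rfl⟩, hx⟩
    exact ⟨U, hU, hx⟩
  · rintro ⟨U, hU, hx⟩
    exact ⟨_, ⟨U, hU, rfl⟩, hx⟩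

theorem IsTrie.length_le (hx : IsTrie T x) : x.length ≤ T.length := by
  obtain ⟨U, hU, hx⟩ := isTrie_iff.1 hx
  have := hx.length_le
  rw [length_prevEnc] at this
  exact this.trans hU.length_le

theorem isTrie_cons : IsTrie (a :: T) x ↔ IsTrie T x ∨ x <+: prevEnc (a :: T) := by
  simp only [isTrie_iff, List.suffix_cons_iff]
  constructor
  · rintro ⟨U, rfl | hU, hx⟩
    exacts [.inr hx, .inl ⟨U, hU, hx⟩]
  · rintro (⟨U, hU, hx⟩ | hx)
    exacts [⟨U, .inr hU, hx⟩, ⟨_, .inl rfl, hx⟩]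

theorem IsNode.isTrie (hx : IsNode T x) : IsTrie T x := IsPatriciaNode.isTrieNode hx

theorem isNode_prevEnc (hU : U <:+ T) : IsNode T (prevEnc U) := .inl ⟨U, hU, rfl⟩

theorem isNode_nil : IsNode T [] := by
  have := isNode_prevEnc (List.nil_suffix (l := T))
  simpa [prevEnc] using this

/-- The effect of prepending a symbol on the set of nodes; `h` is the longest prefix of the new
string in the old trie. -/
theorem isNode_cons {d : A ⊕ ℕ} (hh : IsTrie T h) (hd : h ++ [d] <+: prevEnc (a :: T))
    (hd' : ¬ IsTrie T (h ++ [d])) :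
    IsNode (a :: T) x ↔ IsNode T x ∨ x = h ∨ x = prevEnc (a :: T) := by
  have hhF : h <+: prevEnc (a :: T) := (List.prefix_append _ _).trans hd
  constructor
  · rintro (⟨U, hU, rfl⟩ | ⟨c₁, c₂, hc, h1, h2⟩)
    · rcases List.suffix_cons_iff.1 hU with rfl | hU
      exacts [.inr (.inr rfl), .inl (isNode_prevEnc hU)]
    · by_contra! hcon
      -- At a new branching node, one branch is old and the other comes from the new string. So `x`
      -- is comparable with `h`. If `x` is properly shorter, its new branch runs along `h` and is
      -- old as well; if it is properly longer, then `h ++ [d]` is in the old trie.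
      have aux : ∀ c₁ c₂ : A ⊕ ℕ, c₁ ≠ c₂ → IsTrie (a :: T) (x ++ [c₂]) →
          IsTrie T (x ++ [c₁]) → False := by
        intro c₁ c₂ hc h2 h1
        rcases isTrie_cons.1 h2 with h2' | h2'
        · exact hcon.1 (.inr ⟨c₁, c₂, hc, h1, h2'⟩)
        have hxT : IsTrie T x := h1.of_prefix (List.prefix_append _ _)
        have hxF : x <+: prevEnc (a :: T) := (List.prefix_append _ _).trans h2'
        rcases List.prefix_or_prefix_of_prefix hxF hhF with h' | h'
        · have := snoc_prefix_of_prefix h2' h' hhF hcon.2.1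
          exact hcon.1 (.inr ⟨c₁, c₂, hc, h1, hh.of_prefix this⟩)
        · exact hd' (hxT.of_prefix (snoc_prefix_of_prefix hd h' hxF hcon.2.1.symm))
      rcases isTrie_cons.1 h1 with h1' | h1'
      · exact aux c₁ c₂ hc h2 h1'
      rcases isTrie_cons.1 h2 with h2' | h2'
      · exact aux c₂ c₁ hc.symm h1 h2'
      · exact hc (eq_of_snoc_prefix h1' h2')
  · rintro ((⟨U, hU, rfl⟩ | ⟨c₁, c₂, hc, h1, h2⟩) | rfl | rfl)
    · exact isNode_prevEnc (hU.trans (List.suffix_cons a T))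
    · exact .inr ⟨c₁, c₂, hc, isTrie_cons.2 (.inl h1), isTrie_cons.2 (.inl h2)⟩
    · obtain ⟨U, hU, hx⟩ := isTrie_iff.1 hh
      by_cases he : x = prevEnc U
      · exact he ▸ isNode_prevEnc (hU.trans (List.suffix_cons a T))
      · obtain ⟨c, hc⟩ := exists_snoc_prefix hx he
        have hcT : IsTrie T (x ++ [c]) := isTrie_iff.2 ⟨U, hU, hc⟩
        refine .inr ⟨c, d, ?_, isTrie_cons.2 (.inl hcT), isTrie_cons.2 (.inr hd)⟩
        rintro rfl
        exact hd' hcT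
    · exact isNode_prevEnc List.suffix_rfl

theorem isNode_of_ne {U U' : List (A ⊕ P)} {ℓ : ℕ} {e e' : A ⊕ ℕ} (hU : U <:+ T) (hU' : U' <:+ T)
    (ht : (prevEnc U).take ℓ = (prevEnc U').take ℓ) (he : (prevEnc U)[ℓ]? = some e)
    (he' : (prevEnc U')[ℓ]? = some e') (hne : e ≠ e') : IsNode T ((prevEnc U).take ℓ) := by
  refine .inr ⟨e, e', hne, isTrie_iff.2 ⟨U, hU, ?_⟩, isTrie_iff.2 ⟨U', hU', ?_⟩⟩
  · obtain ⟨h, rfl⟩ := List.getElem?_eq_some_iff.1 he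
    rw [List.take_concat_get' _ _ h]
    exact List.take_prefix _ _
  · obtain ⟨h, rfl⟩ := List.getElem?_eq_some_iff.1 he'
    rw [ht, List.take_concat_get' _ _ h]
    exact List.take_prefix _ _

/-- By `getElem?_prevEnc_tail` each symbol of the tail is the truncation of a symbol of the whole,
so equality of prefixes is inherited, whatever the first symbols are. -/
theorem take_tail_eq {ℓ : ℕ}
    (h : (prevEnc (a :: T)).take (ℓ + 1) = (prevEnc (b :: U)).take (ℓ + 1)) :
    (prevEnc T).take ℓ = (prevEnc U).take ℓ := by
  apply List.ext_getElem?
  intro j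
  by_cases hj : j < ℓ
  · have := congrArg (fun l => l[j + 1]?) h
    simp only [List.getElem?_take_of_lt (Nat.add_lt_add_right hj 1)] at this
    rw [List.getElem?_take_of_lt hj, List.getElem?_take_of_lt hj, getElem?_prevEnc_tail a T,
      getElem?_prevEnc_tail b U, this]
  · rw [List.getElem?_take_eq_none (by omega), List.getElem?_take_eq_none (by omega)]

/-- Where the prev-encodings of `aT` and `bU` can differ for the first time. -/
theorem mismatch {q : ℕ} {c c' : A ⊕ ℕ} (hU : b :: U <:+ T)
    (ht : (prevEnc (a :: T)).take (q + 1) = (prevEnc (b :: U)).take (q + 1))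
    (hc : (prevEnc (a :: T))[q + 1]? = some c) (hc' : (prevEnc (b :: U))[q + 1]? = some c')
    (hne : c ≠ c') : IsNode T ((prevEnc T).take q) ∨ q + 1 = nxt a T ∨ q + 1 = nxt b U := by
  rw [getElem?_prevEnc_cons_succ] at hc hc'
  obtain ⟨e, he, hc⟩ := Option.map_eq_some_iff.1 hc
  obtain ⟨e', he', hc'⟩ := Option.map_eq_some_iff.1 hc'
  by_cases h1 : nxt a T = q + 1
  · exact .inr (.inl h1.symm)
  by_cases h2 : nxt b U = q + 1
  · exact .inr (.inr h2.symm)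
  rw [if_neg h1] at hc
  rw [if_neg h2] at hc'
  subst hc hc'
  -- Neither encoding is altered at this position by the prepended symbol. So the tails themselves
  -- differ here after a common prefix of length `q`, and that prefix is a branching node.
  exact .inl (isNode_of_ne List.suffix_rfl ((List.suffix_cons b U).trans hU) (take_tail_eq ht)
    he he' hne)

/-- The suffix link of a node is a node or is followed by `0`. -/
theorem isNode_tail {ℓ : ℕ} (hℓ : ℓ ≤ T.length)
    (h : IsNode T ((prevEnc (a :: T)).take (ℓ + 1))) :
    IsNode T ((prevEnc T).take ℓ) ∨ (prevEnc T)[ℓ]? = some (Sum.inr 0) := by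
  have hlen : ((prevEnc (a :: T)).take (ℓ + 1)).length = ℓ + 1 := by
    rw [List.length_take, length_prevEnc, List.length_cons]; omega
  rcases h with ⟨U, hU, hx⟩ | ⟨c₁, c₂, hc, h1, h2⟩
  · cases U with
    | nil => rw [hx] at hlen; simp [prevEnc] at hlen
    | cons b U =>
      left
      have hl : (prevEnc (b :: U)).length = ℓ + 1 := by rw [← hx, hlen]
      have := take_tail_eq (a := a) (T := T) (b := b) (U := U) (ℓ := ℓ)
        (by rw [hx, List.take_of_length_le hl.le])
      rw [this, List.take_of_length_le]
      · exact isNode_prevEnc ((List.suffix_cons b U).trans hU)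
      · rw [length_prevEnc] at hl ⊢; simpa using hl.le
  · obtain ⟨U₁, hU₁, h1⟩ := isTrie_iff.1 h1
    obtain ⟨U₂, hU₂, h2⟩ := isTrie_iff.1 h2
    have aux : ∀ {U : List (A ⊕ P)} {c}, U <:+ T →
        (prevEnc (a :: T)).take (ℓ + 1) ++ [c] <+: prevEnc U →
        ∃ b V, V <:+ T ∧ (prevEnc T).take ℓ = (prevEnc V).take ℓ ∧
          ∃ e, (prevEnc V)[ℓ]? = some e ∧ c = if nxt b V = ℓ + 1 then Sum.inr (ℓ + 1) else e := by
      intro U c hU hp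
      have hcU : (prevEnc U)[ℓ + 1]? = some c := by
        rw [← prefix_getElem? hp (by simp only [List.length_append, hlen]; simp),
          List.getElem?_append_right hlen.le, hlen]
        simp
      cases U with
      | nil => simp [prevEnc] at hp
      | cons b V =>
        refine ⟨b, V, (List.suffix_cons b V).trans hU, take_tail_eq (a := a) (b := b) ?_, ?_⟩
        · have := prefix_take_iff.1 ((List.prefix_append _ _).trans hp)
          rwa [hlen] at this
        · rw [getElem?_prevEnc_cons_succ] at hcU
          obtain ⟨e, he, hce⟩ := Option.map_eq_some_iff.1 hcU
          exact ⟨e, he, hce.symm⟩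
    obtain ⟨b₁, V₁, hV₁, ht₁, e₁, he₁, rfl⟩ := aux hU₁ h1
    obtain ⟨b₂, V₂, hV₂, ht₂, e₂, he₂, rfl⟩ := aux hU₂ h2
    by_cases hne : e₁ = e₂
    swap
    · left
      rw [ht₁]
      exact isNode_of_ne hV₁ hV₂ (ht₁.symm.trans ht₂) he₁ he₂ hne
    subst hne
    -- The tails continue alike while the full strings do not, so at least one of these symbols was
    -- altered by prepending, and an altered symbol was 0.
    have he0 : e₁ = Sum.inr 0 := by
      by_cases n1 : nxt b₁ V₁ = ℓ + 1
      · exact Option.some_injective _ (he₁.symm.trans (getElem?_prevEnc_nxt n1))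
      · by_cases n2 : nxt b₂ V₂ = ℓ + 1
        · exact Option.some_injective _ (he₂.symm.trans (getElem?_prevEnc_nxt n2))
        · rw [if_neg n1, if_neg n2] at hc
          exact absurd rfl hc
    -- The encoding of `T` runs through the tail too. If it ends there, the tail is a leaf string;
    -- if it continues by something other than 0, it branches off from `V₁`.
    rcases hT : (prevEnc T)[ℓ]? with _ | e
    · left
      rw [List.take_of_length_le (List.getElem?_eq_none_iff.1 hT)]
      exact isNode_prevEnc List.suffix_rfl
    · by_cases hee : e = e₁
      · right; rw [hee, he0]
      · left
        exact isNode_of_ne List.suffix_rfl hV₁ ht₁ hT he₁ hee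

/-! ### Links -/

/-- The key of the link from the prefix of length `ℓ` of the prev-encoding of `T` for the symbol
`a`. -/
def linkKey (a : A ⊕ P) (T : List (A ⊕ P)) (ℓ : ℕ) : A ⊕ ℕ :=
  match a with
  | Sum.inl c => Sum.inl c
  | Sum.inr _ => Sum.inr (if nxt a T ≤ ℓ then nxt a T else 0)

/-- A link with the key `κ` may lead from `x` to `v`. -/
def IsLink (P : Type*) [DecidableEq P] (κ : A ⊕ ℕ) (x v : List (A ⊕ ℕ)) : Prop :=
  ∃ (a : A ⊕ P) (T : List (A ⊕ P)) (ℓ : ℕ), ℓ ≤ T.length ∧ x = (prevEnc T).take ℓ ∧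
    v = (prevEnc (a :: T)).take (ℓ + 1) ∧ κ = linkKey a T ℓ

/-- A distance beyond `ℓ` is recorded as 0 because it alters nothing within the first `ℓ` symbols of
the tail. Thus the key contains just the information that matters for a prefix of this length. -/
theorem nxt_eq_iff_linkKey {j ℓ : ℕ} (hj : j < ℓ) :
    nxt a T = j + 1 ↔ linkKey a T ℓ = Sum.inr (j + 1) := by
  cases a with
  | inl c => simp [linkKey, nxt]
  | inr p =>
    by_cases h : nxt (Sum.inr p) T ≤ ℓ
    · simp [linkKey, h]
    · simp only [linkKey, h, if_false, Sum.inr.injEq]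
      omega

/-- The target is the source with a symbol put in front and at most one place altered, and the key
names both. So a stored link may be followed even if it was created for other strings and another
parameter. -/
theorem IsLink.target_unique {κ : A ⊕ ℕ} {x v v' : List (A ⊕ ℕ)} (h : IsLink P κ x v)
    (h' : IsLink P κ x v') : v = v' := by
  obtain ⟨a, T, ℓ, hℓ, rfl, rfl, rfl⟩ := h
  obtain ⟨b, U, ℓ', hℓ', hx, rfl, hκ⟩ := h'
  obtain rfl : ℓ = ℓ' := by
    have := congrArg List.length hx
    simp only [List.length_take, length_prevEnc] at this
    omega
  apply List.ext_getElem?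
  rintro (_ | j)
  · rw [List.getElem?_take_of_lt (by omega), List.getElem?_take_of_lt (by omega),
      getElem?_prevEnc_cons_zero, getElem?_prevEnc_cons_zero]
    cases a <;> cases b <;> simp_all [linkKey, headSym]
  · by_cases hj : j < ℓ
    · have hxj := congrArg (fun l => l[j]?) hx
      simp only [List.getElem?_take_of_lt hj] at hxj
      rw [List.getElem?_take_of_lt (by omega), List.getElem?_take_of_lt (by omega),
        getElem?_prevEnc_cons_succ, getElem?_prevEnc_cons_succ, hxj]
      simp only [nxt_eq_iff_linkKey hj, hκ]
    · rw [List.getElem?_take_eq_none (by omega), List.getElem?_take_eq_none (by omega)]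

/-- The source is the tail of the target. The key can be read off the target because a symbol that
points back to the very first place is recognised by its value. Consequently a node is the target of
at most one link, and the links take linear space. -/
theorem IsLink.source_unique {κ κ' : A ⊕ ℕ} {x x' v : List (A ⊕ ℕ)} (h : IsLink P κ x v)
    (h' : IsLink P κ' x' v) : x = x' ∧ κ = κ' := by
  obtain ⟨a, T, ℓ, hℓ, rfl, rfl, rfl⟩ := h
  obtain ⟨b, U, ℓ', hℓ', rfl, hv, rfl⟩ := h'
  obtain rfl : ℓ = ℓ' := by
    have := congrArg List.length hv
    simp only [List.length_take, length_prevEnc, List.length_cons] at this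
    omega
  refine ⟨take_tail_eq hv, ?_⟩
  have h0 := congrArg (fun l => l[0]?) hv
  simp only [List.getElem?_take_of_lt (Nat.succ_pos ℓ), getElem?_prevEnc_cons_zero,
    Option.some.injEq] at h0
  cases a with
  | inl c => cases b <;> simp_all [linkKey, headSym]
  | inr p =>
    cases b with
    | inl c => simp [headSym] at h0
    | inr q =>
      -- The symbol number `j + 1` has the value `j + 1` only if it was altered by prepending, since
      -- an unaltered one has a value of at most `j` by `le_of_getElem?_prevEnc`.
      have key : ∀ {a b : A ⊕ P} {T U : List (A ⊕ P)}, ℓ ≤ U.length →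
          (prevEnc (a :: T)).take (ℓ + 1) = (prevEnc (b :: U)).take (ℓ + 1) →
          ∀ j < ℓ, nxt a T = j + 1 → nxt b U = j + 1 := by
        intro a b T U hU hv j hj hn
        have hvj := congrArg (fun l => l[j + 1]?) hv
        simp only [List.getElem?_take_of_lt (Nat.add_lt_add_right hj 1)] at hvj
        rw [getElem?_prevEnc_cons_succ, getElem?_prevEnc_cons_succ, getElem?_prevEnc_nxt hn,
          Option.map_some, if_pos hn] at hvj
        obtain ⟨e, he, hve⟩ := Option.map_eq_some_iff.1 hvj.symm
        by_contra hnU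
        rw [if_neg hnU] at hve
        subst hve
        have := le_of_getElem?_prevEnc he
        omega
      simp only [linkKey, Sum.inr.injEq]
      have k1 := key hℓ' hv
      have k2 := key hℓ hv.symm
      rcases n1 : nxt (Sum.inr p) T with _ | j
      · rcases n2 : nxt (Sum.inr q) U with _ | j'
        · simp
        · by_cases hj' : j' < ℓ
          · have := k2 j' hj' n2
            omega
          · rw [if_neg (by omega : ¬ j' + 1 ≤ ℓ)]; simp
      · by_cases hj : j < ℓ
        · rw [k1 j hj n1]
        · rw [if_neg (by omega : ¬ j + 1 ≤ ℓ)]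
          split_ifs with h
          · rcases n2 : nxt (Sum.inr q) U with _ | j'
            · rfl
            · have := k2 j' (by omega) n2
              omega
          · rfl

theorem getElem?_eq_zero_of_linkKey {ℓ j : ℕ} (h : linkKey a T ℓ = Sum.inr (j + 1)) :
    ((prevEnc T).take ℓ)[j]? = some (Sum.inr 0) := by
  have hj : j < ℓ := by
    cases a with
    | inl c => simp [linkKey] at h
    | inr p =>
      simp only [linkKey, Sum.inr.injEq] at h
      split_ifs at h; omega
  rw [List.getElem?_take_of_lt hj]
  exact getElem?_prevEnc_nxt ((nxt_eq_iff_linkKey hj).2 h)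

/-! ### The numbers of keys -/

omit [DecidableEq A] in
theorem symCode_injective {cA : A → ℕ} (h : Function.Injective cA) :
    Function.Injective (symCode cA (id : ℕ → ℕ)) := by
  rintro (a | v) (b | w) he <;> simp_all [symCode]
  exact h he

/-- Apart from static symbols and 0, a key points at a zero of `x`, and there are at most |Π| of
these. -/
theorem exists_keys_links [Fintype A] [Fintype P] (cA : A → ℕ) (hx : x <+: prevEnc U) :
    ∃ F : Finset (ℕ × ℕ), F.card ≤ Fintype.card A + Fintype.card P + 1 ∧
      ∀ (κ : A ⊕ ℕ) (v : List (A ⊕ ℕ)), IsLink P κ x v → symCode cA id κ ∈ F := by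
  classical
  refine ⟨Finset.univ.image (fun a : A => (0, cA a)) ∪
    (((Finset.range x.length).filter fun j => x[j]? = some (Sum.inr 0)).image fun j => (1, j + 1)) ∪
    {(1, 0)}, ?_, ?_⟩
  · refine (Finset.card_union_le _ _).trans (Nat.add_le_add ((Finset.card_union_le _ _).trans
      (Nat.add_le_add ?_ ?_)) (by simp))
    · exact Finset.card_image_le
    · exact Finset.card_image_le.trans (card_zeros_le hx)
  · rintro κ v ⟨a, T, ℓ, hℓ, rfl, rfl, rfl⟩
    rcases hκ : linkKey a T ℓ with c | _ | j
    · simp [symCode]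
    · simp [symCode]
    · have := getElem?_eq_zero_of_linkKey hκ
      have hj := (List.getElem?_eq_some_iff.1 this).1
      simp only [symCode, id, Finset.mem_union, Finset.mem_image, Finset.mem_filter,
        Finset.mem_range]
      exact .inl (.inr ⟨j, ⟨hj, this⟩, rfl⟩)

/-- The summand |Π| comes from `card_succ_le`, and the final 1 is for the symbol 0. -/
theorem exists_keys_children [Fintype A] [Fintype P] (cA : A → ℕ) (hx : IsTrie T x) :
    ∃ F : Finset (ℕ × ℕ), F.card ≤ Fintype.card A + Fintype.card P + 1 ∧
      ∀ c : A ⊕ ℕ, IsTrie T (x ++ [c]) → symCode cA id c ∈ F := by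
  classical
  obtain ⟨V, -, hV⟩ := isTrie_iff.1 hx
  refine ⟨Finset.univ.image (fun a : A => (0, cA a)) ∪
    (((Finset.range T.length).filter fun k => IsTrie T (x ++ [Sum.inr (k + 1)])).image
      fun k => (1, k + 1)) ∪ {(1, 0)}, ?_, ?_⟩
  · refine (Finset.card_union_le _ _).trans (Nat.add_le_add ((Finset.card_union_le _ _).trans
      (Nat.add_le_add ?_ ?_)) (by simp))
    · exact Finset.card_image_le
    · refine Finset.card_image_le.trans (card_succ_le hV _ fun k hk => ?_)
      obtain ⟨U, -, hU⟩ := isTrie_iff.1 (Finset.mem_filter.1 hk).2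
      exact ⟨U, hU⟩
  · rintro (a | _ | k) hc
    · simp [symCode]
    · simp [symCode]
    · obtain ⟨U, hUT, hU⟩ := isTrie_iff.1 hc
      have hUx : (prevEnc U)[x.length]? = some (Sum.inr (k + 1)) := by
        rw [← prefix_getElem? hU (by simp)]; simp
      have h1 := le_of_getElem?_prevEnc hUx
      have h2 := hc.length_le
      simp only [List.length_append, List.length_singleton] at h2
      simp only [symCode, id, Finset.mem_union, Finset.mem_image, Finset.mem_filter,
        Finset.mem_range]
      exact .inl (.inr ⟨k, ⟨by omega, hc⟩, rfl⟩)

end Tree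

section Lists

variable {α : Type*} {v w x : List α}

theorem take_succ_eq {y z : List (α)} {j : ℕ} (h : y.take j = z.take j) (h' : y[j]? = z[j]?) :
    y.take (j + 1) = z.take (j + 1) := by
  rw [List.take_add_one, List.take_add_one, h, h']

theorem take_getElem? {y z : List (α)} {j i : ℕ} (h : y.take j = z.take j) (hi : i < j) :
    y[i]? = z[i]? := by
  rw [← List.getElem?_take_of_lt hi, h, List.getElem?_take_of_lt hi]

/-! ### Counting ancestors -/

open Classical in
/-- The number of prefixes of `y` that are shorter than `k` and belong to `N`. -/
noncomputable def cnt (N : Set (List (α))) (y : List (α)) (k : ℕ) : ℕ :=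
  ((Finset.range k).filter fun ℓ => y.take ℓ ∈ N).card

theorem cnt_le (N : Set (List α)) (y : List α) (k : ℕ) : cnt N y k ≤ k := by
  classical
  unfold cnt
  exact (Finset.card_filter_le _ _).trans (by simp)

/-- Descending one edge adds at most one ancestor, the lower end of the edge. -/
theorem cnt_cov {N : Set (List (α))} {y : List (α)} (hc : Cov N v w) (hw : w <+: y) :
    cnt N y (w.length + 1) ≤ cnt N y (v.length + 1) + 1 := by
  classical
  unfold cnt
  refine (Finset.card_le_card fun i hi => ?_).trans (Finset.card_insert_le w.length _)
  simp only [Finset.mem_insert, Finset.mem_filter, Finset.mem_range] at hi ⊢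
  by_contra! hcon
  have hi1 : i < w.length := by omega
  have hi2 : v.length < i := by
    by_contra h
    exact hcon.2 (by omega) hi.2
  have hwl := hw.length_le
  have hl : (y.take i).length = i := by rw [List.length_take]; omega
  rcases hc.2.2.2.2 _ hi.2 (List.prefix_of_prefix_length_le (hc.2.2.1.trans hw)
    (List.take_prefix _ _) (by omega)) (List.prefix_of_prefix_length_le (List.take_prefix _ _) hw
      (by omega)) with e | e
  · rw [← e, hl] at hi2; omega
  · rw [← e, hl] at hi1; omega

/-- The bound 2 accounts for the two strings added to the set of nodes. It is applied with the
longest old node on the new path, so that `m` excludes no old ancestor. -/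
theorem cnt_new {N : Set (List (α))} {y z : List (α)} {k m : ℕ}
    (hN : ∀ x ∈ N, x <+: y → x.length < m) (hk : k ≤ y.length + 1) :
    cnt (insert y (insert z N)) y k ≤ cnt N y m + 2 := by
  classical
  unfold cnt
  have : ((Finset.range k).filter fun ℓ => y.take ℓ ∈ insert y (insert z N)) ⊆
      insert y.length (insert z.length ((Finset.range m).filter fun ℓ => y.take ℓ ∈ N)) := by
    intro i hi
    simp only [Finset.mem_insert, Finset.mem_filter, Finset.mem_range, Set.mem_insert_iff] at hi ⊢
    have hl : (y.take i).length = i := by rw [List.length_take]; omega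
    rcases hi.2 with h | h | h
    · rw [h] at hl; exact .inl hl.symm
    · rw [h] at hl; exact .inr (.inl hl.symm)
    · have := hN _ h (List.take_prefix _ _)
      rw [hl] at this
      exact .inr (.inr ⟨this, h⟩)
  refine (le_of_eq_of_le ?_ (Finset.card_le_card this)).trans ?_
  · congr
  have h2 := Finset.card_insert_le y.length
    (insert z.length ((Finset.range m).filter fun ℓ => y.take ℓ ∈ N))
  have h3 := Finset.card_insert_le z.length ((Finset.range m).filter fun ℓ => y.take ℓ ∈ N)
  omega

end Lists

/-! ### The search for the longest old prefix of the new string -/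

section Step

variable {A P : Type*} [DecidableEq A] [DecidableEq P]
variable {a b : A ⊕ P} {T U : List (A ⊕ P)} {x v w h : List (A ⊕ ℕ)}

/-- The set of nodes of the parameterized suffix tree. -/
def nodes (T : List (A ⊕ P)) : Set (List (A ⊕ ℕ)) := {x | IsNode T x}

theorem mem_nodes : x ∈ nodes T ↔ IsNode T x := Iff.rfl

theorem exists_parent (hx : x ∈ nodes T) (hne : x ≠ []) : ∃ y, Cov (nodes T) y x := by
  classical
  have hex : ∃ k, k < x.length ∧ x.take (x.length - 1 - k) ∈ nodes T :=
    ⟨x.length - 1, by have := List.length_pos_iff.2 hne; omega, by simpa [nodes] using isNode_nil⟩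
  obtain ⟨hk, hn⟩ := Nat.find_spec hex
  have hmin := fun m => Nat.find_min' hex (m := m)
  generalize Nat.find hex = k at hk hn hmin
  have hl : (x.take (x.length - 1 - k)).length = x.length - 1 - k := by
    rw [List.length_take]; omega
  refine ⟨_, hn, hx, List.take_prefix _ _, fun e => ?_, fun u hu h1 h2 => ?_⟩
  · have := congrArg List.length e
    omega
  · by_contra! hc
    have h3 := h1.length_le
    have h4 := h2.length_le
    have h5 : u.length ≠ x.length := fun e => hc.2 (h2.eq_of_length e)
    have h6 : u.length ≠ x.length - 1 - k := fun e =>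
      hc.1 (h1.eq_of_length (by omega)).symm
    have := hmin (x.length - 1 - u.length) ⟨by omega, by
      rw [show x.length - 1 - (x.length - 1 - u.length) = u.length by omega]
      rwa [prefix_take_iff.1 h2] at hu⟩
    omega

/-- If a string of the old tree agrees with the new string at all places where a first mismatch
is possible, then it agrees everywhere. -/
theorem take_eq_of_candidates {m q : ℕ} (hU : b :: U <:+ T) (hw : w <+: prevEnc (b :: U))
    (hm : (prevEnc (a :: T)).take m = w.take m) (hm1 : 1 ≤ m) (hq : q ≤ w.length)
    (h1 : ∀ x ∈ nodes T, x <+: prevEnc T → m ≤ x.length + 1 → x.length + 1 < q →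
      (prevEnc (a :: T))[x.length + 1]? = w[x.length + 1]?)
    (h2 : nxt a T < q → (prevEnc (a :: T))[nxt a T]? = w[nxt a T]?)
    (h3 : nxt b U < q → (prevEnc (a :: T))[nxt b U]? = w[nxt b U]?) :
    (prevEnc (a :: T)).take q = w.take q := by
  have hwlen := hw.length_le
  rw [length_prevEnc] at hwlen
  have hUlen := hU.length_le
  have key : ∀ j, m ≤ j → j ≤ q → (prevEnc (a :: T)).take j = w.take j := by
    intro j hj
    induction j, hj using Nat.le_induction with
    | base => exact fun _ => hm
    | succ j hj ih =>
      intro hjq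
      have ht := ih (by omega)
      refine take_succ_eq ht ?_
      by_contra hne
      obtain ⟨i, rfl⟩ : ∃ i, j = i + 1 := ⟨j - 1, by omega⟩
      have hF : i + 1 < (prevEnc (a :: T)).length := by
        rw [length_prevEnc, List.length_cons]; omega
      have hB : i + 1 < (prevEnc (b :: U)).length := by rw [length_prevEnc]; omega
      have hwB : w[i + 1]? = (prevEnc (b :: U))[i + 1]? := prefix_getElem? hw (by omega)
      have htB : w.take (i + 1) = (prevEnc (b :: U)).take (i + 1) := by
        obtain ⟨r, hr⟩ := hw
        rw [← hr, List.take_append_of_le_length (by omega)]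
      rw [hwB, List.getElem?_eq_getElem hF, List.getElem?_eq_getElem hB] at hne
      rcases mismatch hU (ht.trans htB) (List.getElem?_eq_getElem hF) (List.getElem?_eq_getElem hB)
        (fun e => hne (congrArg some e)) with hn | hn | hn
      · have hl : ((prevEnc T).take i).length = i := by
          rw [List.length_take, length_prevEnc]; omega
        have := h1 _ hn (List.take_prefix _ _)
        rw [hl] at this
        have := this hj (by omega)
        rw [hwB, List.getElem?_eq_getElem hF, List.getElem?_eq_getElem hB] at this
        exact hne this
      · rw [← hn] at h2
        have := h2 (by omega)
        rw [hwB, List.getElem?_eq_getElem hF, List.getElem?_eq_getElem hB] at this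
        exact hne this
      · rw [← hn] at h3
        have := h3 (by omega)
        rw [hwB, List.getElem?_eq_getElem hF, List.getElem?_eq_getElem hB] at this
        exact hne this
  by_cases h : m ≤ q
  · exact key q h le_rfl
  · have := congrArg (List.take q) hm
    rwa [List.take_take, List.take_take, min_eq_left (by omega)] at this

/-- Within an edge the trie continues in one way only, so a mismatch with the label leaves the trie.
-/
theorem not_isTrie_of_mismatch {d : A ⊕ ℕ} {q : ℕ} (hc : Cov (nodes T) v w)
    (hvq : v.length < q) (hq : q < w.length) (ht : h = w.take q) (hl : h.length = q)
    (hd : w[q]? ≠ some d) : ¬ IsTrie T (h ++ [d]) := by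
  intro htr
  have hvh : v <+: h := by
    rw [ht]
    exact List.prefix_of_prefix_length_le hc.2.2.1 (List.take_prefix _ _) (by rw [← ht]; omega)
  rcases Cov.comparable hc hvh (by rintro rfl; omega) (ht ▸ List.take_prefix _ _) htr
    (List.prefix_append _ _) with h' | h'
  · rw [← prefix_getElem? h' (by simp [hl])] at hd
    simp [← hl] at hd
  · have := h'.length_le
    rw [prefix_getElem? h' hq] at hd
    simp [← hl] at hd

theorem not_isTrie_of_no_child {c : A ⊕ ℕ} (hv : v ∈ nodes T)
    (h : ∀ w, Cov (nodes T) v w → ¬ v ++ [c] <+: w) : ¬ IsTrie T (v ++ [c]) := fun hc =>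
  let ⟨w, hw, hcw⟩ := exists_cov hv hc
  h w hw hcw

/-- This expresses that `h` is the longest prefix of the new string in the old trie. -/
theorem prefix_of_prefix_new {d : A ⊕ ℕ} {u : List (A ⊕ ℕ)} (hd : h ++ [d] <+: prevEnc (a :: T))
    (hd' : ¬ IsTrie T (h ++ [d])) (hu : IsTrie T u) (huF : u <+: prevEnc (a :: T)) : u <+: h := by
  rcases List.prefix_or_prefix_of_prefix huF ((List.prefix_append _ _).trans hd) with h' | h'
  · exact h'
  · by_cases he : h = u
    · exact he ▸ List.prefix_rfl
    · exact absurd (hu.of_prefix (snoc_prefix_of_prefix hd h' huF he)) hd'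

theorem nodes_cons {d : A ⊕ ℕ} (hh : IsTrie T h) (hd : h ++ [d] <+: prevEnc (a :: T))
    (hd' : ¬ IsTrie T (h ++ [d])) :
    nodes (a :: T) = insert (prevEnc (a :: T)) (insert h (nodes T)) := by
  ext x
  simp only [mem_nodes, isNode_cons hh hd hd', Set.mem_insert_iff]
  tauto

/-- The number of zeros among the first `k` symbols. -/
def zeros (y : List (A ⊕ ℕ)) (k : ℕ) : ℕ :=
  ((Finset.range k).filter fun ℓ => y[ℓ]? = some (Sum.inr 0)).card

theorem zeros_le [Fintype P] (k : ℕ) : zeros (prevEnc T) k ≤ Fintype.card P := by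
  refine (Finset.card_le_card fun ℓ hℓ => ?_).trans (card_zeros_le (U := T) List.prefix_rfl)
  simp only [Finset.mem_filter, Finset.mem_range] at hℓ ⊢
  exact ⟨(List.getElem?_eq_some_iff.1 hℓ.2).1, hℓ.2⟩

theorem zeros_mono (y : List (A ⊕ ℕ)) {j k : ℕ} (h : j ≤ k) : zeros y j ≤ zeros y k :=
  Finset.card_le_card (Finset.filter_subset_filter _ (Finset.range_subset_range.2 h))

theorem zeros_lt {y : List (A ⊕ ℕ)} {j k ℓ : ℕ} (h : j ≤ ℓ) (hk : ℓ < k)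
    (hℓ : y[ℓ]? = some (Sum.inr 0)) : zeros y j + 1 ≤ zeros y k := by
  unfold zeros
  rw [← Finset.card_insert_of_notMem (a := ℓ) (by simp; omega)]
  refine Finset.card_le_card fun i hi => ?_
  simp only [Finset.mem_insert, Finset.mem_filter, Finset.mem_range] at hi ⊢
  rcases hi with rfl | hi
  exacts [⟨hk, hℓ⟩, ⟨by omega, hi.2⟩]

/-- Removing the first symbol maps the nonempty ancestors of the new string to ancestors of `prevEnc
T` or to places of zeros, by `isNode_tail`; the summand 1 is for the root. This is the comparison of
depths in the amortised analysis. -/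
theorem cnt_tail {k : ℕ} (hk : k ≤ T.length + 1) :
    cnt (nodes T) (prevEnc (a :: T)) (k + 1) ≤
      1 + cnt (nodes T) (prevEnc T) k + zeros (prevEnc T) k := by
  classical
  unfold cnt zeros
  have : ((Finset.range (k + 1)).filter fun ℓ => (prevEnc (a :: T)).take ℓ ∈ nodes T) ⊆
      insert 0 ((((Finset.range k).filter fun ℓ => (prevEnc T).take ℓ ∈ nodes T) ∪
        ((Finset.range k).filter fun ℓ => (prevEnc T)[ℓ]? = some (Sum.inr 0))).image (· + 1)) := by
    intro i hi
    simp only [Finset.mem_insert, Finset.mem_filter, Finset.mem_range, Finset.mem_image,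
      Finset.mem_union] at hi ⊢
    rcases i with _ | i
    · exact .inl rfl
    · refine .inr ⟨i, ?_, rfl⟩
      rcases isNode_tail (by omega) hi.2 with h | h
      exacts [.inl ⟨by omega, h⟩, .inr ⟨by omega, h⟩]
  have h1 := Finset.card_le_card this
  have h2 := Finset.card_insert_le 0 ((((Finset.range k).filter
    fun ℓ => (prevEnc T).take ℓ ∈ nodes T) ∪
        ((Finset.range k).filter fun ℓ => (prevEnc T)[ℓ]? = some (Sum.inr 0))).image (· + 1))
  have h3 := Finset.card_image_le (s := (((Finset.range k).filter
    fun ℓ => (prevEnc T).take ℓ ∈ nodes T) ∪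
        ((Finset.range k).filter fun ℓ => (prevEnc T)[ℓ]? = some (Sum.inr 0)))) (f := (· + 1))
  have h4 := Finset.card_union_le ((Finset.range k).filter
    fun ℓ => (prevEnc T).take ℓ ∈ nodes T)
        ((Finset.range k).filter fun ℓ => (prevEnc T)[ℓ]? = some (Sum.inr 0))
  omega

/-! ### The next occurrences of the parameters -/

theorem nxt_cons_self (p : P) (T : List (A ⊕ P)) : nxt (Sum.inr p : A ⊕ P) (Sum.inr p :: T) = 1 :=
  nxt_eq_succ.2 ⟨p, rfl, by simp, by simp⟩

theorem nxt_cons_of_ne {p : P} (h : a ≠ Sum.inr p) (hT : nxt (Sum.inr p : A ⊕ P) T ≠ 0) :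
    nxt (Sum.inr p) (a :: T) = nxt (Sum.inr p : A ⊕ P) T + 1 := by
  obtain ⟨j, hj⟩ := Nat.exists_eq_succ_of_ne_zero hT
  obtain ⟨q, hq, h1, h2⟩ := nxt_eq_succ.1 hj
  rw [hj]
  obtain rfl := Sum.inr.inj hq
  refine nxt_eq_succ.2 ⟨p, rfl, by simpa using h1, ?_⟩
  simp only [List.take_succ_cons, List.mem_cons, not_or]
  exact ⟨h.symm, h2⟩

theorem nxt_ne_zero {p : P} : nxt (Sum.inr p : A ⊕ P) T ≠ 0 ↔ Sum.inr p ∈ T := by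
  simp [nxt]

end Step

/-! ## The stored text -/

/-- Indexed by positions of the text: the distance to the next occurrence of the parameter. -/
@[simp] def nxtArr : ℕ := 17
/-- The parameters that occur in the text, in the order of their last occurrences. -/
@[simp] def parArr : ℕ := 18
/-- The positions of the first occurrences of the parameters in the text read so far. -/
@[simp] def lastArr : ℕ := 19

section Text

variable {A P : Type*} [DecidableEq A] [DecidableEq P]
variable {X W : ℕ} {s : State} {cA : A → ℕ} {cP : P → ℕ} {S T U : List (A ⊕ P)} {a : A ⊕ P}

/-- The memory holds the prev-encoding of `S` and the distances to the next occurrences. -/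
structure Text (cA : A → ℕ) (m : ℕ → ℕ → ℕ) (S : List (A ⊕ P)) : Prop where
  sym : ∀ (i : ℕ) (c : A ⊕ ℕ), (prevEnc S)[i]? = some c →
    (m tagArr (S.length - 1 - i), m valArr (S.length - 1 - i)) = symCode cA id c
  next : ∀ b U, b :: U <:+ S → m nxtArr U.length = nxt b U

/-- The memory holds the list of the `n` parameters that occur in `T`. -/
structure Params (cP : P → ℕ) (m : ℕ → ℕ → ℕ) (n : ℕ) (T : List (A ⊕ P)) : Prop where
  le : n ≤ T.length
  code : ∀ i < n, ∃ p, Sum.inr p ∈ T ∧ m parArr i = cP p ∧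
    m lastArr i + nxt (Sum.inr p) T = T.length + 1
  surj : ∀ p, Sum.inr p ∈ T → ∃ i < n, m parArr i = cP p
  inj : ∀ i < n, ∀ j < n, m parArr i = m parArr j → i = j

theorem Params.le_card [Fintype P] {m : ℕ → ℕ → ℕ} {n : ℕ} (h : Params cP m n T) :
    n ≤ Fintype.card P := by
  choose f hf using fun i : Fin n => h.code i i.2
  have : Function.Injective f := fun i j hij =>
    Fin.ext (h.inj i i.2 j j.2 (by rw [(hf i).2.1, (hf j).2.1, hij]))
  simpa using Fintype.card_le_of_injective f this

/-- Positions are counted from the right end, so they do not shift. Besides the cell of the new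
symbol only the cell of its next occurrence is written, which has the index `T.length - nxt a T`. -/
theorem Text.cons {m m' : ℕ → ℕ → ℕ} {t v : ℕ} (h : Text cA m T)
    (hc : (t, v) = symCode cA id (headSym a))
    (h0 : m' tagArr = Function.update (m tagArr) T.length t)
    (h1 : m' valArr = if nxt a T = 0 then Function.update (m valArr) T.length v else
      Function.update (Function.update (m valArr) T.length v) (T.length - nxt a T) (nxt a T))
    (h2 : m' nxtArr = Function.update (m nxtArr) T.length (nxt a T)) : Text cA m' (a :: T) := by
  have hle := nxt_le a T
  refine ⟨fun i c hi => ?_, fun b U hU => ?_⟩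
  · rcases i with _ | j
    · rw [getElem?_prevEnc_cons_zero] at hi
      obtain rfl := Option.some.inj hi
      rw [h0, h1, ← hc]
      split_ifs with h
      · simp
      · simp only [List.length_cons, Nat.add_sub_cancel, Nat.sub_zero, Function.update_self]
        rw [Function.update_of_ne (by omega), Function.update_self]
    · rw [getElem?_prevEnc_cons_succ] at hi
      obtain ⟨e, he, rfl⟩ := Option.map_eq_some_iff.1 hi
      have hj : j < T.length := by
        have := (List.getElem?_eq_some_iff.1 he).1
        rwa [length_prevEnc] at this
      have hs := h.sym j e he
      simp only [List.length_cons, Nat.add_sub_cancel]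
      rw [h0, h1, Function.update_of_ne (by omega)]
      have e1 : T.length - 1 - j = T.length - (j + 1) := by omega
      rw [e1] at hs
      split_ifs with h' h'' h''
      · omega
      · rw [Function.update_of_ne (by omega), hs]
      · have := getElem?_prevEnc_nxt h''
        rw [he] at this
        obtain rfl := Option.some.inj this
        rw [h'', Function.update_self]
        simp only [symCode, Prod.mk.injEq] at hs ⊢
        exact ⟨hs.1, rfl⟩
      · rw [Function.update_of_ne (by omega), Function.update_of_ne (by omega), hs]
  · rw [h2]
    rcases List.suffix_cons_iff.1 hU with e | hU
    · obtain ⟨rfl, rfl⟩ := List.cons.inj e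
      simp
    · have := hU.length_le
      rw [List.length_cons] at this
      rw [Function.update_of_ne (by omega), h.next b U hU]

/-- The length of the text and the distances to the parameters grow together, so the stored
positions remain correct. -/
theorem Params.static {m m' : ℕ → ℕ → ℕ} {n : ℕ} (h : Params cP m n T) (c : A)
    (h1 : m' parArr = m parArr) (h2 : m' lastArr = m lastArr) :
    Params cP m' n (Sum.inl c :: T) := by
  refine ⟨h.le.trans (by simp), fun i hi => ?_, fun p hp => ?_, fun i hi j hj => ?_⟩
  · obtain ⟨p, hp, h3, h4⟩ := h.code i hi
    refine ⟨p, by simp [hp], by rw [h1, h3], ?_⟩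
    rw [h2, nxt_cons_of_ne (by simp) (nxt_ne_zero.2 hp), List.length_cons]
    omega
  · rw [h1]; exact h.surj p (by simpa using hp)
  · rw [h1]; exact h.inj i hi j hj

theorem Params.old (hcP : Function.Injective cP) {m m' : ℕ → ℕ → ℕ} {n i : ℕ} {p : P}
    (h : Params cP m n T) (hi : i < n) (hp : m parArr i = cP p) (h1 : m' parArr = m parArr)
    (h2 : m' lastArr = Function.update (m lastArr) i (T.length + 1)) :
    Params cP m' n (Sum.inr p :: T) := by
  refine ⟨h.le.trans (by simp), fun j hj => ?_, fun q hq => ?_, fun j hj k hk => ?_⟩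
  · obtain ⟨q, hq, h3, h4⟩ := h.code j hj
    refine ⟨q, by simp [hq], by rw [h1, h3], ?_⟩
    rw [h2]
    by_cases hij : j = i
    · subst hij
      obtain rfl := hcP (hp.symm.trans h3)
      rw [Function.update_self, nxt_cons_self, List.length_cons]
    · have : (Sum.inr p : A ⊕ P) ≠ Sum.inr q := fun e => by
        obtain rfl := Sum.inr.inj e
        exact hij (h.inj j hj i hi (h3.trans hp.symm))
      rw [Function.update_of_ne hij, nxt_cons_of_ne this (nxt_ne_zero.2 hq), List.length_cons]
      omega
  · rw [h1]
    by_cases hqp : q = p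
    · exact ⟨i, hi, hqp ▸ hp⟩
    · exact h.surj q (by simpa [hqp] using hq)
  · rw [h1]; exact h.inj j hj k hk

theorem Params.new {m m' : ℕ → ℕ → ℕ} {n : ℕ} {p : P}
    (h : Params cP m n T) (hp : ∀ i < n, m parArr i ≠ cP p)
    (h1 : m' parArr = Function.update (m parArr) n (cP p))
    (h2 : m' lastArr = Function.update (m lastArr) n (T.length + 1)) :
    Params cP m' (n + 1) (Sum.inr p :: T) := by
  have hpT : Sum.inr p ∉ T := fun hT => by
    obtain ⟨i, hi, he⟩ := h.surj p hT
    exact hp i hi he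
  refine ⟨by simpa using h.le, fun j hj => ?_, fun q hq => ?_, fun j hj k hk => ?_⟩
  · rw [h1, h2]
    by_cases hjn : j = n
    · subst hjn
      refine ⟨p, by simp, by simp, ?_⟩
      rw [Function.update_self, nxt_cons_self, List.length_cons]
    · obtain ⟨q, hq, h3, h4⟩ := h.code j (by omega)
      refine ⟨q, by simp [hq], by rw [Function.update_of_ne hjn, h3], ?_⟩
      have : (Sum.inr p : A ⊕ P) ≠ Sum.inr q := fun e => by
        obtain rfl := Sum.inr.inj e
        exact hpT hq
      rw [Function.update_of_ne hjn, nxt_cons_of_ne this (nxt_ne_zero.2 hq), List.length_cons]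
      omega
  · rw [h1]
    by_cases hqp : q = p
    · exact ⟨n, by omega, by simp [hqp]⟩
    · obtain ⟨i, hi, he⟩ := h.surj q (by simpa [hqp] using hq)
      exact ⟨i, by omega, by rw [Function.update_of_ne (by omega), he]⟩
  · rw [h1]
    intro he
    by_cases hjn : j = n <;> by_cases hkn : k = n
    · rw [hjn, hkn]
    · rw [hjn, Function.update_self, Function.update_of_ne hkn] at he
      exact absurd he.symm (hp k (by omega))
    · rw [hkn, Function.update_self, Function.update_of_ne hjn] at he
      exact absurd he (hp j (by omega))
    · rw [Function.update_of_ne hjn, Function.update_of_ne hkn] at he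
      exact h.inj j (by omega) k (by omega) he

/-! ### Reading encoded suffixes and finding parameters. -/

/-- Loads the symbol number `61` of the prev-encoding of the suffix of length `60` into the
registers `62` and `63`. -/
def getChar : Prog :=
  subR 64 60 3 ;; subR 64 64 61 ;; ldR 62 tagArr 64 ;; ldR 63 valArr 64 ;;
  .ite (.eq 62 2) .skip (.ite (.lt 61 63) (setR 63 2) .skip)

/-- The cell of the symbol depends on the length of `U` only, not on what precedes `U`; the
comparison of the value with the index performs `trunc`. So the encodings of all suffixes are read
from one stored text. -/
theorem getChar_spec {j : ℕ} {c : A ⊕ ℕ} (hT : Text cA s.mem S) (hU : U <:+ S)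
    (hc : (prevEnc U)[j]? = some c) (h2 : s.reg 2 = 0) (h3 : s.reg 3 = 1)
    (h60 : s.reg 60 = U.length) (h61 : s.reg 61 = j) (hX : S.length ≤ X) :
    wp X W getChar (fun s' => s'.mem = s.mem ∧ s'.time ≤ s.time + 7 ∧
      (s'.reg 62, s'.reg 63) = symCode cA id c) s := by
  obtain ⟨V, rfl⟩ := hU
  rw [getElem?_prevEnc_suffix V U, Option.map_eq_some_iff] at hc
  obtain ⟨e, he, rfl⟩ := hc
  have hj := (List.getElem?_eq_some_iff.1 he).1
  rw [length_prevEnc, List.length_append] at hj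
  have hs := hT.sym _ _ he
  rw [List.length_append] at hs hX
  have e1 : V.length + U.length - 1 - (V.length + j) = U.length - 1 - j := by omega
  rw [e1] at hs
  have h1 : U.length - 1 - j < X := by omega
  obtain ⟨hs1, hs2⟩ := Prod.mk.inj hs
  apply wp_of_vc
  rcases e with e | e
  · simp only [tagArr, valArr] at hs1 hs2
    simp [vc, getChar, h2, h3, h60, h61, hs1, hs2, h1, symCode, trunc]
  · simp only [tagArr, valArr, id] at hs1 hs2
    by_cases hej : e ≤ j
    · simp [vc, getChar, h2, h3, h60, h61, hs1, hs2, h1, symCode, trunc, hej, Nat.not_lt.2 hej]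
    · simp [vc, getChar, h2, h3, h60, h61, hs1, hs2, h1, symCode, trunc, hej, Nat.not_le.1 hej]

/-- Searches the parameter `1` in the list of the parameters. -/
def findParam : Prog :=
  (setR 41 2 ;; setR 43 8) ;;
  .loop (.lt 41 8) (ldR 42 parArr 41 ;;
    .ite (.eq 42 1) (setR 43 41 ;; setR 41 8) (addR 41 41 3))

theorem findParam_spec (h2 : s.reg 2 = 0) (h3 : s.reg 3 = 1) (hX : s.reg 8 ≤ X) (hXW : X ≤ W) :
    wp X W findParam (fun s' => s'.time ≤ s.time + 5 * s.reg 8 + 3 ∧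
      ((s'.reg 43 < s.reg 8 ∧ s.mem parArr (s'.reg 43) = s.reg 1) ∨
        (s'.reg 43 = s.reg 8 ∧ ∀ i < s.reg 8, s.mem parArr i ≠ s.reg 1))) s := by
  refine wp.seq (Q' := fun s' => s'.mem = s.mem ∧ s'.reg 8 = s.reg 8 ∧ s'.reg 1 = s.reg 1 ∧
    s'.reg 3 = 1 ∧ s'.reg 41 = 0 ∧ s'.reg 43 = s.reg 8 ∧ s'.time = s.time + 2)
    (wp_of_vc (by simp [vc, h2, h3])) ?_
  rintro s1 ⟨e1, e2, e3, e4, e5, e6, e7⟩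
  refine wp_loop (fun n s' => s'.mem = s.mem ∧ s'.reg 8 = s.reg 8 ∧ s'.reg 1 = s.reg 1 ∧
    s'.reg 3 = 1 ∧ s'.reg 41 + n = s.reg 8 ∧ s'.time + 5 * n ≤ s.time + 5 * s.reg 8 + 2 ∧
    ((s'.reg 43 < s.reg 8 ∧ s.mem parArr (s'.reg 43) = s.reg 1 ∧ n = 0) ∨
      (s'.reg 43 = s.reg 8 ∧ ∀ i < s'.reg 41, s.mem parArr i ≠ s.reg 1))) ?_ ?_ (s.reg 8) s1
    ⟨e1, e2, e3, e4, by omega, by omega, .inr ⟨e6, by simp [e5]⟩⟩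
  · rintro n s' ⟨f1, f2, f3, f4, f5, f6, f7⟩ ht
    simp only [Test.holds, f2] at ht
    have f7 := (f7.resolve_left (by omega))
    by_cases hc : s.mem parArr (s'.reg 41) = s.reg 1
    · refine wp.mono (Q := fun s'' => s''.mem = s.mem ∧ s''.reg 8 = s.reg 8 ∧ s''.reg 1 = s.reg 1 ∧
        s''.reg 3 = 1 ∧ s''.reg 41 = s.reg 8 ∧ s''.reg 43 = s'.reg 41 ∧ s''.time = s'.time + 5)
        (wp_of_vc ?_) ?_
      · rw [parArr] at hc
        simp [vc, f1, f2, f3, f4, hc]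
        omega
      · rintro s'' ⟨g1, g2, g3, g4, g5, g6, g7⟩
        exact ⟨0, by omega, g1, g2, g3, g4, g5, by omega, .inl ⟨g6 ▸ ht, g6 ▸ hc, rfl⟩⟩
    · refine wp.mono (Q := fun s'' => s''.mem = s.mem ∧ s''.reg 8 = s.reg 8 ∧ s''.reg 1 = s.reg 1 ∧
        s''.reg 3 = 1 ∧ s''.reg 41 = s'.reg 41 + 1 ∧ s''.reg 43 = s'.reg 43 ∧
        s''.time = s'.time + 4) (wp_of_vc ?_) ?_
      · rw [parArr] at hc
        simp [vc, f1, f2, f3, f4, hc]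
        omega
      · rintro s'' ⟨g1, g2, g3, g4, g5, g6, g7⟩
        refine ⟨n - 1, by omega, g1, g2, g3, g4, by omega, by omega,
          .inr ⟨g6.trans f7.1, fun i hi => ?_⟩⟩
        rw [g5] at hi
        rcases Nat.lt_succ_iff_lt_or_eq.1 hi with hi | rfl
        exacts [f7.2 i hi, hc]
  · rintro n s' ⟨f1, f2, f3, f4, f5, f6, f7⟩ ht
    simp only [Test.holds, f2] at ht
    refine ⟨by simp; omega, ?_⟩
    rcases f7 with ⟨f7, f8, -⟩ | ⟨f7, f8⟩
    · exact .inl ⟨f7, f8⟩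
    · exact .inr ⟨f7, fun i hi => f8 i (by omega)⟩

/-- Reads a parameter. -/
def readParam : Prog :=
  findParam ;;
  (.ite (.lt 43 8) (ldR 40 lastArr 43 ;; addR 41 4 3 ;; subR 40 41 40)
    (stR parArr 43 1 ;; addR 8 8 3 ;; setR 40 2) ;;
  addR 41 4 3 ;; stR lastArr 43 41 ;; setR 42 2)

/-- Adds the symbol that has been read to the text; the register `40` is set to the distance to
its next occurrence. -/
def readText : Prog :=
  .ite (.eq 0 2) (setR 40 2 ;; setR 42 1) readParam ;;
  (stR tagArr 4 0 ;; stR valArr 4 42 ;; stR nxtArr 4 40 ;; subR 41 4 40 ;;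
  .ite (.lt 2 40) (stR valArr 41 40) .skip ;; addR 4 4 3)

theorem readParam_spec (hcP : Function.Injective cP) {p : P} (hP : Params cP s.mem (s.reg 8) T)
    (h1 : s.reg 1 = cP p) (h2 : s.reg 2 = 0)
    (h3 : s.reg 3 = 1) (h4 : s.reg 4 = T.length) (hX : T.length < X) (hXW : X ≤ W) :
    wp X W readParam (fun s' => s'.time ≤ s.time + 5 * s.reg 8 + 10 ∧
      s'.reg 40 = nxt (Sum.inr p) T ∧ s'.reg 42 = 0 ∧
      Params cP s'.mem (s'.reg 8) (Sum.inr p :: T)) s := by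
  have hle := hP.le
  refine wp.seq_frame (findParam_spec h2 h3 (by omega) hXW) ?_
  rintro s1 ⟨ht, h43⟩ fr
  have m1 : s1.mem = s.mem := funext fun k => fr.mem k rfl
  have r8 : s1.reg 8 = s.reg 8 := fr.reg _ rfl
  have r1 : s1.reg 1 = cP p := (fr.reg _ rfl).trans h1
  have r2 : s1.reg 2 = 0 := (fr.reg _ rfl).trans h2
  have r3 : s1.reg 3 = 1 := (fr.reg _ rfl).trans h3
  have r4 : s1.reg 4 = T.length := (fr.reg _ rfl).trans h4
  apply wp_of_vc
  rw [h1] at h43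
  rcases h43 with ⟨h43, hp⟩ | ⟨h43, hp⟩
  · obtain ⟨q, hq, hq1, hq2⟩ := hP.code _ h43
    obtain rfl := hcP (hp.symm.trans hq1)
    rw [lastArr] at hq2
    have ho := fun m' => Params.old (m' := m') hcP hP h43 hp
    simp [vc, m1, r2, r3, r4, r8, h43]
    refine ⟨by omega, by omega, by omega, by omega, by omega, ?_⟩
    refine ho _ ?_ ?_ <;> simp
  · have ho := fun m' => Params.new (m' := m') hP hp
    have h0 : nxt (Sum.inr p) T = 0 := by
      by_contra h0
      obtain ⟨i, hi, he⟩ := hP.surj p (nxt_ne_zero.1 h0)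
      exact hp i hi he
    simp [vc, m1, r1, r2, r3, r4, r8, h43, h0]
    refine ⟨by omega, by omega, by omega, by omega, by omega, ?_⟩
    refine ho _ ?_ ?_ <;> simp

theorem readText_spec [Fintype P] (hcP : Function.Injective cP) (hT : Text cA s.mem T)
    (hP : Params cP s.mem (s.reg 8) T) (h01 : (s.reg 0, s.reg 1) = symCode cA cP a)
    (h2 : s.reg 2 = 0) (h3 : s.reg 3 = 1) (h4 : s.reg 4 = T.length) (hX : T.length < X)
    (hXW : X ≤ W) :
    wp X W readText (fun s' => s'.time ≤ s.time + 5 * Fintype.card P + 20 ∧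
      s'.reg 40 = nxt a T ∧ s'.reg 4 = T.length + 1 ∧ Text cA s'.mem (a :: T) ∧
      Params cP s'.mem (s'.reg 8) (a :: T)) s := by
  have hle := nxt_le a T
  have hcard := hP.le_card
  obtain ⟨h0, h1⟩ := Prod.mk.inj h01
  refine wp.seq_frame (Q' := fun s' => s'.time ≤ s.time + 5 * Fintype.card P + 12 ∧
    s'.reg 40 = nxt a T ∧ (s.reg 0, s'.reg 42) = symCode cA id (headSym a) ∧
    Params cP s'.mem (s'.reg 8) (a :: T)) ?_ ?_
  · refine wp_ite (fun h => ?_) (fun h => ?_)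
    · rw [Test.holds, h0, h2] at h
      rcases a with c | p
      · apply wp_of_vc
        simp only at h0 h1
        simpa [vc, h2, nxt, headSym, symCode, h0, h1] using
          ⟨by omega, hP.static c rfl rfl⟩
      · simp at h
    · rw [Test.holds, h0, h2] at h
      rcases a with c | p
      · simp at h
      · refine (readParam_spec (s := s.tick) hcP hP h1 h2 h3 h4 hX hXW).mono ?_
        rintro s' ⟨g1, g2, g3, g4⟩
        rw [State.tick_time, State.tick_reg] at g1
        exact ⟨by omega, g2, by simp [h0, g3, symCode, headSym], g4⟩
  · rintro s1 ⟨g1, g2, g3, g4⟩ fr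
    have r0 : s1.reg 0 = s.reg 0 := fr.reg _ rfl
    have r2 : s1.reg 2 = 0 := (fr.reg _ rfl).trans h2
    have r3 : s1.reg 3 = 1 := (fr.reg _ rfl).trans h3
    have r4 : s1.reg 4 = T.length := (fr.reg _ rfl).trans h4
    have m0 : s1.mem 0 = s.mem 0 := fr.mem _ rfl
    have m1 : s1.mem 1 = s.mem 1 := fr.mem _ rfl
    have m17 : s1.mem 17 = s.mem 17 := fr.mem _ rfl
    have hcons := fun m' => Text.cons (m' := m') hT g3
    have hpar : ∀ m' : ℕ → ℕ → ℕ, m' parArr = s1.mem parArr → m' lastArr = s1.mem lastArr →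
        Params cP m' (s1.reg 8) (a :: T) := fun m' e1 e2 =>
      ⟨g4.le, by rw [e1, e2]; exact g4.code, by rw [e1]; exact g4.surj, by rw [e1]; exact g4.inj⟩
    apply wp_of_vc
    by_cases hn : nxt a T = 0
    · simp [vc, r0, r2, r3, r4, g2, hn]
      refine ⟨by omega, by omega, by omega, hcons _ ?_ ?_ ?_, hpar _ ?_ ?_⟩ <;>
        simp [hn, m0, m1, m17]
    · simp [vc, r0, r2, r3, r4, g2, Nat.pos_of_ne_zero hn]
      refine ⟨by omega, by omega, by omega, by omega, hcons _ ?_ ?_ ?_, hpar _ ?_ ?_⟩ <;>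
        simp [hn, m0, m1, m17]

end Text

/-! ## The stored tree -/

section Tree

variable {A P : Type*} [DecidableEq A] [DecidableEq P]
variable {X W : ℕ} {s : State} {cA : A → ℕ} {cP : P → ℕ} {S T U : List (A ⊕ P)} {a : A ⊕ P}
variable {m m' : ℕ → ℕ → ℕ} {N : Set (List (A ⊕ ℕ))} {num : List (A ⊕ ℕ) → ℕ} {c f : ℕ}
variable {E : Entries}

/-- The memory holds a tree with the nodes `N`, which have numbers up to `c`, in dictionaries with
the entries `E`. -/
structure Tree (cA : A → ℕ) (m : ℕ → ℕ → ℕ) (S : List (A ⊕ P)) (N : Set (List (A ⊕ ℕ)))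
    (num : List (A ⊕ ℕ) → ℕ) (c f : ℕ) (E : Entries) : Prop where
  inj : ∀ x ∈ N, ∀ y ∈ N, num x = num y → x = y
  range : ∀ x ∈ N, num x ≠ 0 ∧ num x ≤ c
  nil_mem : [] ∈ N
  num_nil : num [] = 1
  root : m rootArr 0 = 1
  len : ∀ x ∈ N, m lenArr (num x) = x.length
  pos : ∀ x ∈ N, ∃ U, U <:+ S ∧ U.length = m posArr (num x) ∧ x <+: prevEnc U
  parent : ∀ x z, Cov N x z → m parentArr (num z) = num x
  child : ∀ x ∈ N, ∀ k t, E true (num x) k t ↔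
    ∃ d z, Cov N x z ∧ x ++ [d] <+: z ∧ k = symCode cA id d ∧ t = num z
  link : ∀ i k t, E false i k t → ∃ κ x v, x ∈ N ∧ v ∈ N ∧ i = num x ∧ k = symCode cA id κ ∧
    t = num v ∧ IsLink P κ x v
  fresh : ∀ i k t, E true i k t → i ≤ c
  dict : Dict m f E
  linked : ∃ L : Finset ℕ, L ⊆ Finset.Icc 1 c ∧ f ≤ c + L.card ∧ ∀ t ∈ L, ∃ i k, E false i k t

namespace Tree

/-- Up to the initial offset, the cells that serve edges number at most `c`, and those that serve
links are counted by their targets, of which there are again at most `c`. -/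
theorem free_le (h : Tree cA m S N num c f E) : f ≤ 2 * c := by
  obtain ⟨L, hL, hf, -⟩ := h.linked
  have := Finset.card_le_card hL
  rw [Nat.card_Icc] at this
  omega

theorem congr (h : Tree cA m S N num c f E) (hm : ∀ j, 2 ≤ j → j ≤ 13 → m' j = m j) :
    Tree cA m' S N num c f E where
  __ := h
  root := by rw [hm _ (by simp) (by simp)]; exact h.root
  len := by rw [hm _ (by simp) (by simp)]; exact h.len
  pos := by rw [hm _ (by simp) (by simp)]; exact h.pos
  parent := by rw [hm _ (by simp) (by simp)]; exact h.parent
  dict := h.dict.congr fun j h1 h2 => hm j (by omega) h2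

theorem cons (h : Tree cA m S N num c f E) (a : A ⊕ P) : Tree cA m (a :: S) N num c f E where
  __ := h
  pos x hx :=
    let ⟨U, h1, h2, h3⟩ := h.pos x hx
    ⟨U, h1.trans (List.suffix_cons a S), h2, h3⟩

theorem small_true [Fintype A] [Fintype P] (h : Tree cA m S N num c f E)
    (hN : ∀ x ∈ N, IsTrie T x) {x : List (A ⊕ ℕ)} (hx : x ∈ N) :
    Small E (Fintype.card A + Fintype.card P + 1) true (num x) := by
  obtain ⟨F, hF, hk⟩ := exists_keys_children cA (hN x hx)
  refine ⟨F, hF, fun k t hE => ?_⟩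
  obtain ⟨d, z, hc, hd, rfl, -⟩ := (h.child x hx k t).1 hE
  exact hk d ((hN z hc.2.1).of_prefix hd)

theorem small_false [Fintype A] [Fintype P] (h : Tree cA m S N num c f E) {x : List (A ⊕ ℕ)}
    (hx : x ∈ N) (hxU : x <+: prevEnc U) :
    Small E (Fintype.card A + Fintype.card P + 1) false (num x) := by
  obtain ⟨F, hF, hk⟩ := exists_keys_links cA hxU
  refine ⟨F, hF, fun k t hE => ?_⟩
  obtain ⟨κ, x', v, hx', hv, hi, rfl, -, hl⟩ := h.link _ k t hE
  obtain rfl := h.inj _ hx _ hx' hi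
  exact hk κ v hl

theorem insert_link (h : Tree cA m S N num c f E) {κ : A ⊕ ℕ}
    {x v : List (A ⊕ ℕ)} (hx : x ∈ N) (hv : v ∈ N) (hl : IsLink P κ x v)
    (hno : ∀ t, ¬ E false (num x) (symCode cA id κ) t)
    (hm : ∀ j, 2 ≤ j → j ≤ 5 → m' j = m j)
    (hd : Dict m' (f + 1) (E.insert false (num x) (symCode cA id κ) (num v))) :
    Tree cA m' S N num c (f + 1) (E.insert false (num x) (symCode cA id κ) (num v)) where
  __ := h
  root := by rw [hm _ (by simp) (by simp)]; exact h.root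
  len := by rw [hm _ (by simp) (by simp)]; exact h.len
  pos := by rw [hm _ (by simp) (by simp)]; exact h.pos
  parent := by rw [hm _ (by simp) (by simp)]; exact h.parent
  child y hy k t := by
    rw [← h.child y hy k t]
    simp [Entries.insert]
  link := by
    rintro i k t (hE | ⟨-, rfl, rfl, rfl⟩)
    · exact h.link i k t hE
    · exact ⟨κ, x, v, hx, hv, rfl, rfl, rfl, hl⟩
  fresh := by
    rintro i k t (hE | ⟨h, -⟩)
    · exact h.fresh i k t hE
    · simp at h
  dict := hd
  linked := by
    obtain ⟨L, hL, hf, hLE⟩ := h.linked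
    -- Another link to `v` would have the same source and the same key by `IsLink.source_unique`,
    -- hence would be the entry that is known to be absent.
    have hvL : num v ∉ L := fun hvL => by
      obtain ⟨i, k, hE⟩ := hLE _ hvL
      obtain ⟨κ', x', v', hx', hv', rfl, rfl, hvv, hl'⟩ := h.link _ _ _ hE
      obtain rfl := h.inj _ hv _ hv' hvv
      obtain ⟨rfl, rfl⟩ := hl'.source_unique hl
      exact hno _ hE
    refine ⟨insert (num v) L, ?_, ?_, ?_⟩
    · refine Finset.insert_subset ?_ hL
      have := h.range v hv
      exact Finset.mem_Icc.2 ⟨by omega, this.2⟩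
    · rw [Finset.card_insert_of_notMem hvL]
      omega
    · intro t ht
      rcases Finset.mem_insert.1 ht with rfl | ht
      · exact ⟨num x, _, .inr ⟨rfl, rfl, rfl, rfl⟩⟩
      · obtain ⟨i, k, hE⟩ := hLE t ht
        exact ⟨i, k, .inl hE⟩

/-- Old nodes keep their numbers, and `IsLink` is a property of strings and not of the tree, so the
links stay valid. The new node inherits the occurrence of `w`, of which it is a prefix, and starts
without links. -/
theorem split (hcA : Function.Injective cA) (ht : Tree cA m S N num c f E)
    {v h w : List (A ⊕ ℕ)} {d d' : A ⊕ ℕ} (hc : Cov N v w) (hd : v ++ [d] <+: h)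
    (hd' : h ++ [d'] <+: w) (hhN : h ∉ N) (hex : ∀ u ∈ N, h <+: u → w <+: u)
    (hroot : m' rootArr = m rootArr)
    (hlen : m' lenArr = Function.update (m lenArr) (c + 1) h.length)
    (hpos : m' posArr = Function.update (m posArr) (c + 1) (m posArr (num w)))
    (hpar : m' parentArr =
      Function.update (Function.update (m parentArr) (c + 1) (num v)) (num w) (c + 1))
    (hdict : Dict m' (f + 1) ((E.retarget true (num v) (symCode cA id d) (c + 1)).insert true (c + 1)
      (symCode cA id d') (num w))) :
    Tree cA m' S (insert h N) (Function.update num h (c + 1)) (c + 1) (f + 1)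
      ((E.retarget true (num v) (symCode cA id d) (c + 1)).insert true (c + 1)
        (symCode cA id d') (num w)) := by
  have hvh : v <+: h := (List.prefix_append _ _).trans hd
  have hhw : h <+: w := (List.prefix_append _ _).trans hd'
  have hv : v ≠ h := by
    rintro rfl
    simpa using hd.length_le
  have hw : h ≠ w := by
    rintro rfl
    simpa using hd'.length_le
  have hcov := fun x z => cov_insert_mid (x := x) (z := z) hc hvh hhw hv hw hex
  have hnum : ∀ x ∈ N, Function.update num h (c + 1) x = num x := fun x hx =>
    Function.update_of_ne (by rintro rfl; exact hhN hx) _ _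
  have hne : ∀ x ∈ N, num x ≠ c + 1 := fun x hx => by have := (ht.range x hx).2; omega
  have hnumh : Function.update num h (c + 1) h = c + 1 := Function.update_self _ _ _
  have hkey : ∀ {e e' : A ⊕ ℕ}, symCode cA id e = symCode cA id e' → e = e' :=
    fun he => symCode_injective hcA he
  refine ⟨?_, ?_, .inr ht.nil_mem, (hnum _ ht.nil_mem).trans ht.num_nil, by rw [hroot]; exact ht.root,
    ?_, ?_, ?_, ?_, ?_, ?_, hdict, ?_⟩
  · rintro x (rfl | hx) y (rfl | hy) e
    · rfl
    · rw [hnumh, hnum y hy] at e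
      exact absurd e.symm (hne y hy)
    · rw [hnumh, hnum x hx] at e
      exact absurd e (hne x hx)
    · rw [hnum x hx, hnum y hy] at e
      exact ht.inj x hx y hy e
  · rintro x (rfl | hx)
    · rw [hnumh]; omega
    · rw [hnum x hx]
      have := ht.range x hx
      omega
  · rintro x (rfl | hx)
    · rw [hnumh, hlen, Function.update_self]
    · rw [hnum x hx, hlen, Function.update_of_ne (hne x hx), ht.len x hx]
  · rintro x (rfl | hx)
    · rw [hnumh, hpos, Function.update_self]
      obtain ⟨U, h1, h2, h3⟩ := ht.pos w hc.2.1
      exact ⟨U, h1, h2, hhw.trans h3⟩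
    · rw [hnum x hx, hpos, Function.update_of_ne (hne x hx)]
      exact ht.pos x hx
  · intro x z hxz
    rw [hpar]
    rcases (hcov x z).1 hxz with ⟨h1, h2⟩ | ⟨rfl, rfl⟩ | ⟨rfl, rfl⟩
    · rw [hnum x h1.1, hnum z h1.2.1]
      -- The parent stored with `w` is unique, so an edge to `w` is the one that has been split.
      by_cases hzw : z = w
      · subst hzw
        refine absurd ⟨?_, rfl⟩ h2
        exact ht.inj _ h1.1 _ hc.1 ((ht.parent _ _ h1).symm.trans (ht.parent _ _ hc))
      · rw [Function.update_of_ne (fun e => hzw (ht.inj _ h1.2.1 _ hc.2.1 e)),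
          Function.update_of_ne (hne z h1.2.1), ht.parent _ _ h1]
    · rw [hnumh, hnum _ hc.1, Function.update_of_ne (hne _ hc.2.1).symm, Function.update_self]
    · rw [hnumh, hnum _ hc.2.1, Function.update_self]
  · rintro x hx k t
    simp only [hcov, Entries.insert, Entries.retarget, true_and]
    rcases hx with rfl | hx
    · rw [hnumh, if_neg (fun e => hne _ hc.1 e.1.symm)]
      constructor
      · rintro (hE | ⟨-, rfl, rfl⟩)
        · have := ht.fresh _ _ _ hE
          omega
        · exact ⟨d', w, .inr (.inr ⟨rfl, rfl⟩), hd', rfl, (hnum _ hc.2.1).symm⟩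
      · rintro ⟨e, z, (⟨h1, -⟩ | ⟨h1, -⟩ | ⟨-, rfl⟩), h2, rfl, rfl⟩
        · exact absurd h1.1 hhN
        · exact absurd h1.symm hv
        · rw [eq_of_snoc_prefix h2 hd', hnum _ hc.2.1]
          exact .inr ⟨rfl, rfl, rfl⟩
    · rw [hnum x hx]
      have hxh : x ≠ h := fun e => hhN (e ▸ hx)
      simp only [hne x hx, false_and, or_false, hxh]
      split_ifs with hxk
      · obtain ⟨hxv, rfl⟩ := hxk
        obtain rfl := ht.inj _ hx _ hc.1 hxv
        constructor
        · rintro rfl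
          exact ⟨d, h, .inr ⟨rfl, rfl⟩, hd, rfl, hnumh.symm⟩
        · rintro ⟨e, z, (⟨h1, h2⟩ | ⟨-, rfl⟩), h3, h4, rfl⟩
          · obtain rfl := hkey h4
            refine absurd ⟨rfl, ?_⟩ h2
            refine ht.inj _ h1.2.1 _ hc.2.1 (ht.dict.unique (b := true) (i := num x)
              ((ht.child x hx _ _).2 ⟨d, z, h1, h3, rfl, rfl⟩)
              ((ht.child x hx _ _).2 ⟨d, w, hc, hd.trans hhw, rfl, rfl⟩))
          · exact hnumh
      · rw [ht.child x hx]
        constructor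
        · rintro ⟨e, z, h1, h2, rfl, rfl⟩
          refine ⟨e, z, .inl ⟨h1, ?_⟩, h2, rfl, (hnum z h1.2.1).symm⟩
          rintro ⟨rfl, rfl⟩
          exact hxk ⟨rfl, by rw [eq_of_snoc_prefix h2 (hd.trans hhw)]⟩
        · rintro ⟨e, z, (⟨h1, -⟩ | ⟨rfl, rfl⟩), h3, rfl, rfl⟩
          · exact ⟨e, z, h1, h3, rfl, hnum z h1.2.1⟩
          · exact absurd ⟨rfl, by rw [eq_of_snoc_prefix h3 hd]⟩ hxk
  · rintro i k t (hE | ⟨h, -⟩)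
    · simp only [Entries.retarget, Bool.false_eq_true, false_and, if_false] at hE
      obtain ⟨κ, x, z, hx, hz, rfl, rfl, rfl, hl⟩ := ht.link i k t hE
      exact ⟨κ, x, z, .inr hx, .inr hz, (hnum x hx).symm, rfl, (hnum z hz).symm, hl⟩
    · simp at h
  · rintro i k t (hE | ⟨-, rfl, -⟩)
    · simp only [Entries.retarget, true_and] at hE
      split_ifs at hE with h1
      · rw [h1.1]
        have := (ht.range v hc.1).2
        omega
      · have := ht.fresh i k t hE
        omega
    · exact le_rfl
  · obtain ⟨L, hL, hf, hLE⟩ := ht.linked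
    refine ⟨L, hL.trans (Finset.Icc_subset_Icc_right (by omega)), by omega, fun t ht => ?_⟩
    obtain ⟨i, k, hE⟩ := hLE t ht
    refine ⟨i, k, .inl ?_⟩
    simpa [Entries.retarget] using hE

theorem leaf (ht : Tree cA m S N num c f E)
    {h : List (A ⊕ ℕ)} {d : A ⊕ ℕ} (hh : h ∈ N) (hl : ∀ u ∈ N, ¬ prevEnc S <+: u)
    (hd : h ++ [d] <+: prevEnc S) (hmax : ∀ u ∈ N, u <+: prevEnc S → u <+: h)
    (hroot : m' rootArr = m rootArr)
    (hlen : m' lenArr = Function.update (m lenArr) (c + 1) S.length)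
    (hpos : m' posArr = Function.update (m posArr) (c + 1) S.length)
    (hpar : m' parentArr = Function.update (m parentArr) (c + 1) (num h))
    (hdict : Dict m' (f + 1) (E.insert true (num h) (symCode cA id d) (c + 1))) :
    Tree cA m' S (insert (prevEnc S) N) (Function.update num (prevEnc S) (c + 1)) (c + 1) (f + 1)
      (E.insert true (num h) (symCode cA id d) (c + 1)) := by
  have hlN : prevEnc S ∉ N := fun h' => hl _ h' List.prefix_rfl
  have hcov := fun x z => cov_insert_leaf (x := x) (z := z) hh hl
    ((List.prefix_append _ _).trans hd) hmax
  have hlS := length_prevEnc S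
  have hpS : ∃ U, U <:+ S ∧ U.length = m' posArr (c + 1) ∧ prevEnc S <+: prevEnc U :=
    ⟨S, List.suffix_rfl, by rw [hpos, Function.update_self], List.prefix_rfl⟩
  generalize prevEnc S = l at *
  have hnum : ∀ x ∈ N, Function.update num l (c + 1) x = num x := fun x hx =>
    Function.update_of_ne (by rintro rfl; exact hlN hx) _ _
  have hne : ∀ x ∈ N, num x ≠ c + 1 := fun x hx => by have := (ht.range x hx).2; omega
  have hnuml : Function.update num l (c + 1) l = c + 1 := Function.update_self _ _ _
  refine ⟨?_, ?_, .inr ht.nil_mem, (hnum _ ht.nil_mem).trans ht.num_nil, by rw [hroot]; exact ht.root,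
    ?_, ?_, ?_, ?_, ?_, ?_, hdict, ?_⟩
  · rintro x (rfl | hx) y (rfl | hy) e
    · rfl
    · rw [hnuml, hnum y hy] at e
      exact absurd e.symm (hne y hy)
    · rw [hnuml, hnum x hx] at e
      exact absurd e (hne x hx)
    · rw [hnum x hx, hnum y hy] at e
      exact ht.inj x hx y hy e
  · rintro x (rfl | hx)
    · rw [hnuml]; omega
    · rw [hnum x hx]
      have := ht.range x hx
      omega
  · rintro x (rfl | hx)
    · rw [hnuml, hlen, Function.update_self, hlS]
    · rw [hnum x hx, hlen, Function.update_of_ne (hne x hx), ht.len x hx]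
  · rintro x (rfl | hx)
    · rw [hnuml]
      exact hpS
    · rw [hnum x hx, hpos, Function.update_of_ne (hne x hx)]
      exact ht.pos x hx
  · intro x z hxz
    rw [hpar]
    rcases (hcov x z).1 hxz with h1 | ⟨rfl, rfl⟩
    · rw [hnum x h1.1, hnum z h1.2.1, Function.update_of_ne (hne z h1.2.1), ht.parent _ _ h1]
    · rw [hnuml, hnum _ hh, Function.update_self]
  · rintro x hx k t
    simp only [hcov, Entries.insert, true_and]
    rcases hx with rfl | hx
    · rw [hnuml]
      constructor
      · rintro (hE | ⟨h1, -⟩)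
        · have := ht.fresh _ _ _ hE
          omega
        · exact absurd h1.symm (hne h hh)
      · rintro ⟨e, z, (h1 | ⟨rfl, -⟩), -⟩
        · exact absurd h1.1 hlN
        · exact absurd hh hlN
    · rw [hnum x hx, ht.child x hx]
      constructor
      · rintro (⟨e, z, h1, h2, rfl, rfl⟩ | ⟨h1, rfl, rfl⟩)
        · exact ⟨e, z, .inl h1, h2, rfl, (hnum z h1.2.1).symm⟩
        · obtain rfl := ht.inj _ hx _ hh h1
          exact ⟨d, l, .inr ⟨rfl, rfl⟩, hd, rfl, hnuml.symm⟩
      · rintro ⟨e, z, (h1 | ⟨rfl, rfl⟩), h3, rfl, rfl⟩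
        · exact .inl ⟨e, z, h1, h3, rfl, hnum z h1.2.1⟩
        · exact .inr ⟨rfl, by rw [eq_of_snoc_prefix h3 hd], hnuml⟩
  · rintro i k t (hE | ⟨h, -⟩)
    · obtain ⟨κ, x, z, hx, hz, rfl, rfl, rfl, hl⟩ := ht.link i k t hE
      exact ⟨κ, x, z, .inr hx, .inr hz, (hnum x hx).symm, rfl, (hnum z hz).symm, hl⟩
    · simp at h
  · rintro i k t (hE | ⟨-, rfl, -⟩)
    · have := ht.fresh i k t hE
      omega
    · have := (ht.range h hh).2
      omega
  · obtain ⟨L, hL, hf, hLE⟩ := ht.linked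
    refine ⟨L, hL.trans (Finset.Icc_subset_Icc_right (by omega)), by omega, fun t ht => ?_⟩
    obtain ⟨i, k, hE⟩ := hLE t ht
    exact ⟨i, k, .inl hE⟩

end Tree

end Tree

/-! ## The walk to the root -/

section Walk

variable {A P : Type*} [DecidableEq A] [DecidableEq P]
variable {X W : ℕ} {s s' : State} {cA : A → ℕ} {cP : P → ℕ} {T U : List (A ⊕ P)} {a : A ⊕ P}
variable {m m' : ℕ → ℕ → ℕ} {N : Set (List (A ⊕ ℕ))} {num : List (A ⊕ ℕ) → ℕ} {c f b : ℕ}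
variable {E : Entries} {x : List (A ⊕ ℕ)} {xs : List (List (A ⊕ ℕ))}

/-- What does not change while the tree is updated after the symbol `a` has been read. -/
structure Ctx (cA : A → ℕ) (cP : P → ℕ) (a : A ⊕ P) (T : List (A ⊕ P)) (s : State) : Prop where
  zero : s.reg 2 = 0
  one : s.reg 3 = 1
  length : s.reg 4 = T.length + 1
  nxt : s.reg 40 = nxt a T
  code : (s.reg 0, s.reg 1) = symCode cA cP a
  text : Text cA s.mem (a :: T)

/-- Whether a program does not change the context. -/
def Prog.keeps (p : Prog) : Bool :=
  !(p.writesReg 0 || p.writesReg 1 || p.writesReg 2 || p.writesReg 3 || p.writesReg 4 ||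
    p.writesReg 40 || p.writesArr tagArr || p.writesArr valArr || p.writesArr nxtArr)

theorem Ctx.frame (h : Ctx cA cP a T s) {p : Prog} (hf : Frame p s s') (hp : p.keeps = true) :
    Ctx cA cP a T s' := by
  simp only [Prog.keeps, Bool.not_eq_true', Bool.or_eq_false_iff] at hp
  obtain ⟨⟨⟨⟨⟨⟨⟨⟨h0, h1⟩, h2⟩, h3⟩, h4⟩, h5⟩, h6⟩, h7⟩, h8⟩ := hp
  refine ⟨(hf.reg _ h2).trans h.zero, (hf.reg _ h3).trans h.one, (hf.reg _ h4).trans h.length,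
    (hf.reg _ h5).trans h.nxt, ?_, ⟨?_, ?_⟩⟩
  · rw [hf.reg _ h0, hf.reg _ h1, h.code]
  · rw [hf.mem _ h6, hf.mem _ h7]; exact h.text.sym
  · rw [hf.mem _ h8]; exact h.text.next

theorem Ctx.congr (h : Ctx cA cP a T s) (hm : s'.mem = s.mem)
    (hr : ∀ r ≤ 40, s'.reg r = s.reg r) : Ctx cA cP a T s' := by
  refine ⟨(hr _ (by omega)).trans h.zero, (hr _ (by omega)).trans h.one,
    (hr _ (by omega)).trans h.length, (hr _ (by omega)).trans h.nxt, ?_, hm ▸ h.text⟩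
  rw [hr _ (by omega), hr _ (by omega), h.code]

theorem Ctx.tick (h : Ctx cA cP a T s) : Ctx cA cP a T s.tick :=
  ⟨h.zero, h.one, h.length, h.nxt, h.code, h.text⟩

/-- The stack in the memory holds the numbers of the given nodes, the first one on top. -/
def Stk (m : ℕ → ℕ → ℕ) (num : List (A ⊕ ℕ) → ℕ) : List (List (A ⊕ ℕ)) → Prop
  | [] => True
  | x :: xs => m stkArr xs.length = num x ∧ Stk m num xs

omit [DecidableEq A] in
theorem Stk.congr (h : ∀ i < xs.length, m' stkArr i = m stkArr i) (hs : Stk m num xs) :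
    Stk m' num xs := by
  induction xs with
  | nil => trivial
  | cons x xs ih =>
    exact ⟨(h _ (by simp)).trans hs.1, ih (fun i hi => h i (by simp; omega)) hs.2⟩

/-- The stack holds the nodes of length at least `b` on the path from the last leaf to the root;
none of them has a link for the symbol `a`. -/
structure Stack (cA : A → ℕ) (a : A ⊕ P) (T : List (A ⊕ P)) (m : ℕ → ℕ → ℕ)
    (num : List (A ⊕ ℕ) → ℕ) (E : Entries) (xs : List (List (A ⊕ ℕ))) (b : ℕ) : Prop where
  stk : Stk m num xs
  mem : ∀ x, x ∈ xs ↔ x ∈ nodes T ∧ x <+: prevEnc T ∧ b ≤ x.length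
  sorted : xs.Pairwise fun x y => x.length < y.length
  nolink : ∀ x ∈ xs, ∀ t, ¬ E false (num x) (symCode cA id (linkKey a T x.length)) t

theorem Stack.push (h : Stack cA a T m num E xs (x.length + 1)) (hx : x ∈ nodes T)
    (hxT : x <+: prevEnc T) (hb : b ≤ x.length)
    (hz : ∀ z ∈ nodes T, z <+: prevEnc T → b ≤ z.length → z.length ≤ x.length → z = x)
    (hno : ∀ t, ¬ E false (num x) (symCode cA id (linkKey a T x.length)) t)
    (hm : m' stkArr = Function.update (m stkArr) xs.length (num x)) :
    Stack cA a T m' num E (x :: xs) b := by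
  refine ⟨⟨by rw [hm, Function.update_self], h.stk.congr fun i hi => ?_⟩, fun z => ?_,
    List.pairwise_cons.2 ⟨fun z hz => ?_, h.sorted⟩, ?_⟩
  · rw [hm, Function.update_of_ne hi.ne]
  · rw [List.mem_cons, h.mem]
    constructor
    · rintro (rfl | ⟨h1, h2, h3⟩)
      exacts [⟨hx, hxT, hb⟩, ⟨h1, h2, by omega⟩]
    · rintro ⟨h1, h2, h3⟩
      by_cases hzx : z.length ≤ x.length
      · exact .inl (hz z h1 h2 h3 hzx)
      · exact .inr ⟨h1, h2, by omega⟩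
  · have := ((h.mem z).1 hz).2.2
    omega
  · intro z hz
    rcases List.mem_cons.1 hz with rfl | hz
    exacts [hno, h.nolink z hz]

/-- The nodes on the stack are different ancestors of the last leaf, of length at least `b`, and are
disjoint from those counted on the left. This pays for the walk: what is pushed is subtracted from
the depth. -/
theorem Stack.count (h : Stack cA a T m num E xs b) (hb : b ≤ T.length + 1) :
    xs.length + cnt (nodes T) (prevEnc T) b ≤ cnt (nodes T) (prevEnc T) (T.length + 1) := by
  classical
  have hnd : (xs.map List.length).Nodup :=
    (List.pairwise_map.2 h.sorted).imp fun hlt => hlt.ne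
  unfold cnt
  rw [← List.length_map (as := xs) List.length, ← List.toFinset_card_of_nodup hnd,
    ← Finset.card_union_of_disjoint]
  · refine Finset.card_le_card fun i hi => ?_
    simp only [Finset.mem_union, List.mem_toFinset, List.mem_map, Finset.mem_filter,
      Finset.mem_range] at hi ⊢
    rcases hi with ⟨x, hx, rfl⟩ | hi
    · obtain ⟨h1, h2, -⟩ := (h.mem x).1 hx
      have := h2.length_le
      rw [length_prevEnc] at this
      exact ⟨by omega, prefix_take_iff.1 h2 ▸ h1⟩
    · exact ⟨by omega, hi.2⟩
  · rw [Finset.disjoint_left]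
    intro i hi hi'
    simp only [List.mem_toFinset, List.mem_map, Finset.mem_filter, Finset.mem_range] at hi hi'
    obtain ⟨x, hx, rfl⟩ := hi
    have := ((h.mem x).1 hx).2.2
    omega

theorem Stack.length_le (h : Stack cA a T m num E xs b) (hb : b ≤ T.length + 1) :
    xs.length ≤ T.length + 1 := by
  have := h.count hb
  have := cnt_le (nodes T) (prevEnc T) (T.length + 1)
  omega

/-- Prepares the search for the link of the node `44`. -/
def linkQuery : Prog :=
  setR 10 44 ;; ldR 47 lenArr 44 ;; setR 11 0 ;;
  .ite (.eq 0 2) (setR 12 1) (.ite (.lt 47 40) (setR 12 2) (setR 12 40))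

theorem linkQuery_spec (hC : Ctx cA cP a T s) (hT : Tree cA s.mem T N num c f E)
    (hx : x ∈ N) (h44 : s.reg 44 = num x) (hc : c < X) :
    wp X W linkQuery (fun s' => s'.mem = s.mem ∧ s'.time ≤ s.time + 6 ∧ s'.reg 10 = num x ∧
      (s'.reg 11, s'.reg 12) = symCode cA id (linkKey a T x.length)) s := by
  have hl := hT.len x hx
  have hn := (hT.range x hx).2
  obtain ⟨h0, h1⟩ := Prod.mk.inj hC.code
  rw [lenArr] at hl
  apply wp_of_vc
  rcases a with d | p
  · simp only at h0 h1
    simp [vc, linkQuery, h44, hC.zero, h0, h1, symCode, linkKey]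
    omega
  · simp only at h0 h1
    by_cases hnx : nxt (Sum.inr p) T ≤ x.length
    · simp [vc, linkQuery, h44, hC.zero, h0, hC.nxt, symCode, linkKey, hl, hnx, Nat.not_lt.2 hnx]
      omega
    · simp [vc, linkQuery, h44, hC.zero, h0, hC.nxt, symCode, linkKey, hl, hnx, Nat.not_le.1 hnx]
      omega

/-- One step of the walk from the last leaf towards the root. -/
def walkStep : Prog :=
  linkQuery ;; lookup (dArr false) ;;
  .ite (.eq 14 2)
    (stR stkArr 45 44 ;; addR 45 45 3 ;; .ite (.eq 44 3) (setR 46 3) (ldR 44 parentArr 44))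
    (ldR 46 targetArr 14)

/-- The walk from the last leaf towards the root, up to the first node with a link for the symbol
that has been read; the nodes without such a link are stored on a stack. -/
def walk : Prog :=
  (setR 44 5 ;; setR 45 2 ;; setR 46 2) ;; .loop (.eq 46 2) walkStep

/-- The result of the walk. -/
structure Walked (cA : A → ℕ) (a : A ⊕ P) (T : List (A ⊕ P)) (num : List (A ⊕ ℕ) → ℕ)
    (E : Entries) (v : List (A ⊕ ℕ)) (xs : List (List (A ⊕ ℕ))) (s : State) : Prop where
  mem : v ∈ nodes T
  pre : v <+: prevEnc (a :: T)
  reg_v : s.reg 46 = num v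
  reg_sp : s.reg 45 = xs.length
  stack : Stack cA a T s.mem num E xs v.length

/-- The three outcomes are a link, the root without a link (from which the descent then starts), and
a move to the parent. No node lies between a node and its parent, so the stack keeps holding all
nodes above the bound. -/
theorem walkStep_spec [Fintype A] [Fintype P] (hcA : Function.Injective cA)
    (hC : Ctx cA cP a T s)
    (hT : Tree cA s.mem T (nodes T) num c f E)
    (hx : x ∈ nodes T) (hxT : x <+: prevEnc T) (h44 : s.reg 44 = num x)
    (h45 : s.reg 45 = xs.length) (h46 : s.reg 46 = 0)
    (hS : Stack cA a T s.mem num E xs (x.length + 1)) (hc : c < X) (hf : f ≤ X)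
    (hX : T.length + 2 < X) (hXW : X ≤ W) :
    wp X W walkStep (fun s' =>
      s'.time ≤ s.time + (8 * htBound (Fintype.card A + Fintype.card P + 1) + 15) ∧
      ((∃ v, Walked cA a T num E v xs s') ∨ (Walked cA a T num E [] (x :: xs) s') ∨
        (s'.reg 46 = 0 ∧ ∃ y ∈ nodes T, y <+: prevEnc T ∧ y.length < x.length ∧
          s'.reg 44 = num y ∧ s'.reg 45 = xs.length + 1 ∧
          Stack cA a T s'.mem num E (x :: xs) (y.length + 1)))) s := by
  refine wp.seq_frame (linkQuery_spec hC hT hx h44 hc) ?_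
  rintro s1 ⟨m1, t1, r10, r11⟩ fr1
  obtain ⟨r11, r12⟩ := Prod.mk.inj r11
  have hC1 := hC.frame fr1 rfl
  have g44 : s1.reg 44 = num x := (fr1.reg _ rfl).trans h44
  have g45 : s1.reg 45 = xs.length := (fr1.reg _ rfl).trans h45
  have g46 : s1.reg 46 = 0 := (fr1.reg _ rfl).trans h46
  have hn := (hT.range x hx)
  have hxl := hxT.length_le
  rw [length_prevEnc] at hxl
  have hle := hS.length_le (by omega)
  refine wp.seq_frame (Dict.lookup_spec (b := false) (E := E) (i := num x)
    (k := symCode cA id (linkKey a T x.length)) (m1 ▸ hT.dict) (hT.small_false hx hxT)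
    hC1.zero r10 (by omega) r11 r12 hf) ?_
  rintro s2 ⟨m2, t2, h14⟩ fr2
  have hC2 := hC1.frame fr2 rfl
  have g44 : s2.reg 44 = num x := (fr2.reg _ rfl).trans g44
  have g45 : s2.reg 45 = xs.length := (fr2.reg _ rfl).trans g45
  have g46 : s2.reg 46 = 0 := (fr2.reg _ rfl).trans g46
  have m2 : s2.mem = s.mem := m2.trans m1
  rcases h14 with ⟨h14, hno⟩ | ⟨h14, h14X, hE, -⟩
  · have hpush := fun b hb hz m' hm' => hS.push (b := b) (m' := m') hx hxT hb hz hno hm'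
    by_cases hxn : x = []
    · subst hxn
      rw [hT.num_nil] at g44
      refine wp.mono (Q := fun s' => s'.time = s2.time + 5 ∧ s'.reg 46 = 1 ∧
        s'.reg 45 = xs.length + 1 ∧ s'.mem stkArr = Function.update (s.mem stkArr) xs.length 1)
        (wp_of_vc ?_) ?_
      · simp [vc, hC2.zero, hC2.one, h14, g44, g45, m2]
        omega
      · rintro s' ⟨q1, q2, q3, q4⟩
        refine ⟨by omega, .inr (.inl ⟨hx, List.nil_prefix, q2.trans hT.num_nil.symm, q3, ?_⟩)⟩
        refine hpush 0 (by simp) (fun z _ _ _ h => by simpa using h) _ ?_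
        rw [q4, hT.num_nil]
    · obtain ⟨y, hy⟩ := exists_parent hx hxn
      have hx1 : num x ≠ 1 := fun h => hxn (hT.inj _ hx _ hT.nil_mem (h.trans hT.num_nil.symm))
      have hpar := hT.parent _ _ hy
      rw [parentArr] at hpar
      have hyl : y.length < x.length := by
        have := hy.2.2.1.length_le
        have : y.length ≠ x.length := fun e => hy.2.2.2.1 (hy.2.2.1.eq_of_length e)
        omega
      refine wp.mono (Q := fun s' => s'.time = s2.time + 5 ∧ s'.reg 46 = 0 ∧
        s'.reg 45 = xs.length + 1 ∧ s'.reg 44 = num y ∧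
        s'.mem stkArr = Function.update (s.mem stkArr) xs.length (num x))
        (wp_of_vc ?_) ?_
      · simp [vc, hC2.zero, hC2.one, h14, g44, g45, g46, m2, hx1, hpar]
        omega
      · rintro s' ⟨q1, q2, q3, q4, q5⟩
        refine ⟨by omega, .inr (.inr ⟨q2, y, hy.1, hy.2.2.1.trans hxT, hyl, q4, q3, ?_⟩)⟩
        refine hpush _ (by omega) (fun z hz h1 h2 h3 => ?_) _ q5
        have hzx := List.prefix_of_prefix_length_le h1 hxT h3
        have hyz := List.prefix_of_prefix_length_le (hy.2.2.1.trans hxT) h1 (by omega)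
        rcases hy.2.2.2.2 z hz hyz hzx with rfl | rfl
        · omega
        · rfl
  · rw [m1] at hE
    obtain ⟨κ, x', v, hx', hv, hi, hk, htgt, hl⟩ := hT.link _ _ _ hE
    obtain rfl := hT.inj _ hx _ hx' hi
    obtain rfl := symCode_injective hcA hk
    -- The stored link leads to the right prefix of the new string, although it was inserted at an
    -- earlier time.
    obtain rfl := hl.target_unique
      (v' := (prevEnc (a :: T)).take (x.length + 1)) ⟨a, T, x.length, hxl, prefix_take_iff.1 hxT, rfl, rfl⟩
    rw [targetArr] at htgt
    refine wp.mono (Q := fun s' => s'.time = s2.time + 2 ∧ s'.reg 46 = num ((prevEnc (a :: T)).take (x.length + 1)) ∧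
      s'.reg 45 = xs.length ∧ s'.mem = s.mem) (wp_of_vc ?_) ?_
    · simp [vc, hC2.zero, h14, g45, m2, htgt]
      omega
    · rintro s' ⟨q1, q2, q3, q4⟩
      refine ⟨by omega, .inl ⟨_, hv, List.take_prefix _ _, q2, q3, ?_⟩⟩
      rw [q4, List.length_take, length_prevEnc, List.length_cons, min_eq_left (by omega)]
      exact hS

theorem walk_spec [Fintype A] [Fintype P] (hcA : Function.Injective cA)
    (hC : Ctx cA cP a T s)
    (hT : Tree cA s.mem T (nodes T) num c f E) (h5 : s.reg 5 = num (prevEnc T))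
    (hc : c < X) (hf : f ≤ X) (hX : T.length + 2 < X) (hXW : X ≤ W) :
    wp X W walk (fun s' => ∃ v xs, Walked cA a T num E v xs s' ∧
      s'.time ≤ s.time + 4 + (8 * htBound (Fintype.card A + Fintype.card P + 1) + 16) *
        (xs.length + 1)) s := by
  generalize hH : 8 * htBound (Fintype.card A + Fintype.card P + 1) + 16 = H
  refine wp.seq_frame (Q' := fun s' => s'.mem = s.mem ∧ s'.reg 44 = num (prevEnc T) ∧
    s'.reg 45 = 0 ∧ s'.reg 46 = 0 ∧ s'.time = s.time + 3) (wp_of_vc (by simp [vc, h5, hC.zero])) ?_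
  rintro s1 ⟨m1, r44, r45, r46, t1⟩ fr1
  have hC1 := hC.frame fr1 rfl
  refine wp_loop (fun n s' => Ctx cA cP a T s' ∧ (∀ j, j ≠ stkArr → s'.mem j = s.mem j) ∧
    ((n = 0 ∧ s'.reg 46 ≠ 0 ∧ ∃ v xs, Walked cA a T num E v xs s' ∧
      s'.time ≤ s.time + 3 + H * (xs.length + 1)) ∨
    (s'.reg 46 = 0 ∧ ∃ x xs, n = x.length + 1 ∧ x ∈ nodes T ∧ x <+: prevEnc T ∧
      s'.reg 44 = num x ∧ s'.reg 45 = xs.length ∧ s'.time ≤ s.time + 3 + H * xs.length ∧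
      Stack cA a T s'.mem num E xs (x.length + 1)))) ?_ ?_ (T.length + 1) s1 ?_
  · rintro n s' ⟨hC', hm, h⟩ ht
    rw [Test.holds, hC'.zero] at ht
    obtain ⟨h46, x, xs, rfl, hx, hxT, h44, h45, htm, hS⟩ := h.resolve_left fun h => h.2.1 ht
    have hT' : Tree cA s'.mem T (nodes T) num c f E :=
      hT.congr fun j h1 h2 => hm j (by simp; omega)
    refine (walkStep_spec (s := s'.tick) hcA hC'.tick hT' hx hxT h44 h45 h46 hS hc hf hX
      hXW).frame.mono ?_
    rintro s'' ⟨⟨ht', h⟩, fr⟩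
    rw [State.tick_time] at ht'
    have hC'' := hC'.tick.frame fr rfl
    have hm' : ∀ j, j ≠ stkArr → s''.mem j = s.mem j := fun j hj =>
      (fr.mem j (by
        rw [stkArr] at hj
        simp [Prog.writesArr, walkStep, linkQuery, lookup, hj])).trans (hm j hj)
    have e1 : H * (xs.length + 1) = H * xs.length + H := by ring
    rcases h with ⟨v, hv⟩ | hv | ⟨h46', y, hy, hyT, hyl, h44', h45', hS'⟩
    · refine ⟨0, by omega, hC'', hm', .inl ⟨rfl, ?_, v, xs, hv, by omega⟩⟩
      rw [hv.reg_v]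
      exact (hT.range v hv.mem).1
    · refine ⟨0, by omega, hC'', hm', .inl ⟨rfl, ?_, [], x :: xs, hv, ?_⟩⟩
      · rw [hv.reg_v]
        exact (hT.range _ hv.mem).1
      · rw [List.length_cons, mul_add]
        omega
    · refine ⟨y.length + 1, by omega, hC'', hm', .inr ⟨h46', y, x :: xs, rfl, hy, hyT, h44', h45',
        ?_, hS'⟩⟩
      rw [List.length_cons]
      omega
  · rintro n s' ⟨hC', hm, h⟩ ht
    rw [Test.holds, hC'.zero] at ht
    obtain ⟨-, -, v, xs, hv, htm⟩ := h.resolve_right fun h => ht h.1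
    exact ⟨v, xs, ⟨hv.mem, hv.pre, hv.reg_v, hv.reg_sp, hv.stack⟩, by rw [State.tick_time]; omega⟩
  · refine ⟨hC1, fun j _ => by rw [m1], .inr ⟨r46, prevEnc T, [], by rw [length_prevEnc],
      isNode_prevEnc List.suffix_rfl, List.prefix_rfl, r44, r45, by simp [t1], trivial, fun x => ?_,
      List.Pairwise.nil, by simp⟩⟩
    simp only [List.not_mem_nil, false_iff, not_and, not_le]
    intro _ h
    have := h.length_le
    omega

end Walk

/-! ## The search for the place of a mismatch -/

section Mismatch

variable {A P : Type*} [DecidableEq A] [DecidableEq P]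
variable {X W : ℕ} {s s' : State} {cA : A → ℕ} {cP : P → ℕ} {T U : List (A ⊕ P)} {a b : A ⊕ P}
variable {m m' : ℕ → ℕ → ℕ} {N : Set (List (A ⊕ ℕ))} {num : List (A ⊕ ℕ) → ℕ} {c f k : ℕ}
variable {E : Entries} {x v w : List (A ⊕ ℕ)} {xs : List (List (A ⊕ ℕ))}

theorem Stack.pop (h : Stack cA a T m num E (x :: xs) k) :
    Stack cA a T m num E xs (x.length + 1) := by
  obtain ⟨h1, h2⟩ := List.pairwise_cons.1 h.sorted
  refine ⟨h.stk.2, fun z => ⟨fun hz => ?_, fun ⟨h3, h4, h5⟩ => ?_⟩, h2,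
    fun z hz => h.nolink z (List.mem_cons_of_mem _ hz)⟩
  · obtain ⟨h3, h4, -⟩ := (h.mem z).1 (List.mem_cons_of_mem _ hz)
    exact ⟨h3, h4, h1 z hz⟩
  · have := ((h.mem x).1 List.mem_cons_self).2.2
    rcases List.mem_cons.1 ((h.mem z).2 ⟨h3, h4, by omega⟩) with rfl | hz
    · omega
    · exact hz

theorem Stack.head_le (h : Stack cA a T m num E (x :: xs) k) {z : List (A ⊕ ℕ)}
    (hz : z ∈ x :: xs) : x.length ≤ z.length := by
  rcases List.mem_cons.1 hz with rfl | hz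
  · exact le_rfl
  · exact ((List.pairwise_cons.1 h.sorted).1 z hz).le

theorem Stack.change_bound (h : Stack cA a T m num E xs k) {k' : ℕ}
    (h1 : ∀ z ∈ xs, k' ≤ z.length) (h2 : ∀ z ∈ nodes T, z <+: prevEnc T → k' ≤ z.length →
      k ≤ z.length) : Stack cA a T m num E xs k' :=
  ⟨h.stk, fun z => ⟨fun hz => ⟨((h.mem z).1 hz).1, ((h.mem z).1 hz).2.1, h1 z hz⟩,
    fun ⟨h3, h4, h5⟩ => (h.mem z).2 ⟨h3, h4, h2 z h3 h4 h5⟩⟩, h.sorted, h.nolink⟩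

/-- Compares the symbols number `57` of the new string and of the prev-encoding of the suffix of
length `52`; the register `67` is set to `1` if they are different. -/
def compare : Prog :=
  (setR 60 4 ;; setR 61 57) ;; getChar ;; (setR 65 62 ;; setR 66 63 ;; setR 60 52) ;; getChar ;;
  .ite (.eq 62 65) (.ite (.eq 63 66) (setR 67 2) (setR 67 3)) (setR 67 3)

theorem compare_spec (hcA : Function.Injective cA) (hC : Ctx cA cP a T s) (hU : U <:+ a :: T)
    {j : ℕ} {d d' : A ⊕ ℕ} (hd : (prevEnc (a :: T))[j]? = some d) (hd' : (prevEnc U)[j]? = some d')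
    (h57 : s.reg 57 = j) (h52 : s.reg 52 = U.length) (hX : T.length + 1 ≤ X) :
    wp X W compare (fun s' => s'.mem = s.mem ∧ s'.time ≤ s.time + 22 ∧
      ((d = d' ∧ s'.reg 67 = 0) ∨ (d ≠ d' ∧ s'.reg 67 = 1))) s := by
  refine wp.seq_frame (Q' := fun s' => s'.mem = s.mem ∧ s'.time = s.time + 2 ∧
    s'.reg 60 = (a :: T).length ∧ s'.reg 61 = j) (wp_of_vc (by simp [vc, hC.length, h57])) ?_
  rintro s1 ⟨m1, t1, r60, r61⟩ fr1
  have hC1 := hC.frame fr1 rfl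
  have r52 : s1.reg 52 = U.length := (fr1.reg _ rfl).trans h52
  refine wp.seq_frame (getChar_spec hC1.text List.suffix_rfl hd hC1.zero hC1.one r60 r61
    (by simpa using hX)) ?_
  rintro s2 ⟨m2, t2, rc⟩ fr2
  have hC2 := hC1.frame fr2 rfl
  have r61 : s2.reg 61 = j := (fr2.reg _ rfl).trans r61
  have r52 : s2.reg 52 = U.length := (fr2.reg _ rfl).trans r52
  refine wp.seq_frame (Q' := fun s' => s'.mem = s2.mem ∧ s'.time = s2.time + 3 ∧
    s'.reg 60 = U.length ∧ s'.reg 65 = s2.reg 62 ∧ s'.reg 66 = s2.reg 63)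
    (wp_of_vc (by simp [vc, r52])) ?_
  rintro s3 ⟨m3, t3, r60, r65, r66⟩ fr3
  have hC3 := hC2.frame fr3 rfl
  have r61 : s3.reg 61 = j := (fr3.reg _ rfl).trans r61
  refine wp.seq_frame (getChar_spec hC3.text hU hd' hC3.zero hC3.one r60 r61
    (by simpa using hX)) ?_
  rintro s4 ⟨m4, t4, rc'⟩ fr4
  have hC4 := hC3.frame fr4 rfl
  have r65 : s4.reg 65 = s2.reg 62 := (fr4.reg _ rfl).trans r65
  have r66 : s4.reg 66 = s2.reg 63 := (fr4.reg _ rfl).trans r66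
  have hm : s4.mem = s.mem := by rw [m4, m3, m2, m1]
  have hdd : d = d' ↔ s4.reg 62 = s2.reg 62 ∧ s4.reg 63 = s2.reg 63 := by
    rw [← Prod.mk.injEq, rc, rc', (symCode_injective hcA).eq_iff, eq_comm]
  apply wp_of_vc
  by_cases h1 : s4.reg 62 = s2.reg 62 <;> by_cases h2 : s4.reg 63 = s2.reg 63 <;>
    simp [vc, hdd, r65, r66, h1, h2, hm, hC4.zero, hC4.one] <;> omega

/-- `q` is the length of `w` or the place of a mismatch. -/
def Good (F w : List (A ⊕ ℕ)) (q : ℕ) : Prop := q = w.length ∨ (q < w.length ∧ F[q]? ≠ w[q]?)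

omit [DecidableEq A] in
theorem Good.le {F w : List (A ⊕ ℕ)} {q : ℕ} (h : Good F w q) : q ≤ w.length := by
  rcases h with h | h <;> omega

/-- Replaces the register `51` by the register `57` if that is smaller and if there is a mismatch
there. -/
def tryPos : Prog :=
  .ite (.lt 2 57) (.ite (.lt 57 51) (compare ;; .ite (.eq 67 3) (setR 51 57) .skip) .skip) .skip

theorem compare_prefix (hcA : Function.Injective cA) (hC : Ctx cA cP a T s) (hU : U <:+ a :: T)
    (hw : w <+: prevEnc U) {j : ℕ} (hj : j < w.length) (hwT : w.length ≤ T.length)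
    (h57 : s.reg 57 = j) (h52 : s.reg 52 = U.length) (hX : T.length + 1 ≤ X) :
    wp X W compare (fun s' => s'.mem = s.mem ∧ s'.time ≤ s.time + 22 ∧
      (((prevEnc (a :: T))[j]? = w[j]? ∧ s'.reg 67 = 0) ∨
        ((prevEnc (a :: T))[j]? ≠ w[j]? ∧ s'.reg 67 = 1))) s := by
  have hF : j < (prevEnc (a :: T)).length := by rw [length_prevEnc, List.length_cons]; omega
  have hB : j < (prevEnc U).length := lt_of_lt_of_le hj hw.length_le
  have hd := List.getElem?_eq_getElem hF
  have hd' := List.getElem?_eq_getElem hB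
  refine (compare_spec hcA hC hU hd hd' h57 h52 hX).mono ?_
  rintro s' ⟨h1, h2, h3⟩
  refine ⟨h1, h2, ?_⟩
  rw [prefix_getElem? hw hj, hd, hd', Option.some.injEq, ne_eq, Option.some.injEq]
  exact h3

/-- The position 0 is never tested, since a distance 0 means that there is no next occurrence. The
register 51 only decreases, so agreement below it is not lost by later tests. -/
theorem tryPos_spec (hcA : Function.Injective cA) (hC : Ctx cA cP a T s) (hU : U <:+ a :: T)
    (hw : w <+: prevEnc U) (hwT : w.length ≤ T.length)
    (h52 : s.reg 52 = U.length) (hX : T.length + 1 ≤ X) (hg : Good (prevEnc (a :: T)) w (s.reg 51)) :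
    wp X W tryPos (fun s' => s'.mem = s.mem ∧ s'.time ≤ s.time + 26 ∧ s'.reg 51 ≤ s.reg 51 ∧
      Good (prevEnc (a :: T)) w (s'.reg 51) ∧ (0 < s.reg 57 → s.reg 57 < s'.reg 51 →
        (prevEnc (a :: T))[s.reg 57]? = w[s.reg 57]?)) s := by
  refine wp_ite (fun h => wp_ite (fun h' => ?_) fun h' => ?_) fun h => ?_
  · simp only [Test.holds, State.tick_reg] at h h'
    have hle := hg.le
    have hj : s.reg 57 < w.length := by omega
    refine wp.seq_frame (compare_prefix (s := s.tick.tick) hcA hC.tick.tick hU hw hj hwT rfl h52 hX)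
      ?_
    rintro s1 ⟨m1, t1, h1⟩ fr
    have hC1 := hC.tick.tick.frame fr rfl
    have r57 : s1.reg 57 = s.reg 57 := fr.reg _ rfl
    have r51 : s1.reg 51 = s.reg 51 := fr.reg _ rfl
    rw [State.tick_mem, State.tick_mem] at m1
    rw [State.tick_time, State.tick_time] at t1
    apply wp_of_vc
    rcases h1 with ⟨h1, h67⟩ | ⟨h1, h67⟩
    · simp [vc, hC1.one, h67, m1, r51]
      exact ⟨by omega, hg, fun _ _ => h1⟩
    · simp [vc, hC1.one, h67, m1, r57]
      exact ⟨by omega, by omega, .inr ⟨hj, h1⟩⟩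
  · simp only [Test.holds, State.tick_reg] at h h'
    apply wp_of_vc
    simp only [vc, State.tick_mem, State.tick_time, State.tick_reg, true_and]
    exact ⟨by omega, le_rfl, hg, fun _ h2 => absurd h2 h'⟩
  · simp only [Test.holds, hC.zero] at h
    apply wp_of_vc
    simp only [vc, State.tick_mem, State.tick_time, State.tick_reg, true_and]
    exact ⟨by omega, le_rfl, hg, fun h1 _ => absurd h1 h⟩

/-- Compares the symbols that belong to the top of the stack, and removes it from the stack if they
agree. -/
def popStep : Prog :=
  (subR 57 45 3 ;; ldR 44 stkArr 57 ;; ldR 57 lenArr 44 ;; addR 57 57 3) ;;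
  .ite (.lt 57 53) (compare ;; .ite (.eq 67 3) (setR 51 57 ;; setR 54 2) (subR 45 45 3))
    (setR 54 2)

/-- Treats the nodes on the stack whose length is less than `53`. -/
def popLoop : Prog := (setR 51 53 ;; setR 54 3) ;; .loop (.eq 54 3) popStep

/-- The result of `popLoop`, for the node `w` and the stack `ys`. -/
structure Popped (cA : A → ℕ) (a : A ⊕ P) (T : List (A ⊕ P)) (num : List (A ⊕ ℕ) → ℕ)
    (E : Entries) (w : List (A ⊕ ℕ)) (k : ℕ) (ys : List (List (A ⊕ ℕ))) (s : State) : Prop where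
  reg_sp : s.reg 45 = ys.length
  good : Good (prevEnc (a :: T)) w (s.reg 51)
  agree : ∀ x ∈ nodes T, x <+: prevEnc T → k ≤ x.length → x.length + 1 < s.reg 51 →
    (prevEnc (a :: T))[x.length + 1]? = w[x.length + 1]?
  top : s.reg 51 = w.length → ∃ x zs, ys = x :: zs ∧ s.reg 44 = num x ∧ s.reg 57 = x.length + 1 ∧
    w.length ≤ x.length + 1 ∧ Stack cA a T s.mem num E ys (w.length - 1)

theorem popStep_spec (hcA : Function.Injective cA) (hC : Ctx cA cP a T s)
    (hT : Tree cA s.mem T (nodes T) num c f E) (hU : U <:+ a :: T)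
    (hw : w <+: prevEnc U) (hw0 : w ≠ []) (hwT : w.length ≤ T.length) (h52 : s.reg 52 = U.length)
    (h53 : s.reg 53 = w.length) (h45 : s.reg 45 = xs.length) (h51 : s.reg 51 = w.length)
    {k' : ℕ} (hS : Stack cA a T s.mem num E xs k') (hk : k ≤ k') (hkw : k' ≤ w.length - 1)
    (hag : ∀ x ∈ nodes T, x <+: prevEnc T → k ≤ x.length → x.length < k' →
      (prevEnc (a :: T))[x.length + 1]? = w[x.length + 1]?)
    (h54 : s.reg 54 = 1) (hc : c < X) (hX : T.length + 2 < X) (hXW : X ≤ W) :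
    wp X W popStep (fun s' => s'.mem = s.mem ∧ s'.time ≤ s.time + 31 ∧
      ((s'.reg 54 = 0 ∧ Popped cA a T num E w k xs s') ∨
        (s'.reg 54 = 1 ∧ s'.reg 51 = w.length ∧ ∃ x zs, xs = x :: zs ∧ s'.reg 45 = zs.length ∧
          Stack cA a T s.mem num E zs (x.length + 1) ∧ k ≤ x.length + 1 ∧
          x.length + 1 ≤ w.length - 1 ∧
          ∀ z ∈ nodes T, z <+: prevEnc T → k ≤ z.length → z.length < x.length + 1 →
            (prevEnc (a :: T))[z.length + 1]? = w[z.length + 1]?))) s := by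
  have hw1 : 0 < w.length := List.length_pos_iff.2 hw0
  have hlen := hS.length_le (by omega)
  -- The stack cannot be empty: the leaf `prevEnc T` is at its bottom and has length at least
  -- `w.length`.
  obtain ⟨x, zs, rfl⟩ : ∃ x zs, xs = x :: zs := by
    have : prevEnc T ∈ xs := (hS.mem _).2 ⟨isNode_prevEnc List.suffix_rfl, List.prefix_rfl, by
      rw [length_prevEnc]; omega⟩
    cases xs with
    | nil => simp at this
    | cons x zs => exact ⟨x, zs, rfl⟩
  obtain ⟨hx, hxT, hkx⟩ := (hS.mem x).1 List.mem_cons_self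
  have hxl := hxT.length_le
  rw [length_prevEnc] at hxl
  have hlx := hT.len x hx
  have hstk := hS.stk.1
  rw [lenArr] at hlx
  rw [stkArr] at hstk
  have hr := hT.range x hx
  rw [List.length_cons] at h45 hlen
  have hag' : ∀ z ∈ nodes T, z <+: prevEnc T → k ≤ z.length → z.length < x.length →
      (prevEnc (a :: T))[z.length + 1]? = w[z.length + 1]? := by
    intro z hz hzT hkz hzx
    by_cases hzk : z.length < k'
    · exact hag z hz hzT hkz hzk
    · have := hS.head_le ((hS.mem z).2 ⟨hz, hzT, by omega⟩)
      omega
  refine wp.seq_frame (Q' := fun s' => s'.mem = s.mem ∧ s'.time = s.time + 4 ∧ s'.reg 44 = num x ∧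
    s'.reg 57 = x.length + 1) (wp_of_vc ?_) ?_
  · simp [vc, h45, hC.one, hstk, hlx]
    omega
  rintro s1 ⟨m1, t1, r44, r57⟩ fr1
  have hC1 := hC.frame fr1 rfl
  have r52 : s1.reg 52 = U.length := (fr1.reg _ rfl).trans h52
  have r53 : s1.reg 53 = w.length := (fr1.reg _ rfl).trans h53
  have r51 : s1.reg 51 = w.length := (fr1.reg _ rfl).trans h51
  have r45 : s1.reg 45 = zs.length + 1 := (fr1.reg _ rfl).trans h45
  have r54 : s1.reg 54 = 1 := (fr1.reg _ rfl).trans h54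
  refine wp_ite (fun h => ?_) fun h => ?_
  · rw [Test.holds, r57, r53] at h
    refine wp.seq_frame (compare_prefix (s := s1.tick) hcA hC1.tick hU hw h hwT r57 r52
      (by omega)) ?_
    rintro s2 ⟨m2, t2, h2⟩ fr2
    have hC2 := hC1.tick.frame fr2 rfl
    have g51 : s2.reg 51 = w.length := (fr2.reg _ rfl).trans r51
    have g57 : s2.reg 57 = x.length + 1 := (fr2.reg _ rfl).trans r57
    have g45 : s2.reg 45 = zs.length + 1 := (fr2.reg _ rfl).trans r45
    have g54 : s2.reg 54 = 1 := (fr2.reg _ rfl).trans r54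
    rw [State.tick_mem, m1] at m2
    rw [State.tick_time] at t2
    rcases h2 with ⟨h2, r67⟩ | ⟨h2, r67⟩
    · refine wp.mono (Q := fun s' => s'.mem = s.mem ∧ s'.time = s2.time + 2 ∧ s'.reg 54 = 1 ∧
        s'.reg 51 = w.length ∧ s'.reg 45 = zs.length) (wp_of_vc ?_) ?_
      · simp [vc, hC2.one, r67, g45, m2, g54, g51]
      · rintro s' ⟨q1, q2, q3, q4, q5⟩
        refine ⟨q1, by omega, .inr ⟨q3, q4, x, zs, rfl, q5, hS.pop, by omega, by omega,
          fun z hz hzT hkz hzx => ?_⟩⟩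
        by_cases hzx' : z.length = x.length
        · rw [hzx', h2]
        · exact hag' z hz hzT hkz (by omega)
    · refine wp.mono (Q := fun s' => s'.mem = s.mem ∧ s'.time = s2.time + 3 ∧ s'.reg 54 = 0 ∧
        s'.reg 51 = x.length + 1 ∧ s'.reg 45 = zs.length + 1) (wp_of_vc ?_) ?_
      · simp [vc, hC2.one, hC2.zero, r67, g45, m2, g57]
      · rintro s' ⟨q1, q2, q3, q4, q5⟩
        refine ⟨q1, by omega, .inl ⟨q3, q5, .inr (q4 ▸ ⟨h, h2⟩), fun z hz hzT hkz hzx => ?_,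
          fun h' => ?_⟩⟩
        · exact hag' z hz hzT hkz (by omega)
        · omega
  · rw [Test.holds, r57, r53] at h
    refine wp.mono (Q := fun s' => s'.mem = s.mem ∧ s'.time = s1.time + 2 ∧ s'.reg 54 = 0 ∧
        s'.reg 51 = w.length ∧ s'.reg 45 = zs.length + 1 ∧ s'.reg 44 = num x ∧
        s'.reg 57 = x.length + 1) (wp_of_vc ?_) ?_
    · simp [vc, hC1.zero, r45, m1, r57, r51, r44]
    · rintro s' ⟨q1, q2, q3, q4, q5, q6, q7⟩
      refine ⟨q1, by omega, .inl ⟨q3, q5, .inl q4, fun z hz hzT hkz hzx => ?_,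
        fun _ => ⟨x, zs, rfl, q6, q7, by omega, ?_⟩⟩⟩
      · exact hag' z hz hzT hkz (by omega)
      · rw [q1]
        refine hS.change_bound (fun z hz => ?_) fun z hz _ hzw => by omega
        have := hS.head_le hz
        omega

/-- A node is popped when the strings agree at the place that belongs to it. It is not needed again,
so its removal is paid by the 32 steps credited when it was pushed. The first disagreement, or the
first stacked node too long to matter, ends the loop. -/
theorem popLoop_spec (hcA : Function.Injective cA) (hC : Ctx cA cP a T s)
    (hT : Tree cA s.mem T (nodes T) num c f E) (hU : U <:+ a :: T)
    (hw : w <+: prevEnc U) (hw0 : w ≠ []) (hwT : w.length ≤ T.length) (h52 : s.reg 52 = U.length)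
    (h53 : s.reg 53 = w.length) (h45 : s.reg 45 = xs.length)
    (hS : Stack cA a T s.mem num E xs k) (hkw : k ≤ w.length - 1)
    (hc : c < X) (hX : T.length + 2 < X) (hXW : X ≤ W) :
    wp X W popLoop (fun s' => s'.mem = s.mem ∧ ∃ ys, Popped cA a T num E w k ys s' ∧
      s'.time + 32 * ys.length ≤ s.time + 32 * xs.length + 40) s := by
  refine wp.seq_frame (Q' := fun s' => s'.mem = s.mem ∧ s'.time = s.time + 2 ∧
    s'.reg 51 = w.length ∧ s'.reg 54 = 1) (wp_of_vc (by simp [vc, h53, hC.one])) ?_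
  rintro s1 ⟨m1, t1, r51, r54⟩ fr1
  have hC1 := hC.frame fr1 rfl
  have r52 : s1.reg 52 = U.length := (fr1.reg _ rfl).trans h52
  have r53 : s1.reg 53 = w.length := (fr1.reg _ rfl).trans h53
  have r45 : s1.reg 45 = xs.length := (fr1.reg _ rfl).trans h45
  refine wp_loop (fun n s' => Ctx cA cP a T s' ∧ s'.mem = s.mem ∧ s'.reg 52 = U.length ∧
    s'.reg 53 = w.length ∧
    ((n = 0 ∧ s'.reg 54 = 0 ∧ ∃ ys, Popped cA a T num E w k ys s' ∧
      s'.time + 32 * ys.length ≤ s.time + 32 * xs.length + 34) ∨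
     (s'.reg 54 = 1 ∧ s'.reg 51 = w.length ∧ ∃ ys k', n = ys.length + 1 ∧ s'.reg 45 = ys.length ∧
      Stack cA a T s'.mem num E ys k' ∧ k ≤ k' ∧ k' ≤ w.length - 1 ∧
      s'.time + 32 * ys.length ≤ s.time + 32 * xs.length + 2 ∧
      ∀ z ∈ nodes T, z <+: prevEnc T → k ≤ z.length → z.length < k' →
        (prevEnc (a :: T))[z.length + 1]? = w[z.length + 1]?))) ?_ ?_ (xs.length + 1) s1 ?_
  · rintro n s' ⟨hC', hm, g52, g53, h⟩ ht
    rw [Test.holds, hC'.one] at ht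
    obtain ⟨-, g51, ys, k', rfl, g45, hS', hk', hkw', htm, hag⟩ := h.resolve_left fun h => by
      omega
    refine (popStep_spec (s := s'.tick) hcA hC'.tick (by rw [State.tick_mem, hm]; exact hT) hU hw
      hw0 hwT g52 g53 g45 g51 hS' hk' hkw' hag ht hc hX hXW).frame.mono ?_
    rintro s'' ⟨⟨m2, t2, h⟩, fr⟩
    have hC2 := hC'.tick.frame fr rfl
    rw [State.tick_mem] at m2 h
    rw [State.tick_time] at t2
    have q52 : s''.reg 52 = U.length := (fr.reg _ rfl).trans g52
    have q53 : s''.reg 53 = w.length := (fr.reg _ rfl).trans g53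
    rcases h with ⟨h54, hp⟩ | ⟨h54, h51, x, zs, rfl, h45', hS'', hkx, hxw, hag'⟩
    · exact ⟨0, by omega, hC2, m2.trans hm, q52, q53, .inl ⟨rfl, h54, ys, hp, by omega⟩⟩
    · refine ⟨zs.length + 1, by simp, hC2, m2.trans hm, q52, q53, .inr ⟨h54, h51, zs,
        x.length + 1, rfl, h45', by rwa [m2], hkx, hxw, ?_, hag'⟩⟩
      rw [List.length_cons] at htm
      omega
  · rintro n s' ⟨hC', hm, g52, g53, h⟩ ht
    rw [Test.holds, hC'.one] at ht
    obtain ⟨-, -, ys, hp, htm⟩ := h.resolve_right fun h => ht h.1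
    exact ⟨hm, ys, ⟨hp.reg_sp, hp.good, hp.agree, hp.top⟩, by rw [State.tick_time]; omega⟩
  · refine ⟨hC1, m1, r52, r53, .inr ⟨r54, r51, xs, k, rfl, r45, by rwa [m1], le_rfl, hkw, by omega,
      fun z _ _ h1 h2 => by omega⟩⟩

/-- Computes the length of the longest common prefix of the new string and the node `50`. -/
def findSplit : Prog :=
  popLoop ;; (setR 55 57 ;; setR 57 40) ;; tryPos ;; (subR 57 52 3 ;; ldR 57 nxtArr 57) ;; tryPos

/-- The places belonging to stacked nodes are tested first and then the next occurrences of the two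
first symbols; by `take_eq_of_candidates` no other place can be the first mismatch. If none is
found, the top of the stack tells whether the tail of `w` is a node. -/
theorem findSplit_spec (hcA : Function.Injective cA) (hC : Ctx cA cP a T s)
    (hT : Tree cA s.mem T (nodes T) num c f E) (hU : U <:+ T)
    (hw : w <+: prevEnc U) (hwT : w.length ≤ T.length) (h52 : s.reg 52 = U.length)
    (h53 : s.reg 53 = w.length) (h45 : s.reg 45 = xs.length)
    (hS : Stack cA a T s.mem num E xs k) (hkw : k < w.length)
    (hkF : (prevEnc (a :: T)).take (k + 1) = w.take (k + 1))
    (hc : c < X) (hX : T.length + 2 < X) (hXW : X ≤ W) :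
    wp X W findSplit (fun s' => s'.mem = s.mem ∧ Good (prevEnc (a :: T)) w (s'.reg 51) ∧
      (prevEnc (a :: T)).take (s'.reg 51) = w.take (s'.reg 51) ∧
      ∃ ys, s'.time + 32 * ys.length ≤ s.time + 32 * xs.length + 96 ∧ s'.reg 45 = ys.length ∧
        (s'.reg 51 = w.length → ∃ x zs, ys = x :: zs ∧ s'.reg 44 = num x ∧
          s'.reg 55 = x.length + 1 ∧ w.length ≤ x.length + 1 ∧
          Stack cA a T s.mem num E ys (w.length - 1))) s := by
  have hw0 : w ≠ [] := by rintro rfl; simp at hkw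
  have hU' := hU.trans (List.suffix_cons a T)
  obtain ⟨b, V, rfl⟩ : ∃ b V, U = b :: V := by
    cases U with
    | nil => exact absurd (List.prefix_nil.1 hw) hw0
    | cons b V => exact ⟨b, V, rfl⟩
  have hVl := hU.length_le
  rw [List.length_cons] at hVl
  refine wp.seq_frame (popLoop_spec hcA hC hT hU' hw hw0 hwT h52 h53 h45 hS (by omega) hc hX hXW) ?_
  rintro s1 ⟨m1, ys, hp, t1⟩ fr1
  have hC1 := hC.frame fr1 rfl
  have r52 : s1.reg 52 = (b :: V).length := (fr1.reg _ rfl).trans h52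
  refine wp.seq_frame (Q' := fun s' => s'.mem = s.mem ∧ s'.time = s1.time + 2 ∧
    s'.reg 55 = s1.reg 57 ∧ s'.reg 57 = nxt a T) (wp_of_vc (by simp [vc, hC1.nxt, m1])) ?_
  rintro s2 ⟨m2, t2, r55, r57⟩ fr2
  have hC2 := hC1.frame fr2 rfl
  have r52 : s2.reg 52 = (b :: V).length := (fr2.reg _ rfl).trans r52
  have r51 : s2.reg 51 = s1.reg 51 := fr2.reg _ rfl
  refine wp.seq_frame (tryPos_spec hcA hC2 hU' hw hwT r52 (by omega) (by rw [r51]; exact hp.good)) ?_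
  rintro s3 ⟨m3, t3, le3, hg3, h3⟩ fr3
  have hC3 := hC2.frame fr3 rfl
  have r52 : s3.reg 52 = (b :: V).length := (fr3.reg _ rfl).trans r52
  have r55 : s3.reg 55 = s1.reg 57 := (fr3.reg _ rfl).trans r55
  have hnx := hC3.text.next b V hU'
  rw [nxtArr] at hnx
  refine wp.seq_frame (Q' := fun s' => s'.mem = s.mem ∧ s'.time = s3.time + 2 ∧
    s'.reg 57 = nxt b V) (wp_of_vc (by
      rw [List.length_cons] at r52
      simp [vc, hC3.one, r52, hnx, m3, m2]; omega)) ?_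
  rintro s4 ⟨m4, t4, r57'⟩ fr4
  have hC4 := hC3.frame fr4 rfl
  have r52 : s4.reg 52 = (b :: V).length := (fr4.reg _ rfl).trans r52
  have r51' : s4.reg 51 = s3.reg 51 := fr4.reg _ rfl
  have r55 : s4.reg 55 = s1.reg 57 := (fr4.reg _ rfl).trans r55
  have r44 : s4.reg 44 = s1.reg 44 :=
    (fr4.reg _ rfl).trans ((fr3.reg _ rfl).trans (fr2.reg _ rfl))
  have r45 : s4.reg 45 = s1.reg 45 :=
    (fr4.reg _ rfl).trans ((fr3.reg _ rfl).trans (fr2.reg _ rfl))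
  refine (tryPos_spec hcA hC4 hU' hw hwT r52 (by omega)
    (by rw [r51']; exact hg3)).frame.mono ?_
  rintro s5 ⟨⟨m5, t5, le5, hg5, h5⟩, fr5⟩
  have r55 : s5.reg 55 = s1.reg 57 := (fr5.reg _ rfl).trans r55
  have r44 : s5.reg 44 = s1.reg 44 := (fr5.reg _ rfl).trans r44
  have r45 : s5.reg 45 = s1.reg 45 := (fr5.reg _ rfl).trans r45
  rw [r57] at h3
  rw [r57'] at h5
  -- If a parameter does not recur, its candidate is the place 0, where agreement is already known.
  have h00 : (prevEnc (a :: T))[0]? = w[0]? := take_getElem? hkF (by omega)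
  refine ⟨m5.trans m4, hg5, ?_, ys, by omega, r45.trans hp.reg_sp, fun h51 => ?_⟩
  · refine take_eq_of_candidates hU hw hkF (by omega) hg5.le (fun x hx hxT h1 h2 => ?_)
      (fun h => ?_) fun h => ?_
    · exact hp.agree x hx hxT (by omega) (by omega)
    · rcases Nat.eq_zero_or_pos (nxt a T) with e | e
      · rwa [e]
      · exact h3 e (by omega)
    · rcases Nat.eq_zero_or_pos (nxt b V) with e | e
      · rwa [e]
      · exact h5 e h
  · have hle := hp.good.le
    obtain ⟨x, zs, h1, h2, h3, h4, h5⟩ := hp.top (by omega)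
    exact ⟨x, zs, h1, r44.trans h2, r55.trans h3, h4, m1 ▸ h5⟩

end Mismatch

/-! ## The descent to the longest old prefix of the new string -/

section Descent

variable {A P : Type*} [DecidableEq A] [DecidableEq P]
variable {X W : ℕ} {s s' : State} {cA : A → ℕ} {cP : P → ℕ} {T U : List (A ⊕ P)} {a b : A ⊕ P}
variable {m m' : ℕ → ℕ → ℕ} {N : Set (List (A ⊕ ℕ))} {num : List (A ⊕ ℕ) → ℕ} {c f k : ℕ}
variable {E : Entries} {x v w : List (A ⊕ ℕ)} {xs : List (List (A ⊕ ℕ))}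

theorem snoc_prefix_of_getElem? {α : Type*} {v y : List α} {d : α} (h : v <+: y)
    (hd : y[v.length]? = some d) : v ++ [d] <+: y := by
  rw [prefix_take_iff] at h ⊢
  rw [List.length_append, List.length_singleton, List.take_add_one, ← h, hd]
  rfl

/-- Inserts a link from the node `44` to the node `50`, and removes the top of the stack. -/
def addLink : Prog :=
  linkQuery ;; setR 13 50 ;; dictInsert (dArr false) ;; subR 45 45 3

theorem addLink_spec [Fintype A] [Fintype P] (hC : Ctx cA cP a T s)
    (hT : Tree cA s.mem T (nodes T) num c f E) (hx : x ∈ nodes T) (hxT : x <+: prevEnc T)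
    (h7 : s.reg 7 = f) (h44 : s.reg 44 = num x) (h50 : s.reg 50 = num w) (hw : w ∈ nodes T)
    (hwF : w = (prevEnc (a :: T)).take (x.length + 1))
    (hno : ∀ t, ¬ E false (num x) (symCode cA id (linkKey a T x.length)) t)
    (hc : 2 * c < X) (hXW : X ≤ W) :
    wp X W addLink (fun s' =>
      s'.time ≤ s.time + 86 * htBound (Fintype.card A + Fintype.card P + 1) + 22 ∧
      s'.reg 7 = f + 1 ∧ s'.reg 45 = s.reg 45 - 1 ∧
      Tree cA s'.mem T (nodes T) num c (f + 1)
        (E.insert false (num x) (symCode cA id (linkKey a T x.length)) (num w))) s := by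
  have hf := hT.free_le
  have hr := hT.range x hx
  have hxl := hxT.length_le
  rw [length_prevEnc] at hxl
  refine wp.seq_frame (linkQuery_spec hC hT hx h44 (by omega)) ?_
  rintro s1 ⟨m1, t1, r10, r11⟩ fr1
  obtain ⟨r11, r12⟩ := Prod.mk.inj r11
  have hC1 := hC.frame fr1 rfl
  have r7 : s1.reg 7 = f := (fr1.reg _ rfl).trans h7
  have r50 : s1.reg 50 = num w := (fr1.reg _ rfl).trans h50
  refine wp.seq_frame (Q' := fun s' => s'.mem = s.mem ∧ s'.time = s1.time + 1 ∧ s'.reg 13 = num w)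
    (wp_of_vc (by simp [vc, r50, m1])) ?_
  rintro s2 ⟨m2, t2, r13⟩ fr2
  have hC2 := hC1.frame fr2 rfl
  refine wp.seq_frame (Dict.insert_spec (b := false) (E := E) (i := num x) (f := f) (t := num w)
    (k := symCode cA id (linkKey a T x.length)) (m2 ▸ hT.dict) (hT.small_false hx hxT) hC2.zero
    hC2.one ((fr2.reg _ rfl).trans r7) ((fr2.reg _ rfl).trans r10) (by omega)
    ((fr2.reg _ rfl).trans r11) ((fr2.reg _ rfl).trans r12) r13 (by omega) hXW hno) ?_
  rintro s3 ⟨t3, r7', hd⟩ fr3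
  have hC3 := hC2.frame fr3 rfl
  have r45 : s3.reg 45 = s.reg 45 :=
    (fr3.reg _ rfl).trans ((fr2.reg _ rfl).trans (fr1.reg _ rfl))
  have hT3 := hT.insert_link (m' := s3.mem) hx hw ⟨a, T, x.length, hxl, prefix_take_iff.1 hxT, hwF, rfl⟩ hno
    (fun j h1 h2 => by
      rw [← m2]
      refine fr3.mem j ?_
      interval_cases j <;> rfl) hd
  refine wp.mono (Q := fun s' => s'.mem = s3.mem ∧ s'.time = s3.time + 1 ∧
    s'.reg 7 = s3.reg 7 ∧ s'.reg 45 = s.reg 45 - 1) (wp_of_vc (by simp [vc, hC3.one, r45])) ?_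
  rintro s4 ⟨m4, t4, r7, r45⟩
  exact ⟨by omega, by omega, r45, by rw [m4]; exact hT3⟩

/-- The state during the descent, at the node `v`. -/
structure Descent (cA : A → ℕ) (cP : P → ℕ) (a : A ⊕ P) (T : List (A ⊕ P))
    (num : List (A ⊕ ℕ) → ℕ) (c f : ℕ) (E : Entries) (v : List (A ⊕ ℕ)) (s : State) : Prop where
  ctx : Ctx cA cP a T s
  tree : Tree cA s.mem T (nodes T) num c f E
  free : s.reg 7 = f
  mem : v ∈ nodes T
  pre : v <+: prevEnc (a :: T)
  reg_v : s.reg 46 = num v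

/-- The descent has ended at a node. -/
def NoChild (cA : A → ℕ) (a : A ⊕ P) (T : List (A ⊕ P)) (num : List (A ⊕ ℕ) → ℕ) (E : Entries)
    (v : List (A ⊕ ℕ)) : Prop :=
  ∀ d, (prevEnc (a :: T))[v.length]? = some d → ∀ t, ¬ E true (num v) (symCode cA id d) t

/-- The descent has ended within the edge from `v` to `w`. -/
structure WithinEdge (X : ℕ) (cA : A → ℕ) (a : A ⊕ P) (T : List (A ⊕ P))
    (num : List (A ⊕ ℕ) → ℕ) (f : ℕ) (E : Entries) (v w : List (A ⊕ ℕ)) (d : A ⊕ ℕ) (s : State) :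
    Prop where
  cov : Cov (nodes T) v w
  sym : v ++ [d] <+: w
  gt : v.length < s.reg 51
  lt : s.reg 51 < w.length
  take : (prevEnc (a :: T)).take (s.reg 51) = w.take (s.reg 51)
  ne : (prevEnc (a :: T))[s.reg 51]? ≠ w[s.reg 51]?
  reg_w : s.reg 50 = num w
  reg_pos : s.reg 52 = s.mem posArr (num w)
  cell_lt : s.reg 56 < X
  dict : ∀ t, Dict (Function.update s.mem targetArr
    (Function.update (s.mem targetArr) (s.reg 56) t)) f (E.retarget true (num v) (symCode cA id d) t)

/-- Moves to the child `50` if the new string extends it. -/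
def enterEdge : Prog :=
  (setR 56 14 ;; ldR 50 targetArr 14 ;; ldR 53 lenArr 50 ;; ldR 52 posArr 50) ;; findSplit ;;
  .ite (.eq 51 53) (.ite (.eq 55 53) addLink .skip ;; setR 46 50) (addR 49 3 3)

/-- One step of the descent. -/
def descendStep : Prog :=
  (ldR 61 lenArr 46 ;; setR 60 4) ;; getChar ;; (setR 10 46 ;; setR 11 62 ;; setR 12 63) ;;
  lookup (dArr true) ;; .ite (.eq 14 2) (setR 49 3) enterEdge

/-- The descent; the register `49` tells where it ends. -/
def descend : Prog := setR 49 2 ;; .loop (.eq 49 2) descendStep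

/-- The last inequality of the first alternative measures progress: traversing an edge either
inserts a link, which raises the counter of cells, or passes a zero of `prevEnc T`. -/
theorem enterEdge_spec [Fintype A] [Fintype P] (hcA : Function.Injective cA)
    (hD : Descent cA cP a T num c f E v s) {d : A ⊕ ℕ}
    (hcov : Cov (nodes T) v w) (hd : v ++ [d] <+: w) (hdF : v ++ [d] <+: prevEnc (a :: T))
    (h14 : s.reg 14 < X) (htgt : s.mem targetArr (s.reg 14) = num w)
    (hdict : ∀ t, Dict (Function.update s.mem targetArr
      (Function.update (s.mem targetArr) (s.reg 14) t)) f
        (E.retarget true (num v) (symCode cA id d) t))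
    (h45 : s.reg 45 = xs.length) (h49 : s.reg 49 = 0)
    (hS : Stack cA a T s.mem num E xs v.length)
    (hc : 2 * c < X) (hX : T.length + 2 < X) (hXW : X ≤ W) :
    wp X W enterEdge (fun s' => ∃ ys, s'.time + 32 * ys.length ≤ s.time + 32 * xs.length +
        (86 * htBound (Fintype.card A + Fintype.card P + 1) + 126) ∧
      ((s'.reg 49 = 0 ∧ s'.reg 45 = ys.length ∧ ∃ E' f', Descent cA cP a T num c f' E' w s' ∧
        Stack cA a T s'.mem num E' ys w.length ∧
        f + zeros (prevEnc T) v.length + 1 ≤ f' + zeros (prevEnc T) w.length) ∨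
      (s'.reg 49 = 2 ∧ Descent cA cP a T num c f E v s' ∧
        WithinEdge X cA a T num f E v w d s'))) s := by
  have hC := hD.ctx
  have hwN := hcov.2.1
  obtain ⟨U, hU, hUp, hwU⟩ := hD.tree.pos w hwN
  have hr := hD.tree.range w hwN
  have hlw := hD.tree.len w hwN
  have hwT := (IsNode.isTrie hwN).length_le
  have hvw := hd.length_le
  rw [List.length_append, List.length_singleton] at hvw
  rw [lenArr] at hlw
  rw [posArr] at hUp
  rw [targetArr] at htgt
  refine wp.seq_frame (Q' := fun s' => s'.mem = s.mem ∧ s'.time = s.time + 4 ∧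
    s'.reg 56 = s.reg 14 ∧ s'.reg 50 = num w ∧ s'.reg 53 = w.length ∧ s'.reg 52 = U.length)
    (wp_of_vc ?_) ?_
  · simp [vc, htgt, hlw, hUp]
    omega
  rintro s1 ⟨m1, t1, r56, r50, r53, r52⟩ fr1
  have hC1 := hC.frame fr1 rfl
  have r45 : s1.reg 45 = xs.length := (fr1.reg _ rfl).trans h45
  have hkF : (prevEnc (a :: T)).take (v.length + 1) = w.take (v.length + 1) := by
    have h1 := prefix_take_iff.1 hdF
    have h2 := prefix_take_iff.1 hd
    rw [List.length_append, List.length_singleton] at h1 h2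
    rw [← h1, ← h2]
  refine wp.seq_frame (findSplit_spec (k := v.length) hcA hC1 (m1 ▸ hD.tree) hU hwU hwT r52 r53 r45
    (m1 ▸ hS) (by omega) hkF (by omega) hX hXW) ?_
  rintro s2 ⟨m2, hg, htk, ys, t2, r45, htop⟩ fr2
  have hC2 := hC1.frame fr2 rfl
  have m2 : s2.mem = s.mem := m2.trans m1
  have r56 : s2.reg 56 = s.reg 14 := (fr2.reg _ rfl).trans r56
  have r50 : s2.reg 50 = num w := (fr2.reg _ rfl).trans r50
  have r53 : s2.reg 53 = w.length := (fr2.reg _ rfl).trans r53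
  have r52 : s2.reg 52 = U.length := (fr2.reg _ rfl).trans r52
  have r46 : s2.reg 46 = num v := ((fr2.reg _ rfl).trans (fr1.reg _ rfl)).trans hD.reg_v
  have r49 : s2.reg 49 = 0 := ((fr2.reg _ rfl).trans (fr1.reg _ rfl)).trans h49
  have r7 : s2.reg 7 = f := ((fr2.reg _ rfl).trans (fr1.reg _ rfl)).trans hD.free
  refine wp_ite (fun h => ?_) fun h => ?_
  · rw [Test.holds, r53] at h
    obtain ⟨x, zs, rfl, r44, r55, hwx, hS'⟩ := htop h
    rw [m1] at hS'
    obtain ⟨hx, hxT, hxk⟩ := (hS'.mem x).1 List.mem_cons_self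
    have hwF : w = (prevEnc (a :: T)).take w.length := by
      rw [h, List.take_length] at htk
      exact htk.symm
    by_cases hxw : x.length + 1 = w.length
    · refine wp.seq_frame (Q' := fun s' =>
        s'.time ≤ s2.time + 86 * htBound (Fintype.card A + Fintype.card P + 1) + 24 ∧
        s'.reg 7 = f + 1 ∧ s'.reg 45 = s2.reg 45 - 1 ∧ s'.mem stkArr = s.mem stkArr ∧
        s'.reg 50 = num w ∧ s'.reg 49 = 0 ∧ Ctx cA cP a T s' ∧
        Tree cA s'.mem T (nodes T) num c (f + 1)
          (E.insert false (num x) (symCode cA id (linkKey a T x.length)) (num w)))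
        (wp_ite (fun _ => ?_) fun h' => ?_) ?_
      · refine (addLink_spec (s := s2.tick.tick) hC2.tick.tick (by
          rw [State.tick_mem, State.tick_mem, m2]; exact hD.tree) hx hxT r7 r44 r50 hwN (hxw ▸ hwF)
          (hS'.nolink x List.mem_cons_self) hc hXW).frame.mono ?_
        rintro s3 ⟨⟨q1, q2, q3, q4⟩, fr⟩
        refine ⟨q1.trans ?_, q2, q3, (fr.mem _ rfl).trans (by rw [State.tick_mem, State.tick_mem, m2]),
          (fr.reg _ rfl).trans r50, (fr.reg _ rfl).trans r49, hC2.tick.tick.frame fr rfl, q4⟩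
        rw [State.tick_time, State.tick_time]
        omega
      · rw [Test.holds, State.tick_reg, r55, r53] at h'
        exact absurd hxw h'
      · rintro s3 ⟨t3, r7', r45', hstk, r50', r49', hC3, hT3⟩ -
        refine wp.frame (wp_of_vc (Q := fun s' => s'.mem = s3.mem ∧ s'.time = s3.time + 1 ∧
          s'.reg 46 = num w) (by simp [vc, r50'])) |>.mono ?_
        rintro s4 ⟨⟨m4, t4, r46'⟩, fr4⟩
        rw [List.length_cons] at t2 r45
        refine ⟨zs, by omega, .inl ⟨(fr4.reg _ rfl).trans r49', ?_, _, f + 1,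
          ⟨hC3.frame fr4 rfl, m4 ▸ hT3, (fr4.reg _ rfl).trans r7', hwN, ?_, r46'⟩, ?_, ?_⟩⟩
        · rw [fr4.reg _ rfl, r45', r45]
          rfl
        · rw [hwF]; exact List.take_prefix _ _
        · have hp := hS'.pop
          rw [hxw] at hp
          refine ⟨hp.stk.congr fun i _ => by rw [m4, hstk], hp.mem, hp.sorted, fun z hz t => ?_⟩
          rintro (hE | ⟨-, hzx, -⟩)
          · exact hp.nolink z hz t hE
          · have := hD.tree.inj _ ((hp.mem z).1 hz).1 _ hx hzx
            have := ((hp.mem z).1 hz).2.2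
            subst z
            omega
        · have := zeros_mono (prevEnc T) (show v.length ≤ w.length by omega)
          omega
    · refine wp.mono (Q := fun s' => s'.mem = s.mem ∧ s'.time = s2.time + 4 ∧
        s'.reg 46 = num w ∧ ∀ r, r ≠ 46 → s'.reg r = s2.reg r) (wp_of_vc ?_) ?_
      · simp +contextual [vc, r55, r53, hxw, r50, m2]
      · rintro s4 ⟨m4, t4, r46', hr4⟩
        refine ⟨x :: zs, by omega, .inl ⟨(hr4 _ (by omega)).trans r49, (hr4 _ (by omega)).trans r45,
          E, f, ⟨hC2.congr (m4.trans m2.symm) fun r hr => hr4 r (by omega), m4 ▸ hD.tree,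
            (hr4 _ (by omega)).trans r7, hwN, ?_, r46'⟩, ?_, ?_⟩⟩
        · rw [hwF]; exact List.take_prefix _ _
        · rw [m4]
          refine hS'.change_bound (fun z hz => ?_) fun z _ _ hz => by omega
          have := hS'.head_le hz
          omega
        -- Let `ℓ + 1` be the length of `w`. If the tail of `w` were a node it would be on the
        -- stack, and the top, being no longer than it, would have length `ℓ`; this is excluded by
        -- `hxw`. So `isNode_tail` yields a zero at `ℓ`, which lies between the lengths of `v` and
        -- `w`.
        · obtain ⟨ℓ, hℓ⟩ : ∃ ℓ, w.length = ℓ + 1 := ⟨w.length - 1, by omega⟩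
          rw [hℓ] at hwF
          rcases isNode_tail (T := T) (a := a) (ℓ := ℓ) (by omega) (hwF ▸ hwN) with hn | hn
          · have hl : ((prevEnc T).take ℓ).length = ℓ := by
              rw [List.length_take, length_prevEnc]; omega
            have := hS'.head_le ((hS'.mem _).2 ⟨hn, List.take_prefix _ _, by omega⟩)
            omega
          · have := zeros_lt (j := v.length) (k := w.length) (ℓ := ℓ) (by omega) (by omega) hn
            omega
  · rw [Test.holds, r53] at h
    have hne := (hg.resolve_left h)
    refine wp.frame (wp_of_vc (Q := fun s' => s'.mem = s.mem ∧ s'.time = s2.time + 2 ∧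
      s'.reg 49 = 2) ?_) |>.mono ?_
    · simp [vc, hC2.one, m2]
      omega
    rintro s4 ⟨⟨m4, t4, r49'⟩, fr4⟩
    have r51 : s4.reg 51 = s2.reg 51 := fr4.reg _ rfl
    refine ⟨ys, by omega, .inr ⟨r49', ⟨(hC2.tick).frame fr4 rfl, m4 ▸ hD.tree,
      (fr4.reg _ rfl).trans r7, hD.mem, hD.pre, (fr4.reg _ rfl).trans r46⟩, hcov, hd, ?_, ?_, ?_, ?_,
      (fr4.reg _ rfl).trans r50, ?_, ?_, ?_⟩⟩
    -- The first symbol of the label was matched by the lookup, so the mismatch comes after it.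
    · rw [r51]
      by_contra hlt
      exact hne.2 (take_getElem? hkF (by omega))
    · rw [r51]; exact hne.1
    · rw [r51]; exact htk
    · rw [r51]; exact hne.2
    · rw [fr4.reg _ rfl, m4, posArr, ← hUp]; exact r52
    · rw [fr4.reg _ rfl, State.tick_reg, r56]; exact h14
    · rw [fr4.reg _ rfl, State.tick_reg, r56, m4]; exact hdict

theorem descendStep_spec [Fintype A] [Fintype P] (hcA : Function.Injective cA)
    (hD : Descent cA cP a T num c f E v s)
    (h45 : s.reg 45 = xs.length) (h49 : s.reg 49 = 0)
    (hS : Stack cA a T s.mem num E xs v.length)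
    (hc : 2 * c < X) (hX : T.length + 2 < X) (hXW : X ≤ W) :
    wp X W descendStep (fun s' => ∃ ys, s'.time + 32 * ys.length ≤ s.time + 32 * xs.length +
        (94 * htBound (Fintype.card A + Fintype.card P + 1) + 145) ∧
      ((s'.reg 49 = 0 ∧ s'.reg 45 = ys.length ∧ ∃ w E' f', Descent cA cP a T num c f' E' w s' ∧
        Cov (nodes T) v w ∧ Stack cA a T s'.mem num E' ys w.length ∧
        f + zeros (prevEnc T) v.length + 1 ≤ f' + zeros (prevEnc T) w.length) ∨
      (s'.reg 49 ≠ 0 ∧ Descent cA cP a T num c f E v s' ∧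
        ((s'.reg 49 = 1 ∧ NoChild cA a T num E v) ∨
        (s'.reg 49 = 2 ∧ ∃ w d, WithinEdge X cA a T num f E v w d s'))))) s := by
  have hC := hD.ctx
  have hr := hD.tree.range v hD.mem
  have hlv := hD.tree.len v hD.mem
  have hvT := (IsNode.isTrie hD.mem).length_le
  have hf := hD.tree.free_le
  rw [lenArr] at hlv
  refine wp.seq_frame (Q' := fun s' => s'.mem = s.mem ∧ s'.time = s.time + 2 ∧
    s'.reg 61 = v.length ∧ s'.reg 60 = (a :: T).length) (wp_of_vc ?_) ?_
  · simp [vc, hD.reg_v, hlv, hC.length]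
    omega
  rintro s1 ⟨m1, t1, r61, r60⟩ fr1
  have hC1 := hC.frame fr1 rfl
  have hlt : v.length < (prevEnc (a :: T)).length := by
    rw [length_prevEnc, List.length_cons]; omega
  have hd := List.getElem?_eq_getElem hlt
  generalize (prevEnc (a :: T))[v.length] = d at hd
  refine wp.seq_frame (getChar_spec hC1.text List.suffix_rfl hd hC1.zero hC1.one r60 r61
    (by rw [List.length_cons]; omega)) ?_
  rintro s2 ⟨m2, t2, rd⟩ fr2
  have hC2 := hC1.frame fr2 rfl
  obtain ⟨r62, r63⟩ := Prod.mk.inj rd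
  have r46 : s2.reg 46 = num v := ((fr2.reg _ rfl).trans (fr1.reg _ rfl)).trans hD.reg_v
  refine wp.seq_frame (Q' := fun s' => s'.mem = s.mem ∧ s'.time = s2.time + 3 ∧
    s'.reg 10 = num v ∧ s'.reg 11 = (symCode cA id d).1 ∧ s'.reg 12 = (symCode cA id d).2)
    (wp_of_vc (by simp only [symCode, id]; simp [vc, m2, m1, r46, r62, r63])) ?_
  rintro s3 ⟨m3, t3, r10, r11, r12⟩ fr3
  have hC3 := hC2.frame fr3 rfl
  refine wp.seq_frame (Dict.lookup_spec (b := true) (E := E) (i := num v)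
    (k := symCode cA id d) (m3 ▸ hD.tree.dict)
    (hD.tree.small_true (fun x hx => IsNode.isTrie hx) hD.mem)
    hC3.zero r10 (by omega) r11 r12 (by omega)) ?_
  rintro s4 ⟨m4, t4, h14⟩ fr4
  have hC4 := hC3.frame fr4 rfl
  rw [m3] at m4 h14
  have hk : ∀ r, (lookup (dArr true)).writesReg r = false →
      (setR 10 46 ;; setR 11 62 ;; setR 12 63).writesReg r = false →
      getChar.writesReg r = false → (ldR 61 lenArr 46 ;; setR 60 4).writesReg r = false →
      s4.reg r = s.reg r := fun r e1 e2 e3 e4 =>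
    (fr4.reg _ e1).trans ((fr3.reg _ e2).trans ((fr2.reg _ e3).trans (fr1.reg _ e4)))
  have g45 : s4.reg 45 = xs.length := (hk _ rfl rfl rfl rfl).trans h45
  have g49 : s4.reg 49 = 0 := (hk _ rfl rfl rfl rfl).trans h49
  have g46 : s4.reg 46 = num v := (hk _ rfl rfl rfl rfl).trans hD.reg_v
  have g7 : s4.reg 7 = f := (hk _ rfl rfl rfl rfl).trans hD.free
  refine wp_ite (fun h => ?_) fun h => ?_
  · rw [Test.holds, hC4.zero] at h
    obtain ⟨-, hno⟩ := h14.resolve_right fun h' => h'.1 h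
    refine wp.frame (wp_of_vc (Q := fun s' => s'.mem = s.mem ∧ s'.time = s4.time + 2 ∧
      s'.reg 49 = 1) (by simp [vc, hC4.one, m4])) |>.mono ?_
    rintro s5 ⟨⟨m5, t5, r49⟩, fr5⟩
    refine ⟨xs, by omega, .inr ⟨by omega, ⟨hC4.tick.frame fr5 rfl, m5 ▸ hD.tree,
      (fr5.reg _ rfl).trans g7, hD.mem, hD.pre, (fr5.reg _ rfl).trans g46⟩, .inl ⟨r49, ?_⟩⟩⟩
    intro d' hd'
    rw [hd] at hd'
    obtain rfl := Option.some.inj hd'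
    exact hno
  · rw [Test.holds, hC4.zero] at h
    obtain ⟨-, h14X, hE, hdict⟩ := h14.resolve_left fun h' => h h'.1
    obtain ⟨d', w, hcov, hvd, hdd, htgt⟩ := (hD.tree.child v hD.mem _ _).1 hE
    obtain rfl := symCode_injective hcA hdd
    have hD4 : Descent cA cP a T num c f E v s4.tick :=
      ⟨hC4.tick, by rw [State.tick_mem, m4]; exact hD.tree, g7, hD.mem, hD.pre, g46⟩
    refine (enterEdge_spec (xs := xs) hcA hD4 hcov hvd (snoc_prefix_of_getElem? hD.pre hd) h14X
      (by rw [State.tick_mem, m4]; exact htgt) (by rw [State.tick_mem, m4]; exact hdict) g45 g49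
      (by rw [State.tick_mem, m4]; exact hS) hc hX hXW).mono ?_
    rintro s5 ⟨ys, t5, h5⟩
    rw [State.tick_time] at t5
    refine ⟨ys, by omega, ?_⟩
    rcases h5 with ⟨q1, q2, E', f', q3, q4, q5⟩ | ⟨q1, q2, q3⟩
    · exact .inl ⟨q1, q2, w, E', f', q3, hcov, q4, q5⟩
    · exact .inr ⟨by omega, q2, .inr ⟨q1, w, d, q3⟩⟩

/-- Each edge costs at most `γ`, apart from the credited removals, and adds at most one ancestor; it
is paid by a new link or by a zero. The zeros before the end of `v` are kept in the second estimate: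
they cancel with those in `cnt_tail`, so |Π| enters only once there. -/
theorem descend_spec [Fintype A] [Fintype P] (hcA : Function.Injective cA)
    (hD : Descent cA cP a T num c f E v s) (h45 : s.reg 45 = xs.length)
    (hS : Stack cA a T s.mem num E xs v.length)
    (hc : 2 * c < X) (hX : T.length + 2 < X) (hXW : X ≤ W) {γ : ℕ}
    (hγ : γ = 94 * htBound (Fintype.card A + Fintype.card P + 1) + 150) :
    wp X W descend (fun s' => ∃ w E' f', Descent cA cP a T num c f' E' w s' ∧
      ((s'.reg 49 = 1 ∧ NoChild cA a T num E' w) ∨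
        (s'.reg 49 = 2 ∧ ∃ z d, WithinEdge X cA a T num f' E' w z d s')) ∧
      s'.time + γ * f ≤ s.time + 32 * xs.length + γ * (f' + Fintype.card P + 1) + 2 ∧
      cnt (nodes T) (prevEnc (a :: T)) (w.length + 1) + f + zeros (prevEnc T) v.length ≤
        cnt (nodes T) (prevEnc (a :: T)) (v.length + 1) + f' + Fintype.card P) s := by
  refine wp.seq_frame (Q' := fun s' => s'.mem = s.mem ∧ s'.time = s.time + 1 ∧ s'.reg 49 = 0)
    (wp_of_vc (by simp [vc, hD.ctx.zero])) ?_
  rintro s1 ⟨m1, t1, r49⟩ fr1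
  refine wp_loop (fun n s' => ∃ w E' f', Descent cA cP a T num c f' E' w s' ∧
      cnt (nodes T) (prevEnc (a :: T)) (w.length + 1) + f + zeros (prevEnc T) v.length ≤
        cnt (nodes T) (prevEnc (a :: T)) (v.length + 1) + f' + zeros (prevEnc T) w.length ∧
      ((s'.reg 49 = 0 ∧ n = T.length + 1 - w.length ∧ ∃ ys, s'.reg 45 = ys.length ∧
        Stack cA a T s'.mem num E' ys w.length ∧ s'.time + 32 * ys.length + γ * f ≤
          s.time + 32 * xs.length + γ * (f' + zeros (prevEnc T) w.length) + 1) ∨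
      (s'.reg 49 ≠ 0 ∧ n = 0 ∧ ((s'.reg 49 = 1 ∧ NoChild cA a T num E' w) ∨
        (s'.reg 49 = 2 ∧ ∃ z d, WithinEdge X cA a T num f' E' w z d s')) ∧
        s'.time + γ * f ≤ s.time + 32 * xs.length + γ * (f' + zeros (prevEnc T) w.length + 1) + 1)))
    ?_ ?_ (T.length + 1 - v.length) s1 ?_
  · rintro n s' ⟨w, E', f', hD', hcnt, h⟩ ht
    rw [Test.holds, hD'.ctx.zero] at ht
    obtain ⟨-, rfl, ys, h45', hS', htm⟩ := h.resolve_right fun h => h.1 ht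
    have hwT := (IsNode.isTrie hD'.mem).length_le
    have hD'' : Descent cA cP a T num c f' E' w s'.tick :=
      ⟨hD'.ctx.tick, hD'.tree, hD'.free, hD'.mem, hD'.pre, hD'.reg_v⟩
    refine (descendStep_spec hcA hD'' h45' ht hS' hc hX hXW).mono ?_
    rintro s'' ⟨zs, t2, h2⟩
    rw [State.tick_time] at t2
    rcases h2 with ⟨q1, q2, z, E₂, f₂, hD₂, hcov, hS₂, q3⟩ | ⟨q1, hD₂, q2⟩
    · have hzT := (IsNode.isTrie hD₂.mem).length_le
      have h1 := cnt_cov hcov hD₂.pre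
      have hlt : w.length < z.length := by
        have := hcov.2.2.1.length_le
        have : w.length ≠ z.length := fun e => hcov.2.2.2.1 (hcov.2.2.1.eq_of_length e)
        omega
      refine ⟨T.length + 1 - z.length, by omega, z, E₂, f₂, hD₂, by omega,
        .inl ⟨q1, rfl, zs, q2, hS₂, ?_⟩⟩
      have := Nat.mul_le_mul_left γ q3
      rw [mul_add, mul_one] at this
      omega
    · refine ⟨0, by omega, w, E', f', hD₂, hcnt, .inr ⟨q1, rfl, q2, ?_⟩⟩
      rw [mul_add, mul_one]
      omega
  · rintro n s' ⟨w, E', f', hD', hcnt, h⟩ ht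
    rw [Test.holds, hD'.ctx.zero] at ht
    obtain ⟨-, -, h1, h2⟩ := h.resolve_left fun h => ht h.1
    have hz := zeros_le (T := T) w.length
    refine ⟨w, E', f', ⟨hD'.ctx.tick, hD'.tree, hD'.free, hD'.mem, hD'.pre, hD'.reg_v⟩, ?_, ?_,
      by omega⟩
    · rcases h1 with h1 | ⟨h1, z, d, h3⟩
      · exact .inl h1
      · exact .inr ⟨h1, z, d, ⟨h3.cov, h3.sym, h3.gt, h3.lt, h3.take, h3.ne, h3.reg_w, h3.reg_pos,
          h3.cell_lt, h3.dict⟩⟩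
    · have : γ * (f' + zeros (prevEnc T) w.length + 1) ≤ γ * (f' + Fintype.card P + 1) :=
        Nat.mul_le_mul_left _ (by omega)
      rw [State.tick_time]
      omega
  · refine ⟨v, E, f, ⟨hD.ctx.frame fr1 rfl, m1 ▸ hD.tree, (fr1.reg _ rfl).trans hD.free, hD.mem,
      hD.pre, (fr1.reg _ rfl).trans hD.reg_v⟩, by omega, .inl ⟨r49, rfl, xs,
      (fr1.reg _ rfl).trans h45, m1 ▸ hS, ?_⟩⟩
    rw [mul_add]
    omega

end Descent

/-! ## The online algorithm -/

section Step

variable {A P : Type*} [DecidableEq A] [DecidableEq P]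
variable {X W : ℕ} {s s' : State} {cA : A → ℕ} {cP : P → ℕ} {T U : List (A ⊕ P)} {a b : A ⊕ P}
variable {m m' : ℕ → ℕ → ℕ} {N : Set (List (A ⊕ ℕ))} {num : List (A ⊕ ℕ) → ℕ} {c f k : ℕ}
variable {E : Entries} {x v w h : List (A ⊕ ℕ)} {xs : List (List (A ⊕ ℕ))} {d : A ⊕ ℕ}

/-! ### Splitting an edge and adding the leaf. -/

/-- Splits the edge to the node `50`. -/
def splitEdge : Prog :=
  (addR 6 6 3 ;; stR lenArr 6 51 ;; stR posArr 6 52 ;; stR parentArr 6 46 ;; stR parentArr 50 6) ;;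
  (stR targetArr 56 6 ;; setR 46 6 ;; setR 60 52 ;; setR 61 51) ;; getChar ;;
  (setR 10 46 ;; setR 11 62 ;; setR 12 63 ;; setR 13 50) ;; dictInsert (dArr true)

/-- The node `h`, which is to be the parent of the new leaf, is in the tree. -/
structure Headed (cA : A → ℕ) (cP : P → ℕ) (a : A ⊕ P) (T : List (A ⊕ P))
    (num : List (A ⊕ ℕ) → ℕ) (c f : ℕ) (E : Entries) (h : List (A ⊕ ℕ)) (d : A ⊕ ℕ)
    (s : State) : Prop where
  ctx : Ctx cA cP a T s
  tree : Tree cA s.mem T (insert h (nodes T)) num c f E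
  count : s.reg 6 = c
  free : s.reg 7 = f
  reg_h : s.reg 46 = num h
  trie : IsTrie T h
  sym : h ++ [d] <+: prevEnc (a :: T)
  not_trie : ¬ IsTrie T (h ++ [d])

theorem NoChild.headed (hN : NoChild cA a T num E v) (hD : Descent cA cP a T num c f E v s)
    (h6 : s.reg 6 = c) : ∃ d, Headed cA cP a T num c f E v d s := by
  have hvT := (IsNode.isTrie hD.mem).length_le
  have hlt : v.length < (prevEnc (a :: T)).length := by
    rw [length_prevEnc, List.length_cons]; omega
  have hd := List.getElem?_eq_getElem hlt
  refine ⟨_, hD.ctx, ?_, h6, hD.free, hD.reg_v, IsNode.isTrie hD.mem,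
    snoc_prefix_of_getElem? hD.pre hd, not_isTrie_of_no_child hD.mem fun w hw hvw => ?_⟩
  · rw [Set.insert_eq_of_mem hD.mem]
    exact hD.tree
  · exact hN _ hd _ ((hD.tree.child v hD.mem _ _).2 ⟨_, w, hw, hvw, rfl, rfl⟩)

/-- The mismatch lies strictly inside an edge, so the agreeing prefix is in the trie without being a
node, and its continuation by the new string leaves the trie. The bound on old ancestors makes the
depth of the new leaf computable from that of `v`. -/
theorem splitEdge_spec [Fintype A] [Fintype P] (hcA : Function.Injective cA)
    (hD : Descent cA cP a T num c f E v s) (hE : WithinEdge X cA a T num f E v w d s)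
    (h6 : s.reg 6 = c) (hc : 2 * c + 2 < X) (hX : T.length + 2 < X) (hXW : X ≤ W) :
    wp X W splitEdge (fun s' => ∃ h num' E' e, Headed cA cP a T num' (c + 1) (f + 1) E' h e s' ∧
      (∀ u ∈ nodes T, u <+: prevEnc (a :: T) → u.length ≤ v.length) ∧
      s'.time ≤ s.time + 86 * htBound (Fintype.card A + Fintype.card P + 1) + 34) s := by
  have hC := hD.ctx
  have hvN := hE.cov.1
  have hwN := hE.cov.2.1
  have hrv := hD.tree.range v hvN
  have hrw := hD.tree.range w hwN
  have hf := hD.tree.free_le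
  obtain ⟨U, hU, hUp, hwU⟩ := hD.tree.pos w hwN
  have hwT := (IsNode.isTrie hwN).length_le
  obtain ⟨hcov, hvd, hgt, hlt, htk, hne, h50, h52, h56, hdict⟩ := hE
  generalize hq : s.reg 51 = q at *
  have hqF : q < (prevEnc (a :: T)).length := by rw [length_prevEnc, List.length_cons]; omega
  have hlh : ((prevEnc (a :: T)).take q).length = q := by rw [List.length_take]; omega
  have hhF : (prevEnc (a :: T)).take q <+: prevEnc (a :: T) := List.take_prefix _ _
  have hhw : (prevEnc (a :: T)).take q <+: w := htk ▸ List.take_prefix _ _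
  generalize hh : (prevEnc (a :: T)).take q = h at *
  obtain ⟨d', hd'⟩ : ∃ d', w[q]? = some d' := ⟨_, List.getElem?_eq_getElem hlt⟩
  obtain ⟨e, he⟩ : ∃ e, (prevEnc (a :: T))[q]? = some e := ⟨_, List.getElem?_eq_getElem hqF⟩
  have hhw' : h ++ [d'] <+: w := snoc_prefix_of_getElem? hhw (by rw [hlh, hd'])
  have hhF' : h ++ [e] <+: prevEnc (a :: T) := snoc_prefix_of_getElem? hhF (by rw [hlh, he])
  have hnt : ¬ IsTrie T (h ++ [e]) :=
    not_isTrie_of_mismatch hcov hgt hlt htk hlh (by rw [← he]; exact hne.symm)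
  have hvh : v <+: h := List.prefix_of_prefix_length_le hcov.2.2.1 hhw (by omega)
  have hvdh : v ++ [d] <+: h := List.prefix_of_prefix_length_le hvd hhw (by simp; omega)
  have hvne : v ≠ h := by rintro rfl; omega
  have hhN : h ∉ nodes T := fun hN => by
    rcases hcov.2.2.2.2 h hN hvh hhw with rfl | rfl <;> omega
  have hex : ∀ u ∈ nodes T, h <+: u → w <+: u := fun u hu hhu => by
    rcases Cov.comparable hcov hvh hvne hhw (IsNode.isTrie hu) hhu with h' | h'
    · have := hhu.length_le
      rcases hcov.2.2.2.2 u hu (hvh.trans hhu) h' with rfl | rfl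
      · omega
      · exact List.prefix_rfl
    · exact h'
  -- An old node on the new path is a prefix of `h`; if longer than `v` it would lie strictly inside
  -- the edge.
  have hmax : ∀ u ∈ nodes T, u <+: prevEnc (a :: T) → u.length ≤ v.length := fun u hu huF => by
    have huh := prefix_of_prefix_new hhF' hnt (IsNode.isTrie hu) huF
    by_contra hlt'
    have hvu := List.prefix_of_prefix_length_le hD.pre huF (by omega)
    have := huh.length_le
    rcases hcov.2.2.2.2 u hu hvu (huh.trans hhw) with rfl | rfl <;> omega
  have htrie : IsTrie T h := (IsNode.isTrie hwN).of_prefix hhw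
  refine wp.seq_frame (Q' := fun s' => s'.time = s.time + 5 ∧ s'.reg 6 = c + 1 ∧
    s'.mem 4 = Function.update (s.mem 4) (c + 1) h.length ∧
    s'.mem 5 = Function.update (s.mem 5) (c + 1) (s.mem 5 (num w)) ∧
    s'.mem 3 = Function.update (Function.update (s.mem 3) (c + 1) (num v)) (num w) (c + 1))
    (wp_of_vc ?_) ?_
  · rw [posArr] at h52
    simp [vc, h6, hC.one, hD.reg_v, h50, hq, hlh, h52]
    omega
  rintro s1 ⟨t1, r6, m4, m5, m3⟩ fr1
  have hC1 := hC.frame fr1 rfl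
  have mj : ∀ j, j ≠ 3 → j ≠ 4 → j ≠ 5 → s1.mem j = s.mem j := fun j h1 h2 h3 =>
    fr1.mem j (by simp [Prog.writesArr, h1, h2, h3])
  have r56 : s1.reg 56 = s.reg 56 := fr1.reg _ rfl
  have r51 : s1.reg 51 = q := (fr1.reg _ rfl).trans hq
  have r52 : s1.reg 52 = U.length := (fr1.reg _ rfl).trans (h52.trans hUp.symm)
  have r50 : s1.reg 50 = num w := (fr1.reg _ rfl).trans h50
  have r7 : s1.reg 7 = f := (fr1.reg _ rfl).trans hD.free
  refine wp.seq_frame (Q' := fun s' => s'.time = s1.time + 4 ∧ s'.reg 46 = c + 1 ∧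
    s'.reg 60 = U.length ∧ s'.reg 61 = q ∧
    s'.mem = Function.update s1.mem 11 (Function.update (s1.mem 11) (s.reg 56) (c + 1)))
    (wp_of_vc (by simp [vc, r6, r56, r51, r52, h56])) ?_
  rintro s2 ⟨t2, r46, r60, r61, m2⟩ fr2
  have hC2 := hC1.frame fr2 rfl
  have hUd : (prevEnc U)[q]? = some d' := by rw [← prefix_getElem? hwU hlt, hd']
  refine wp.seq_frame (getChar_spec hC2.text (hU.trans (List.suffix_cons a T)) hUd hC2.zero hC2.one
    r60 r61 (by rw [List.length_cons]; omega)) ?_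
  rintro s3 ⟨m3', t3, rd⟩ fr3
  have hC3 := hC2.frame fr3 rfl
  obtain ⟨r62, r63⟩ := Prod.mk.inj rd
  have r46 : s3.reg 46 = c + 1 := (fr3.reg _ rfl).trans r46
  have r50 : s3.reg 50 = num w := (fr3.reg _ rfl).trans ((fr2.reg _ rfl).trans r50)
  have r7 : s3.reg 7 = f := (fr3.reg _ rfl).trans ((fr2.reg _ rfl).trans r7)
  refine wp.seq_frame (Q' := fun s' => s'.mem = s2.mem ∧ s'.time = s3.time + 4 ∧
    s'.reg 10 = c + 1 ∧ s'.reg 11 = (symCode cA id d').1 ∧ s'.reg 12 = (symCode cA id d').2 ∧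
    s'.reg 13 = num w)
    (wp_of_vc (by simp only [symCode, id]; simp [vc, m3', r46, r50, r62, r63])) ?_
  rintro s4 ⟨m4', t4, r10, r11, r12, r13⟩ fr4
  have hC4 := hC3.frame fr4 rfl
  have r7 : s4.reg 7 = f := (fr4.reg _ rfl).trans r7
  have hd4 : Dict s4.mem f (E.retarget true (num v) (symCode cA id d) (c + 1)) := by
    refine (hdict (c + 1)).congr fun j h1 h2 => ?_
    rw [m4', m2, targetArr]
    by_cases hj : j = 11
    · subst hj
      rw [Function.update_self, Function.update_self, mj 11 (by omega) (by omega) (by omega)]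
    · rw [Function.update_of_ne hj, Function.update_of_ne hj, mj j (by omega) (by omega) (by omega)]
  -- The number `c + 1` is new, so by `fresh` its dictionary of edges is still empty.
  have hno : ∀ k t, ¬ (E.retarget true (num v) (symCode cA id d) (c + 1)) true (c + 1) k t := by
    intro k t hE
    simp only [Entries.retarget, true_and] at hE
    rw [if_neg (by omega)] at hE
    have := hD.tree.fresh _ _ _ hE
    omega
  refine (Dict.insert_spec (b := true) (i := c + 1) (f := f) (t := num w)
    (k := symCode cA id d') (M := Fintype.card A + Fintype.card P + 1) hd4
    ⟨∅, by simp, fun k t hE => absurd hE (hno k t)⟩ hC4.zero hC4.one r7 r10 (by omega) r11 r12 r13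
    (by omega) hXW (hno _)).frame.mono ?_
  rintro s5 ⟨⟨t5, r7, hd5⟩, fr5⟩
  have hmem : ∀ j, 2 ≤ j → j ≤ 5 → s5.mem j = s1.mem j := fun j h1 h2 => by
    have e5 : s5.mem j = s4.mem j := fr5.mem j (by interval_cases j <;> rfl)
    rw [e5, m4', m2, Function.update_of_ne (by omega)]
  refine ⟨h, Function.update num h (c + 1), _, e, ⟨hC4.frame fr5 rfl,
    hD.tree.split hcA hcov hvdh hhw' hhN hex ?_ ?_ ?_ ?_ hd5, ?_, r7, ?_, htrie, hhF', hnt⟩,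
    hmax, by omega⟩
  · rw [hmem _ (by simp) (by simp), mj _ (by simp) (by simp) (by simp)]
  · rw [hmem _ (by simp) (by simp)]; exact m4
  · rw [hmem _ (by simp) (by simp)]; exact m5
  · rw [hmem _ (by simp) (by simp)]; exact m3
  · exact (fr5.reg _ rfl).trans ((fr4.reg _ rfl).trans ((fr3.reg _ rfl).trans
      ((fr2.reg _ rfl).trans r6)))
  · rw [Function.update_self]
    exact (fr5.reg _ rfl).trans ((fr4.reg _ rfl).trans r46)

/-- Adds the new leaf to the tree. -/
def addLeaf : Prog :=
  (ldR 61 lenArr 46 ;; addR 6 6 3 ;; stR lenArr 6 4 ;; stR posArr 6 4 ;; stR parentArr 6 46 ;;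
    setR 5 6 ;; setR 60 4) ;;
  getChar ;; (setR 10 46 ;; setR 11 62 ;; setR 12 63 ;; setR 13 6) ;; dictInsert (dArr true)

theorem addLeaf_spec [Fintype A] [Fintype P] (hcA : Function.Injective cA)
    (hH : Headed cA cP a T num c f E h d s)
    (hc : 2 * c < X) (hX : T.length + 2 < X) (hcX : c + 1 < X) (hXW : X ≤ W) :
    wp X W addLeaf (fun s' => ∃ num' E', Ctx cA cP a T s' ∧
      Tree cA s'.mem (a :: T) (nodes (a :: T)) num' (c + 1) (f + 1) E' ∧
      s'.reg 5 = num' (prevEnc (a :: T)) ∧ s'.reg 6 = c + 1 ∧ s'.reg 7 = f + 1 ∧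
      s'.time ≤ s.time + 86 * htBound (Fintype.card A + Fintype.card P + 1) + 32) s := by
  have hC := hH.ctx
  have hhN : h ∈ insert h (nodes T) := Set.mem_insert _ _
  have hr := hH.tree.range h hhN
  have hf := hH.tree.free_le
  have hlh := hH.tree.len h hhN
  have hhT := hH.trie.length_le
  have hNT : ∀ x ∈ insert h (nodes T), IsTrie T x := by
    rintro x (rfl | hx)
    exacts [hH.trie, IsNode.isTrie hx]
  rw [lenArr] at hlh
  refine wp.seq_frame (Q' := fun s' => s'.time = s.time + 7 ∧ s'.reg 6 = c + 1 ∧ s'.reg 5 = c + 1 ∧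
    s'.reg 61 = h.length ∧ s'.reg 60 = (a :: T).length ∧
    s'.mem 4 = Function.update (s.mem 4) (c + 1) (a :: T).length ∧
    s'.mem 5 = Function.update (s.mem 5) (c + 1) (a :: T).length ∧
    s'.mem 3 = Function.update (s.mem 3) (c + 1) (num h))
    (wp_of_vc ?_) ?_
  · simp [vc, hH.count, hC.one, hH.reg_h, hlh, hC.length]
    omega
  rintro s1 ⟨t1, r6, r5, r61, r60, m4, m5, m3⟩ fr1
  have hC1 := hC.frame fr1 rfl
  have mj : ∀ j, j ≠ 3 → j ≠ 4 → j ≠ 5 → s1.mem j = s.mem j := fun j h1 h2 h3 =>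
    fr1.mem j (by simp [Prog.writesArr, h1, h2, h3])
  have r46 : s1.reg 46 = num h := (fr1.reg _ rfl).trans hH.reg_h
  have r7 : s1.reg 7 = f := (fr1.reg _ rfl).trans hH.free
  have hFd : (prevEnc (a :: T))[h.length]? = some d := by
    rw [← prefix_getElem? hH.sym (by simp)]; simp
  refine wp.seq_frame (getChar_spec hC1.text List.suffix_rfl hFd hC1.zero hC1.one
    r60 r61 (by rw [List.length_cons]; omega)) ?_
  rintro s2 ⟨m2, t2, rd⟩ fr2
  have hC2 := hC1.frame fr2 rfl
  obtain ⟨r62, r63⟩ := Prod.mk.inj rd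
  have r46 : s2.reg 46 = num h := (fr2.reg _ rfl).trans r46
  have r6 : s2.reg 6 = c + 1 := (fr2.reg _ rfl).trans r6
  have r5 : s2.reg 5 = c + 1 := (fr2.reg _ rfl).trans r5
  have r7 : s2.reg 7 = f := (fr2.reg _ rfl).trans r7
  refine wp.seq_frame (Q' := fun s' => s'.mem = s1.mem ∧ s'.time = s2.time + 4 ∧
    s'.reg 10 = num h ∧ s'.reg 11 = (symCode cA id d).1 ∧ s'.reg 12 = (symCode cA id d).2 ∧
    s'.reg 13 = c + 1)
    (wp_of_vc (by simp only [symCode, id]; simp [vc, m2, r46, r6, r62, r63])) ?_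
  rintro s3 ⟨m3', t3, r10, r11, r12, r13⟩ fr3
  have hC3 := hC2.frame fr3 rfl
  have r6 : s3.reg 6 = c + 1 := (fr3.reg _ rfl).trans r6
  have r5 : s3.reg 5 = c + 1 := (fr3.reg _ rfl).trans r5
  have r7 : s3.reg 7 = f := (fr3.reg _ rfl).trans r7
  have hd3 : Dict s3.mem f E := hH.tree.dict.congr fun j h1 h2 => by
    rw [m3', mj j (by omega) (by omega) (by omega)]
  have hno : ∀ t, ¬ E true (num h) (symCode cA id d) t := by
    intro t hE
    obtain ⟨d', z, hz, hdz, hdd, -⟩ := (hH.tree.child h hhN _ _).1 hE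
    obtain rfl := symCode_injective hcA hdd
    exact hH.not_trie ((hNT z hz.2.1).of_prefix hdz)
  refine (Dict.insert_spec (b := true) (i := num h) (f := f) (t := c + 1)
    (k := symCode cA id d) hd3 (hH.tree.small_true hNT hhN) hC3.zero hC3.one r7 r10 (by omega)
    r11 r12 r13 (by omega) hXW hno).frame.mono ?_
  rintro s4 ⟨⟨t4, r7, hd4⟩, fr4⟩
  have hmem : ∀ j, 2 ≤ j → j ≤ 5 → s4.mem j = s1.mem j := fun j h1 h2 => by
    have e5 : s4.mem j = s3.mem j := fr4.mem j (by interval_cases j <;> rfl)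
    rw [e5, m3']
  have htree := (hH.tree.cons a).leaf (m' := s4.mem) hhN (fun u hu hFu => ?_) hH.sym
    (fun u hu huF => prefix_of_prefix_new hH.sym hH.not_trie (hNT u hu) huF) ?_ ?_ ?_ ?_ hd4
  · rw [← nodes_cons hH.trie hH.sym hH.not_trie] at htree
    exact ⟨_, _, hC3.frame fr4 rfl, htree, by rw [Function.update_self, fr4.reg _ rfl, r5],
      (fr4.reg _ rfl).trans r6, r7, by omega⟩
  · have h1 := (hNT u hu).length_le
    have h2 := hFu.length_le
    rw [length_prevEnc, List.length_cons] at h2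
    omega
  · rw [hmem _ (by simp) (by simp), mj _ (by simp) (by simp) (by simp)]
  · rw [hmem _ (by simp) (by simp)]; exact m4
  · rw [hmem _ (by simp) (by simp)]; exact m5
  · rw [hmem _ (by simp) (by simp)]; exact m3

/-! ### The invariant and the amortised analysis. -/

/-- The program that is run first. -/
def initProg : Prog :=
  setC 3 1 ;; setR 5 3 ;; setR 6 3 ;; setR 7 3 ;; stR rootArr 2 3

/-- The program that is run after each symbol that is read. -/
def stepProg : Prog :=
  readText ;; walk ;; descend ;; .ite (.eq 49 3) .skip splitEdge ;; addLeaf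

/-- A bound for the time of an iteration of the descent. -/
def unit (A P : Type*) [Fintype A] [Fintype P] : ℕ :=
  94 * htBound (Fintype.card A + Fintype.card P + 1) + 150

/-- The invariant of the algorithm, after the string `T` has been read. -/
structure Inv [Fintype A] [Fintype P] (cA : A → ℕ) (cP : P → ℕ) (T : List (A ⊕ P))
    (num : List (A ⊕ ℕ) → ℕ) (c f : ℕ) (E : Entries) (s : State) : Prop where
  zero : s.reg 2 = 0
  one : s.reg 3 = 1
  length : s.reg 4 = T.length
  text : Text cA s.mem T
  params : Params cP s.mem (s.reg 8) T
  tree : Tree cA s.mem T (nodes T) num c f E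
  leaf : s.reg 5 = num (prevEnc T)
  count : s.reg 6 = c
  free : s.reg 7 = f
  count_le : c ≤ 2 * T.length + 1
  time : s.time + unit A P * cnt (nodes T) (prevEnc T) (T.length + 1) ≤
    unit A P * ((3 * Fintype.card P + 7) * T.length + 2 * f + 1)

theorem initProg_spec [Fintype A] [Fintype P] (cA : A → ℕ) (cP : P → ℕ) (hX : 0 < X) (hXW : X ≤ W) :
    wp X W initProg (fun s => ∃ num E, Inv cA cP ([] : List (A ⊕ P)) num 1 1 E s) State.start := by
  have hn : ∀ x, x ∈ nodes ([] : List (A ⊕ P)) ↔ x = [] := fun x => by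
    constructor
    · intro hx
      simpa using (IsNode.isTrie hx).length_le
    · rintro rfl
      exact isNode_nil
  have hcov : ∀ x z, ¬ Cov (nodes ([] : List (A ⊕ P))) x z := by
    rintro x z ⟨hx, hz, -, hne, -⟩
    exact hne (((hn x).1 hx).trans ((hn z).1 hz).symm)
  refine wp.mono (Q := fun s => s.time = 5 ∧ s.reg 2 = 0 ∧ s.reg 3 = 1 ∧ s.reg 4 = 0 ∧ s.reg 5 = 1 ∧
    s.reg 6 = 1 ∧ s.reg 7 = 1 ∧ s.reg 8 = 0 ∧ s.mem 2 0 = 1 ∧ ∀ j, j ≠ 2 → s.mem j = fun _ => 0)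
    (wp_of_vc ?_) ?_
  · simp +contextual [vc, initProg, State.start, Function.update_of_ne]
    omega
  rintro s ⟨h1, h2, h3, h4, h5, h6, h7, h8, h9, h10⟩
  refine ⟨fun _ => 1, fun _ _ _ _ => False, h2, h3, h4, ⟨fun i c h => ?_, fun b U h => ?_⟩, ?_, ?_,
    h5, h6, h7, by simp, ?_⟩
  · simp [prevEnc] at h
  · simp at h
  · rw [h8]
    exact ⟨le_rfl, by simp, by simp, by simp⟩
  · refine ⟨fun x hx y hy _ => ((hn x).1 hx).trans ((hn y).1 hy).symm, by simp, isNode_nil, rfl, h9,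
      fun x hx => ?_, fun x hx => ⟨[], by simp, ?_, ?_⟩, fun x z h => absurd h (hcov x z),
      fun x hx k t => ?_, fun i k t h => h.elim, fun i k t h => h.elim, ?_,
      ∅, by simp, by simp, by simp⟩
    · rw [h10 _ (by simp), (hn x).1 hx]; rfl
    · rw [h10 _ (by simp)]; rfl
    · rw [(hn x).1 hx]; exact List.nil_prefix
    · simp [hcov]
    · refine ⟨fun _ _ => .nil, ⟨fun b i => ?_, fun b i => trivial, fun b i => trivial,
        fun b i => List.nodup_nil, by simp, fun b i => List.Pairwise.nil, by simp, ?_, by simp⟩,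
        by simp⟩
      · rw [h10 _ (by cases b <;> simp)]; rfl
      · rw [h10 _ (by simp)]
  · have := cnt_le (nodes ([] : List (A ⊕ P))) (prevEnc ([] : List (A ⊕ P))) 1
    have h := Nat.mul_le_mul_left (unit A P) this
    have hu : 150 ≤ unit A P := Nat.le_add_left _ _
    simp only [List.length_nil, zero_add, mul_zero, mul_add]
    omega

/-- Put `u = unit A P` and `p = |Π|`. Reading the symbol, walking, descending and updating the tree
take at most `u` times |xs| + (f' - f) + 2p + 4 steps. The potential rises by at most `u` times 3 +
p + (f' - f) - |xs|. The length of the stack cancels, and what remains is 3p + 7 + 2(f' - f), as in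
the field `time`. -/
theorem stepProg_spec [Fintype A] [Fintype P] (hcA : Function.Injective cA)
    (hcP : Function.Injective cP) (hI : Inv cA cP T num c f E s)
    (hX : 8 * T.length + 8 < X) (hXW : X ≤ W) :
    wp X W stepProg (fun s' => ∃ num' c' f' E', Inv cA cP (a :: T) num' c' f' E' s')
      (s.read (symCode cA cP a)) := by
  have hc := hI.count_le
  have hf := hI.tree.free_le
  refine wp.seq_frame (readText_spec (T := T) (a := a) hcP hI.text hI.params rfl hI.zero hI.one
    hI.length (by omega) hXW) ?_
  rintro s1 ⟨t1, r40, r4, htext, hpar⟩ fr1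
  have r0 : s1.reg 0 = (symCode cA cP a).1 := (fr1.reg _ rfl).trans rfl
  have r1 : s1.reg 1 = (symCode cA cP a).2 := (fr1.reg _ rfl).trans rfl
  have hC1 : Ctx cA cP a T s1 := ⟨(fr1.reg _ rfl).trans hI.zero, (fr1.reg _ rfl).trans hI.one, r4, r40,
    by rw [r0, r1], htext⟩
  have hT1 : Tree cA s1.mem T (nodes T) num c f E := hI.tree.congr fun j h1 h2 =>
    fr1.mem j (by interval_cases j <;> rfl)
  refine wp.seq_frame (walk_spec hcA hC1 hT1 ((fr1.reg _ rfl).trans hI.leaf) (by omega) (by omega)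
    (by omega) hXW) ?_
  rintro s2 ⟨v, xs, hw, t2⟩ fr2
  have hvT := (IsNode.isTrie hw.mem).length_le
  have hT2 : Tree cA s2.mem T (nodes T) num c f E := hT1.congr fun j h1 h2 =>
    fr2.mem j (by interval_cases j <;> rfl)
  have hD : Descent cA cP a T num c f E v s2 := ⟨hC1.frame fr2 rfl, hT2,
    ((fr2.reg _ rfl).trans (fr1.reg _ rfl)).trans hI.free, hw.mem, hw.pre, hw.reg_v⟩
  refine wp.seq_frame (descend_spec (X := X) hcA hD hw.reg_sp hw.stack (by omega) (by omega) hXW rfl) ?_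
  rintro s3 ⟨w, E', f', hD', hend, t3, hcnt⟩ fr3
  have r6 : s3.reg 6 = c :=
    ((fr3.reg _ rfl).trans ((fr2.reg _ rfl).trans (fr1.reg _ rfl))).trans hI.count
  refine wp.seq_frame (Q' := fun s' => ∃ num' c' f'' E'' h d, Headed cA cP a T num' c' f'' E'' h d s' ∧
    c' ≤ c + 1 ∧ f' ≤ f'' ∧ (∀ u ∈ nodes T, u <+: prevEnc (a :: T) → u.length ≤ w.length) ∧
    s'.time ≤ s3.time + 86 * htBound (Fintype.card A + Fintype.card P + 1) + 35)
    (wp_ite (fun h => ?_) fun h => ?_) ?_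
  · rw [Test.holds, hD'.ctx.one] at h
    obtain ⟨-, hno⟩ := hend.resolve_right fun h' => by omega
    have hD'' : Descent cA cP a T num c f' E' w s3.tick :=
      ⟨hD'.ctx.tick, hD'.tree, hD'.free, hD'.mem, hD'.pre, hD'.reg_v⟩
    obtain ⟨d, hH⟩ := hno.headed hD'' r6
    refine wp_of_vc ⟨num, c, f', E', w, d, ⟨hH.ctx.tick, hH.tree, hH.count, hH.free, hH.reg_h,
      hH.trie, hH.sym, hH.not_trie⟩, by omega, le_rfl, fun u hu huF =>
      (prefix_of_prefix_new hH.sym hH.not_trie (IsNode.isTrie hu) huF).length_le, ?_⟩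
    rw [State.tick_time, State.tick_time]
    omega
  · rw [Test.holds, hD'.ctx.one] at h
    obtain ⟨-, z, d, hE⟩ := hend.resolve_left fun h' => h h'.1
    have hD'' : Descent cA cP a T num c f' E' w s3.tick :=
      ⟨hD'.ctx.tick, hD'.tree, hD'.free, hD'.mem, hD'.pre, hD'.reg_v⟩
    have hE'' : WithinEdge X cA a T num f' E' w z d s3.tick := ⟨hE.cov, hE.sym, hE.gt, hE.lt, hE.take,
      hE.ne, hE.reg_w, hE.reg_pos, hE.cell_lt, hE.dict⟩
    refine (splitEdge_spec hcA hD'' hE'' r6 (by omega) (by omega) hXW).mono ?_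
    rintro s' ⟨h, num', E'', e, hH, hmax, ht⟩
    rw [State.tick_time] at ht
    exact ⟨num', c + 1, f' + 1, E'', h, e, hH, le_rfl, by omega, hmax, by omega⟩
  rintro s4 ⟨num', c', f'', E'', h, d, hH, hc', hf', hmax, t4⟩ fr4
  refine (addLeaf_spec hcA hH (by omega) (by omega) (by omega) hXW).frame.mono ?_
  rintro s5 ⟨⟨num₂, E₂, hC5, hT5, r5, r6', r7, t5⟩, fr5⟩
  have hk : ∀ r, addLeaf.writesReg r = false → (Prog.ite (.eq 49 3) .skip splitEdge).writesReg r = false →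
      descend.writesReg r = false → walk.writesReg r = false → s5.reg r = s1.reg r :=
    fun r e1 e2 e3 e4 =>
    (fr5.reg _ e1).trans ((fr4.reg _ e2).trans ((fr3.reg _ e3).trans (fr2.reg _ e4)))
  have hkm : ∀ r, addLeaf.writesArr r = false → (Prog.ite (.eq 49 3) .skip splitEdge).writesArr r = false →
      descend.writesArr r = false → walk.writesArr r = false → s5.mem r = s1.mem r :=
    fun r e1 e2 e3 e4 =>
    (fr5.mem _ e1).trans ((fr4.mem _ e2).trans ((fr3.mem _ e3).trans (fr2.mem _ e4)))
  have hpar5 : Params cP s5.mem (s5.reg 8) (a :: T) := by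
    rw [hk 8 rfl rfl rfl rfl]
    have e1 : s5.mem parArr = s1.mem parArr := hkm _ rfl rfl rfl rfl
    have e2 : s5.mem lastArr = s1.mem lastArr := hkm _ rfl rfl rfl rfl
    exact ⟨hpar.le, by rw [e1, e2]; exact hpar.code, by rw [e1]; exact hpar.surj,
      by rw [e1]; exact hpar.inj⟩
  refine ⟨num₂, c' + 1, f'' + 1, E₂, hC5.zero, hC5.one, hC5.length, hC5.text, hpar5, hT5, r5, r6', r7,
    by rw [List.length_cons]; omega, ?_⟩
  have hstk := hw.stack.count (by omega)
  have htail := cnt_tail (a := a) (T := T) (k := v.length) (by omega)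
  have hnew : cnt (nodes (a :: T)) (prevEnc (a :: T)) ((a :: T).length + 1) ≤
      cnt (nodes T) (prevEnc (a :: T)) (w.length + 1) + 2 := by
    rw [nodes_cons hH.trie hH.sym hH.not_trie]
    exact cnt_new (fun x hx hxF => Nat.lt_succ_of_le (hmax x hx hxF)) (by rw [length_prevEnc])
  have htime := hI.time
  have hrt : (s.read (symCode cA cP a)).time = s.time + 2 := rfl
  rw [hrt] at t1
  generalize cnt (nodes (a :: T)) (prevEnc (a :: T)) ((a :: T).length + 1) = n' at *
  generalize cnt (nodes T) (prevEnc T) (T.length + 1) = n at *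
  have hu : unit A P = 94 * htBound (Fintype.card A + Fintype.card P + 1) + 150 := rfl
  rw [← hu] at t3
  generalize htBound (Fintype.card A + Fintype.card P + 1) = H at *
  generalize unit A P = u at *
  generalize Fintype.card P = p at *
  -- A node on the stack is paid for twice: once when it is visited by the walk and once, with 32
  -- steps, when it is removed.
  have e1 : (8 * H + 16) * (xs.length + 1) + 32 * xs.length ≤ u * xs.length + u := by
    have := Nat.mul_le_mul_right (xs.length + 1) (show 8 * H + 48 ≤ u by omega)
    have e : (8 * H + 48) * (xs.length + 1) =
      (8 * H + 16) * (xs.length + 1) + 32 * xs.length + 32 := by ring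
    rw [mul_add u] at this
    omega
  -- The balance of depths: `hnew`, the second estimate of `descend_spec`, `htail` and `hstk` are
  -- added. The 3 consists of the two new nodes and the root in `cnt_tail`.
  have e2 : u * (n' + xs.length + f) ≤ u * (3 + n + f' + p) := Nat.mul_le_mul_left _ (by omega)
  have e3 : u * f' ≤ u * f'' := Nat.mul_le_mul_left _ hf'
  have e4 : 5 * p ≤ u * p := Nat.mul_le_mul_right _ (by omega)
  have e5 : (3 * p + 7) * (T.length + 1) = (3 * p + 7) * T.length + 3 * p + 7 := by ring
  rw [List.length_cons, e5]
  simp only [mul_add, mul_one] at e2 t3 htime ⊢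
  have e6 : u * (3 * p) = 3 * (u * p) := by ring
  have e7 : u * (2 * f) = 2 * (u * f) := by ring
  have e8 : u * (2 * f'') = 2 * (u * f'') := by ring
  omega

end Step

/-! ## The stored tree as a data structure, and the bounds -/

section Final

variable {A P : Type*} [DecidableEq A] [DecidableEq P]
variable {X W : ℕ} {s : State} {cA : A → ℕ} {cP : P → ℕ} {S : List (A ⊕ P)}
variable {m : ℕ → ℕ → ℕ} {num : List (A ⊕ ℕ) → ℕ} {c f : ℕ} {E : Entries}

theorem Tr.Rep.binTree : ∀ {t : Tr}, t.Rep m →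
    BinTree m t.root (t.cells.map fun c => (cellKey m c, m targetArr c)) t.ht
  | .nil, _ => .nil
  | .node p l r, h => by
    obtain ⟨h1, h2, h3, -, h4, h5⟩ := h
    simp only [Tr.cells, List.map_append, List.map_cons]
    exact .node h1 (h2 ▸ Tr.Rep.binTree h4) (h3 ▸ Tr.Rep.binTree h5)

theorem Dict.binSearchTree {M : ℕ} (h : Dict m f E) {b : Bool} {i : ℕ} (hM : Small E M b i) :
    ∃ d h, BinSearchTree m (m (dArr b) i) d h ∧ h ≤ htBound M ∧
      ∀ k t, (k, t) ∈ d ↔ E b i k t := by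
  obtain ⟨tr, hr, hE⟩ := h
  obtain ⟨F, hF, hk⟩ := hM
  refine ⟨(tr b i).cells.map fun c => (cellKey m c, m targetArr c), (tr b i).ht, ⟨?_, ?_⟩,
    hr.ht_le hF fun c hc => hk _ _ ((hE b i _ _).2 ⟨c, hc, rfl, rfl⟩), fun k t => ?_⟩
  · rw [hr.root]
    exact (hr.rep b i).binTree
  · exact List.pairwise_map.2 (hr.sorted b i)
  · rw [hE]
    simp

theorem Inv.holdsTree [Fintype A] [Fintype P] (hI : Inv cA cP S num c f E s) {H : ℝ}
    (hH : (htBound (Fintype.card A + Fintype.card P + 1) : ℝ) ≤ H) :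
    HoldsTree cA s.mem S H num where
  text := hI.text.sym
  inj x y hx hy := hI.tree.inj x hx y hy
  root := hI.tree.root.trans hI.tree.num_nil.symm
  len x hx := hI.tree.len x hx
  pos x hx := hI.tree.pos x hx
  parent x y h := hI.tree.parent _ _ (isPatriciaEdge_iff.1 h)
  children x hx := by
    obtain ⟨d, h, h1, h2, h3⟩ := hI.tree.dict.binSearchTree (b := true)
      (hI.tree.small_true (fun y hy => IsNode.isTrie hy) hx)
    refine ⟨d, h, h1, (Nat.cast_le.2 h2).trans hH, fun k t => ?_⟩
    rw [h3, hI.tree.child x hx]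
    constructor
    · rintro ⟨e, z, hc, ⟨y, rfl⟩, rfl, rfl⟩
      rw [List.append_assoc, List.singleton_append] at hc ⊢
      exact ⟨e, y, isPatriciaEdge_iff.2 hc, rfl, rfl⟩
    · rintro ⟨e, y, hc, rfl, rfl⟩
      exact ⟨e, x ++ e :: y, isPatriciaEdge_iff.1 hc, ⟨y, by simp⟩, rfl, rfl⟩

/-- The algorithm. -/
def algorithm : OnlineAlgorithm := ⟨initProg, stepProg⟩

theorem State.Ok.read (h : s.Ok X W) {k : ℕ × ℕ} (h1 : k.1 ≤ W) (h2 : k.2 ≤ W) :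
    (s.read k).Ok X W := (h.setReg h1).setReg h2

/-- The bounds `X` and `W` are fixed for the whole run. A bound of eight cells per symbol suffices
since there are at most 2n + 1 nodes and twice as many dictionary cells; `B` is added to `W` because
the codes of the symbols are stored. -/
theorem exists_runs [Fintype A] [Fintype P] (hcA : Function.Injective cA)
    (hcP : Function.Injective cP) {B : ℕ} (hB : ∀ a, cA a ≤ B) (hB' : ∀ p, cP p ≤ B)
    (S : List (A ⊕ P)) (hX : 8 * S.length < X) (hXW : X + B ≤ W) :
    ∃ s, algorithm.Runs cA cP S s ∧ s.Ok X W ∧ ∃ num c f E, Inv cA cP S num c f E s := by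
  induction S with
  | nil =>
    obtain ⟨s, h1, h2, num, E, h3⟩ := initProg_spec (X := X) (W := W) cA cP (by omega) (by omega)
      ⟨Nat.zero_le _, Nat.zero_le _, fun _ => Nat.zero_le _, fun _ _ => Nat.zero_le _⟩
    exact ⟨s, .nil h1, h2, num, 1, 1, E, h3⟩
  | cons a S ih =>
    rw [List.length_cons] at hX
    obtain ⟨s, h1, h2, num, c, f, E, h3⟩ := ih (by omega)
    have hk : (symCode cA cP a).1 ≤ W ∧ (symCode cA cP a).2 ≤ W := by
      rcases a with a | p
      · exact ⟨Nat.zero_le _, (hB a).trans (by omega)⟩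
      · refine ⟨?_, (hB' p).trans (by omega)⟩
        simp only [symCode]
        omega
    obtain ⟨s', h4, h5, num', c', f', E', h6⟩ := stepProg_spec (X := X) (W := W) (a := a) hcA hcP h3
      (by omega) (by omega) (h2.read hk.1 hk.2)
    exact ⟨s', .cons h1 h4, h5, num', c', f', E', h6⟩

/-- For `n ≥ 2` one has n + 2 ≤ n², so the binary logarithm of n + 2 is at most 2 log n / log 2. The
additive 1 is absorbed since log n ≥ log 2, and this is where an alphabet of at least two symbols is
needed. -/
theorem htBound_le {n : ℕ} (hn : 2 ≤ n) : (htBound (n + 1) : ℝ) ≤ 8 * Real.log n := by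
  have h2 := Real.log_two_gt_d9
  have hn' : (2 : ℝ) ≤ n := by exact_mod_cast hn
  have hl : Real.log 2 ≤ Real.log n := Real.log_le_log (by norm_num) hn'
  have h1 : (Nat.log 2 (n + 2) : ℝ) * Real.log 2 ≤ 2 * Real.log n := by
    have h3 : 2 ^ Nat.log 2 (n + 2) ≤ n ^ 2 :=
      (Nat.pow_log_le_self 2 (by omega)).trans (by nlinarith)
    have h4 : ((2 : ℝ) ^ Nat.log 2 (n + 2)) ≤ (n : ℝ) ^ 2 := by exact_mod_cast h3
    have h5 := Real.log_le_log (by positivity) h4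
    rw [Real.log_pow, Real.log_pow] at h5
    exact_mod_cast h5
  have h6 : (htBound (n + 1) : ℝ) = 2 * (Nat.log 2 (n + 2) : ℝ) + 1 := by
    simp [htBound]
  rw [h6]
  nlinarith [Nat.cast_nonneg (α := ℝ) (Nat.log 2 (n + 2))]

theorem Inv.time_le [Fintype A] [Fintype P] (hI : Inv cA cP S num c f E s)
    (hP : 1 ≤ Fintype.card P) (hS : 1 ≤ S.length) :
    s.time ≤ 5612 * htBound (Fintype.card A + Fintype.card P + 1) *
      (S.length * Fintype.card P) := by
  have h1 := hI.time
  have hf := hI.tree.free_le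
  have hc := hI.count_le
  have hu : unit A P ≤ 244 * htBound (Fintype.card A + Fintype.card P + 1) := by
    have : 1 ≤ htBound (Fintype.card A + Fintype.card P + 1) := Nat.le_add_left _ _
    unfold unit
    omega
  -- From `f ≤ 2c` and `c ≤ 2n + 1` one gets 2f + 1 ≤ 8n + 5, and 3 + 7 + 8 + 5 = 23. The factor 244
  -- above is 94 + 150.
  have h2 : (3 * Fintype.card P + 7) * S.length + 2 * f + 1 ≤ 23 * (S.length * Fintype.card P) := by
    have : S.length ≤ S.length * Fintype.card P := Nat.le_mul_of_pos_right _ hP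
    have e : (3 * Fintype.card P + 7) * S.length = 3 * (S.length * Fintype.card P) + 7 * S.length := by
      ring
    omega
  calc s.time ≤ unit A P * ((3 * Fintype.card P + 7) * S.length + 2 * f + 1) := by omega
    _ ≤ 244 * htBound (Fintype.card A + Fintype.card P + 1) * (23 * (S.length * Fintype.card P)) :=
        Nat.mul_le_mul hu h2
    _ = _ := by ring

end Final

end PSuffixTree

theorem mainTheorem4 :
    ∃ (alg : PSuffixTree.OnlineAlgorithm) (C : ℝ),
      ∀ (A P : Type*) [Fintype A] [Fintype P] [DecidableEq A] [DecidableEq P]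
        (cA : A → ℕ) (cP : P → ℕ),
        Function.Injective cA → Function.Injective cP →
        1 ≤ Fintype.card P → 2 ≤ Fintype.card A + Fintype.card P →
        ∀ S : List (A ⊕ P), ∃ s : PSuffixTree.State,
          alg.Runs cA cP S s ∧
          (∃ num : List (A ⊕ ℕ) → ℕ,
            PSuffixTree.HoldsTree cA s.mem S
              (C * Real.log ((Fintype.card A : ℝ) + (Fintype.card P : ℝ))) num) ∧
          (S ≠ [] →
            (s.time : ℝ) ≤ C * ((S.length : ℝ) * (Fintype.card P : ℝ) *
              Real.log ((Fintype.card A : ℝ) + (Fintype.card P : ℝ))) ∧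
            (s.space : ℝ) ≤ C * (S.length : ℝ) ∧
            ∀ B : ℕ, (∀ a, cA a ≤ B) → (∀ p, cP p ≤ B) →
              (s.word : ℝ) ≤ C * ((S.length : ℝ) + (B : ℝ))) := by
  -- The constant is 8 · 5612, where 5612 = 244 · 23 comes from `Inv.time_le` and 8 from
  -- `htBound_le`; the bounds for space, word size and heights need much less.
  refine ⟨PSuffixTree.algorithm, 44896, ?_⟩
  intro A P _ _ _ _ cA cP hcA hcP hP hAP S
  obtain ⟨s, hr, hok, num, c, f, E, hI⟩ := PSuffixTree.exists_runs
    (B := max (Finset.univ.sup cA) (Finset.univ.sup cP)) hcA hcP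
    (fun a => le_max_of_le_left (Finset.le_sup (Finset.mem_univ a)))
    (fun p => le_max_of_le_right (Finset.le_sup (Finset.mem_univ p))) S (Nat.lt_succ_self _) le_rfl
  have hlog := PSuffixTree.htBound_le hAP
  have hl0 : 0 ≤ Real.log ((Fintype.card A + Fintype.card P : ℕ) : ℝ) := Real.log_natCast_nonneg _
  rw [← Nat.cast_add]
  refine ⟨s, hr, ⟨num, hI.holdsTree (by linarith)⟩, fun hS => ⟨?_, ?_, fun B h1 h2 => ?_⟩⟩
  · have h1 := hI.time_le hP (List.length_pos_iff.2 hS)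
    have h2 : (s.time : ℝ) ≤
        5612 * (PSuffixTree.htBound (Fintype.card A + Fintype.card P + 1) : ℝ) *
          ((S.length : ℝ) * (Fintype.card P : ℝ)) := by exact_mod_cast h1
    have h3 : (0 : ℝ) ≤ (S.length : ℝ) * (Fintype.card P : ℝ) := by positivity
    calc (s.time : ℝ) ≤ _ := h2
      _ ≤ 5612 * (8 * Real.log ((Fintype.card A + Fintype.card P : ℕ) : ℝ)) *
          ((S.length : ℝ) * (Fintype.card P : ℝ)) := by gcongr
      _ = _ := by ring
  · have h1 := hok.1
    have h2 : 0 < S.length := List.length_pos_iff.2 hS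
    have h3 : s.space ≤ 44896 * S.length := by omega
    exact_mod_cast h3
  · have h3 := hok.2.1
    have h4 : 0 < S.length := List.length_pos_iff.2 hS
    have h5 : max (Finset.univ.sup cA) (Finset.univ.sup cP) ≤ B :=
      max_le (Finset.sup_le fun a _ => h1 a) (Finset.sup_le fun p _ => h2 p)
    have h6 : s.word ≤ 44896 * (S.length + B) := by omega
    exact_mod_cast h6
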